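/- Let $V$ be a real vector space of dimension $\mathfrak n<\infty$ with a positive definite symmetric bilinear form $B$, $Q(x)=\tfrac12B(x,x)$, both extended $\mathbb C$-bilinearly resp. quadratically to $\mathcal V=\mathbb C\otimes V$. Let $L\subset V$ be a full lattice with $B(L,L)\subseteq\mathbb Z$ (it is called even if $Q(L)\subseteq\mathbb Z$, odd otherwise), and $L^\sharp$ its dual lattice. Put $\mathfrak e(x)=e^{2\pi i x}$ and $q^n=\mathfrak e(n\tau)$. **Groups.** $\mathrm{Mp}_2(\mathbb Z)$ is the group of pairs $\gamma=(M,r)$ with $M=\left(\begin{smallmatrix}a&b\\c&d\end{smallmatrix}\right)\in\mathrm{SL}_2(\mathbb Z)$ and $r(\tau)=\pm\sqrt{c\tau+d}$ on the upper half plane $\mathfrak H$, with $(M_1,r_1)(M_2,r_2)=(M_1M_2,\,r_1(M_2\tau)r_2(\tau))$; $\widetilde G$ denotes the preimage of $G\le\mathrm{SL}_2(\mathbb Z)$. $H(L,1)$ is the group of all $([v,w],\xi)$, $v,w\in L$, $\xi=\pm1$, with $$([v_1,w_1],\xi_1)([v_2,w_2],\xi_2)=([v_1+v_2,w_1+w_2],\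 \xi_1\xi_2e^{\pi i(B(v_1,w_2)-B(v_2,w_1))}).$$ $\widetilde G\ltimes H(L,1)$ is formed with the right action $([v,w],\xi)\gamma=([av+cw,bv+dw],\xi)$. For $k\in\frac12\mathbb Z$, a finite-dimensional complex space $\mathcal W$, $\phi:\mathfrak H\times\mathcal V\to\mathcal W$ and $g=(M,r,[v,w],\xi)$ put $$(\phi|_{k,B}\,g)(\tau,z)=r(\tau)^{-2k}\,\xi\,\mathfrak e\Big(\tfrac{-c\,Q(z+\tau v+w)}{c\tau+d}+\tau Q(v)+B(v,z)+\tfrac12B(v,w)\Big)\,\phi\Big(M\tau,\tfrac{z+\tau v+w}{c\tau+d}\Big),$$ and $(h|_k\gamma)(\tau)=r(\tau)^{-2k}h(M\tau)$ for functions $h$ on $\mathfrak H$. **Spaces.** Let $G\le\mathrm{SL}_2(\mathbb Z)$ have finite index and let $\rho$ be a representation of $\widetilde G\ltimes H(L,1)$ on $\mathcal W$ with kernel of finite index. A weakly holomorphic Jacobi form of weight $k$, index $(L,B)$, group $G$ and representation $\rho$ is a holomorphic $\phi:\mathfrak H\times\mathcal V\to\mathcal W$ such that $\phi|_{k,B}\,g=\rho(g)\circ\phi$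 for all $g\in\widetilde G\ltimes H(L,1)$ and such that, for every $g\in\mathrm{Mp}_2(\mathbb Z)\ltimes H(L,1)$, there is an absolutely convergent expansion $$(\phi|_{k,B}\,g)(\tau,z)=\sum_{n,t}c^{g}(n,t)\,q^n\,\mathfrak e(B(t,z)),\qquad n\in\tfrac1N\mathbb Z,\ t\in\tfrac1NL^\sharp$$ for some integer $N\ge1$, with $c^{g}(n,t)=0$ unless $n\ge N_0$ for some $N_0\in\mathbb Q$. It is a Jacobi form (Jacobi cusp form) if instead always $c^{g}(n,t)=0$ unless $n-Q(t)\ge0$ (resp. $>0$). Put $c^g(n,t)=0$ for all other $(n,t)\in\mathbb R\times V$. For a representation $\sigma$ of $\widetilde G$ on a finite-dimensional complex space $X$, weakly holomorphic modular forms (modular forms, cusp forms) of weight $k$ for $G$ and $\sigma$ are the holomorphic $h:\mathfrak H\to X$ with $h|_k\gamma=\sigma(\gamma)\circ h$ for $\gamma\in\widetilde G$ such that for each $\gamma\in\mathrm{Mp}_2(\mathbb Z)$ the function $h|_k\gamma$ has a $q$-expansion with exponents in some $\frac1N\mathbb Z$ that are bounded below (resp. $\ge0$, $>0$). **Theta series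 and Weil representation.** For $t\in L^\sharp/L$ put $\vartheta_{L,t}(\tau,z)=\sum_{v\in t+L}\mathfrak e(\tau Q(v)+B(v,z))$. **Theorem.** Suppose that $\rho([av,bv],1)=\mathrm{id}$ for all coprime integers $a,b$ and all $v\in L$. Here $L$ may be even or odd. (1) For every weakly holomorphic Jacobi form $\phi$ as above and every $\gamma\in\mathrm{Mp}_2(\mathbb Z)$, the coefficients $c^\gamma$ are uniquely determined, the series $$h_t^\gamma(\tau)=\sum_n c^\gamma(n+Q(t),t)\,q^n$$ converge absolutely, depend only on the class $t\in L^\sharp/L$, define holomorphic functions on $\mathfrak H$, and $$\phi|_{k,B}\gamma=\sum_{t\in L^\sharp/L}h_t^\gamma\,\vartheta_{L,t}.$$ (2) Suppose moreover that $L$ is even. There is a unique representation $\rho_L$ of $\mathrm{Mp}_2(\mathbb Z)\ltimes H(L,1)$ on $\mathbb C[L^\sharp/L]$ (the Weil representation) with $$\rho_L\big(\left(\begin{smallmatrix}1&1\\0&1\end{smallmatrix}\right),1\big)\delta_x=\mathfrak e(Q(x))\delta_x,\qquad \rho_L\big(\left(\begin{smallmatrix}0&-1\\1&0\end{smallmatrix}\right),\sqrt\tau\big)\delta_x=\frac{(-i)^{\mathfrak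 n/2}}{\sqrt{|L^\sharp/L|}}\sum_{y\in L^\sharp/L}\mathfrak e(-B(x,y))\delta_y,$$ $$\rho_L([v,w],\xi)\delta_x=\xi\,\mathfrak e(\tfrac12B(v,w))\delta_x .$$ Let $\rho_L^*$ be its dual and $\delta_t^*$ the dual basis. The map sending $\phi=\sum_{n,t}c(n,t)q^n\mathfrak e(B(t,z))$ to $$h(\tau)=\sum_n\Big(\sum_{t\in L^\sharp/L}c(n+Q(t),t)\otimes\delta_t^*\Big)q^n\in\mathcal W\otimes\mathbb C[L^\sharp/L]^*$$ is a well-defined injective $\mathbb C$-linear map from the weakly holomorphic Jacobi forms of weight $k$, index $(L,B)$, group $G$ and representation $\rho$ into the weakly holomorphic modular forms of weight $k-\mathfrak n/2$ for $G$ and $(\rho\otimes\rho_L^*)|_{\widetilde G}$. It maps Jacobi forms to modular forms and Jacobi cusp forms to cusp forms. -/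

import Mathlib

open Complex UpperHalfPlane Matrix.SpecialLinearGroup
open scoped TensorProduct MatrixGroups

namespace LatticeJacobi

noncomputable section

/-! ### Lattices and discriminant groups -/

/-- A positive definite integral lattice `(L, B)` of full rank in a finite-dimensional real vector
space `V`: `B` is a positive definite symmetric bilinear form on `V`, `L` is the `ℤ`-span of an
`ℝ`-basis of `V`, and `B` takes integral values on `L`. -/
structure IntegralLattice (V : Type*) [AddCommGroup V] [Module ℝ V] where
  carrier : Submodule ℤ V
  form : LinearMap.BilinForm ℝ V
  symm : ∀ x y, form x y = form y x
  posDef : ∀ x, x ≠ 0 → 0 < form x x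
  exists_basis : ∃ b : Module.Basis (Fin (Module.finrank ℝ V)) ℝ V,
    carrier = Submodule.span ℤ (Set.range b)
  integral : ∀ x ∈ carrier, ∀ y ∈ carrier, ∃ m : ℤ, form x y = m

section Lattice

variable {V : Type*} [AddCommGroup V] [Module ℝ V] (L : IntegralLattice V)

namespace IntegralLattice

/-- The quadratic form `Q(x) = B(x, x) / 2`. -/
def Q (x : V) : ℝ := L.form x x / 2

/-- The lattice is even if `Q` is integral on it. -/
def IsEven : Prop := ∀ x ∈ L.carrier, ∃ m : ℤ, L.Q x = m

/-- The dual lattice `L♯ = {x | B(x, L) ⊆ ℤ}`. -/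
def dual : Submodule ℤ V := L.form.dualSubmodule L.carrier

theorem carrier_le_dual : L.carrier ≤ L.dual := by
  intro x hx y hy
  obtain ⟨m, hm⟩ := L.integral x hx y hy
  exact Submodule.mem_one.mpr ⟨m, by simp [hm]⟩

/-- The discriminant group `L♯ / L`. -/
abbrev Disc : Type _ := L.dual ⧸ L.carrier.submoduleOf L.dual

/-- The class in `L♯ / L` of an element of `L♯`. -/
abbrev toDisc (t : L.dual) : L.Disc := Submodule.Quotient.mk t

theorem nondegenerate : L.form.Nondegenerate := by
  constructor
  · intro x hx
    by_contra h
    exact (L.posDef x h).ne' (hx x)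
  · intro x hx
    by_contra h
    exact (L.posDef x h).ne' (hx x)

instance finite_disc : Finite L.Disc := by
  classical
  obtain ⟨b, hb⟩ := L.exists_basis
  have hd : L.dual =
      Submodule.span ℤ (Set.range (L.form.dualBasis L.nondegenerate b)) := by
    rw [dual, hb, LinearMap.BilinForm.dualSubmodule_span_of_basis]
  have key : ∀ (c : Module.Basis (Fin (Module.finrank ℝ V)) ℝ V) (N : Submodule ℤ V),
      N = Submodule.span ℤ (Set.range c) →
      Nonempty (Module.Basis (Fin (Module.finrank ℝ V)) ℤ N) := by
    intro c N hN
    subst hN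
    exact ⟨Module.Basis.span (c.linearIndependent.restrict_scalars' ℤ)⟩
  obtain ⟨bL⟩ := key b _ hb
  obtain ⟨bD⟩ := key _ _ hd
  have : Module.Free ℤ L.dual := Module.Free.of_basis bD
  have : Module.Finite ℤ L.dual := Module.Finite.of_basis bD
  apply Submodule.finiteQuotientOfFreeOfRankEq
  rw [(Submodule.submoduleOfEquivOfLe L.carrier_le_dual).finrank_eq,
    Module.finrank_eq_card_basis bL, Module.finrank_eq_card_basis bD]

instance fintype_disc : Fintype L.Disc := Fintype.ofFinite _

/-- The `ℂ`-bilinear extension of `B` to the complexification of `V`. -/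
def formC : LinearMap.BilinForm ℂ (ℂ ⊗[ℝ] V) := L.form.baseChange ℂ

/-- The extension of `Q` to the complexification of `V`. -/
def QC (z : ℂ ⊗[ℝ] V) : ℂ := L.formC z z / 2

/-- `A([v₁, w₁], [v₂, w₂]) = B(v₁, w₂) - B(v₂, w₁)`. -/
def altForm (v₁ w₁ v₂ w₂ : V) : ℝ := L.form v₁ w₂ - L.form v₂ w₁

end IntegralLattice

end Lattice

/-- `e(x) = exp(2πix)`. -/
def e (x : ℂ) : ℂ := Complex.exp (2 * Real.pi * Complex.I * x)

/-! ### The metaplectic group over `ℤ` -/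

/-- The double cover of `SL₂(ℤ)`: pairs of a matrix with bottom row `(c, d)` and one of the two
continuous square roots of `τ ↦ cτ + d` on the upper half plane, that is, one of the two functions
`± (cτ + d)^(1/2)`. -/
@[ext]
structure Mp2Z where
  mat : SL(2, ℤ)
  root : ℍ → ℂ
  continuous_root : Continuous root
  sq_root : ∀ τ : ℍ, root τ ^ 2 = (mat 1 0 : ℂ) * τ + (mat 1 1 : ℂ)

theorem denom_mul (g h : SL(2, ℤ)) (τ : ℍ) :
    (((g * h) 1 0 : ℤ) : ℂ) * τ + (((g * h) 1 1 : ℤ) : ℂ) =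
      ((g 1 0 : ℂ) * ↑(h • τ) + (g 1 1 : ℂ)) * ((h 1 0 : ℂ) * τ + (h 1 1 : ℂ)) := by
  have := UpperHalfPlane.denom_cocycle_σ (g : GL (Fin 2) ℝ) (h : GL (Fin 2) ℝ) τ
  have hne : ((h 1 0 : ℂ) * τ + (h 1 1 : ℂ)) ≠ 0 := by
    simpa [UpperHalfPlane.denom] using UpperHalfPlane.denom_ne_zero (h : GL (Fin 2) ℝ) τ
  rw [UpperHalfPlane.coe_specialLinearGroup_apply]
  simp only [Matrix.SpecialLinearGroup.coe_mul, Matrix.mul_apply, Fin.sum_univ_two]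
  push_cast
  simp only [eq_intCast, Complex.ofReal_intCast]
  field_simp
  ring

theorem denom_ne (g : SL(2, ℤ)) (τ : ℍ) : (g 1 0 : ℂ) * τ + (g 1 1 : ℂ) ≠ 0 := by
  simpa [UpperHalfPlane.denom] using UpperHalfPlane.denom_ne_zero (g : GL (Fin 2) ℝ) τ

namespace Mp2Z

theorem root_ne_zero (g : Mp2Z) (τ : ℍ) : g.root τ ≠ 0 := by
  intro h
  have := g.sq_root τ
  rw [h] at this
  exact denom_ne g.mat τ (by rw [← this]; simp)

theorem continuous_smul (g : SL(2, ℤ)) : Continuous fun τ : ℍ => g • τ :=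
  continuous_const_smul (g : GL (Fin 2) ℝ)

instance : One Mp2Z :=
  ⟨⟨1, fun _ => 1, continuous_const, fun τ => by simp⟩⟩

instance : Mul Mp2Z :=
  ⟨fun g h => ⟨g.mat * h.mat, fun τ => g.root (h.mat • τ) * h.root τ,
    (g.continuous_root.comp (continuous_smul h.mat)).mul h.continuous_root, fun τ => by
      rw [mul_pow, g.sq_root, h.sq_root, denom_mul]⟩⟩

instance : Inv Mp2Z :=
  ⟨fun g => ⟨g.mat⁻¹, fun τ => (g.root (g.mat⁻¹ • τ))⁻¹,
    (g.continuous_root.comp (continuous_smul g.mat⁻¹)).inv₀ fun τ => g.root_ne_zero _,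
    fun τ => by
      have h := denom_mul g.mat g.mat⁻¹ τ
      rw [mul_inv_cancel] at h
      rw [inv_pow, g.sq_root, inv_eq_iff_eq_inv, eq_comm, inv_eq_of_mul_eq_one_left]
      rw [← h]
      simp⟩⟩

theorem mat_one : (1 : Mp2Z).mat = 1 := rfl
theorem root_one (τ : ℍ) : (1 : Mp2Z).root τ = 1 := rfl
theorem mat_mul (g h : Mp2Z) : (g * h).mat = g.mat * h.mat := rfl
theorem root_mul (g h : Mp2Z) (τ : ℍ) :
    (g * h).root τ = g.root (h.mat • τ) * h.root τ := rfl
theorem mat_inv (g : Mp2Z) : (g⁻¹).mat = g.mat⁻¹ := rfl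
theorem root_inv (g : Mp2Z) (τ : ℍ) : (g⁻¹).root τ = (g.root (g.mat⁻¹ • τ))⁻¹ := rfl

/-- The product of the metaplectic group is
`(M₁, r₁(τ)) (M₂, r₂(τ)) = (M₁ M₂, r₁(M₂ τ) r₂(τ))`. -/
instance : Group Mp2Z :=
  Group.ofLeftAxioms
    (fun a b c => by
      ext τ
      · simp only [mat_mul, mul_assoc]
      · simp only [root_mul, mat_mul, mul_smul, mul_assoc])
    (fun a => by
      ext τ
      · simp only [mat_mul, mat_one, one_mul]
      · simp only [root_mul, root_one, one_mul])
    (fun a => by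
      ext τ
      · simp only [mat_mul, mat_inv, mat_one, inv_mul_cancel]
      · rw [root_mul, root_inv, inv_smul_smul, root_one,
          inv_mul_cancel₀ (a.root_ne_zero τ)])

/-- The projection to `SL₂(ℤ)`. -/
def proj : Mp2Z →* SL(2, ℤ) where
  toFun := mat
  map_one' := rfl
  map_mul' _ _ := rfl

/-- The preimage in the double cover of a subgroup of `SL₂(ℤ)`. -/
def preimage (G : Subgroup SL(2, ℤ)) : Subgroup Mp2Z := G.comap proj

/-- `(T, 1)` with `T = (1 1; 0 1)`. -/
def T : Mp2Z := ⟨ModularGroup.T, fun _ => 1, continuous_const, fun τ => by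
  simp [ModularGroup.T]⟩

/-- `(S, τ ^ (1/2))` with `S = (0 -1; 1 0)` and the principal square root. -/
def S : Mp2Z := ⟨ModularGroup.S, fun τ => (τ : ℂ) ^ (1 / 2 : ℂ),
  UpperHalfPlane.continuous_coe.cpow continuous_const fun τ => Or.inr τ.im_pos.ne',
  fun τ => by
    rw [← Complex.cpow_nat_mul]
    simp [ModularGroup.S]⟩

end Mp2Z

/-! ### The Jacobi group -/

section Jacobi

variable {V : Type*} [AddCommGroup V] [Module ℝ V]

/-- The semidirect product of the double cover of `SL₂(ℤ)` with the Heisenberg group of `(V, B)`;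
the element `(γ, [v, w], ξ)` is the product of `γ` and `([v, w], ξ)`. -/
@[ext]
structure JacobiGroup (L : IntegralLattice V) where
  mp : Mp2Z
  v : V
  w : V
  ξ : Circle

namespace JacobiGroup

variable {L : IntegralLattice V}

instance : One (JacobiGroup L) := ⟨⟨1, 0, 0, 1⟩⟩

/-- `(γ₁, h₁) (γ₂, h₂) = (γ₁ γ₂, (h₁ γ₂) h₂)`, where `([v, w], ξ) γ = ([av + cw, bv + dw], ξ)` and
`([v₁, w₁], ξ₁) ([v₂, w₂], ξ₂) = ([v₁ + v₂, w₁ + w₂], ξ₁ ξ₂ exp(πi A([v₁, w₁], [v₂, w₂])))`. -/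
instance : Mul (JacobiGroup L) :=
  ⟨fun g h =>
    let v' := h.mp.mat 0 0 • g.v + h.mp.mat 1 0 • g.w
    let w' := h.mp.mat 0 1 • g.v + h.mp.mat 1 1 • g.w
    ⟨g.mp * h.mp, v' + h.v, w' + h.w,
      g.ξ * h.ξ * Circle.exp (Real.pi * L.altForm v' w' h.v h.w)⟩⟩

instance : Inv (JacobiGroup L) :=
  ⟨fun g =>
    let m := (g.mp⁻¹).mat
    ⟨g.mp⁻¹, -(m 0 0 • g.v + m 1 0 • g.w), -(m 0 1 • g.v + m 1 1 • g.w), g.ξ⁻¹⟩⟩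

theorem mp_mul (g h : JacobiGroup L) : (g * h).mp = g.mp * h.mp := rfl
theorem v_mul (g h : JacobiGroup L) :
    (g * h).v = h.mp.mat 0 0 • g.v + h.mp.mat 1 0 • g.w + h.v := rfl
theorem w_mul (g h : JacobiGroup L) :
    (g * h).w = h.mp.mat 0 1 • g.v + h.mp.mat 1 1 • g.w + h.w := rfl
theorem xi_mul (g h : JacobiGroup L) : (g * h).ξ = g.ξ * h.ξ * Circle.exp (Real.pi *
    L.altForm (h.mp.mat 0 0 • g.v + h.mp.mat 1 0 • g.w)
      (h.mp.mat 0 1 • g.v + h.mp.mat 1 1 • g.w) h.v h.w) := rfl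
theorem mp_one : (1 : JacobiGroup L).mp = 1 := rfl
theorem v_one : (1 : JacobiGroup L).v = 0 := rfl
theorem w_one : (1 : JacobiGroup L).w = 0 := rfl
theorem xi_one : (1 : JacobiGroup L).ξ = 1 := rfl
theorem mp_inv (g : JacobiGroup L) : (g⁻¹).mp = g.mp⁻¹ := rfl
theorem v_inv (g : JacobiGroup L) :
    (g⁻¹).v = -((g.mp⁻¹).mat 0 0 • g.v + (g.mp⁻¹).mat 1 0 • g.w) := rfl
theorem w_inv (g : JacobiGroup L) :
    (g⁻¹).w = -((g.mp⁻¹).mat 0 1 • g.v + (g.mp⁻¹).mat 1 1 • g.w) := rfl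
theorem xi_inv (g : JacobiGroup L) : (g⁻¹).ξ = g.ξ⁻¹ := rfl

theorem det_eq (m : SL(2, ℤ)) : (m 0 0 : ℝ) * m 1 1 - m 0 1 * m 1 0 = 1 := by
  have := m.det_coe
  rw [Matrix.det_fin_two] at this
  exact_mod_cast this

theorem inv_entries (m : SL(2, ℤ)) : m⁻¹ 0 0 = m 1 1 ∧ m⁻¹ 0 1 = -m 0 1 ∧
    m⁻¹ 1 0 = -m 1 0 ∧ m⁻¹ 1 1 = m 0 0 := by
  simp [Matrix.SpecialLinearGroup.coe_inv, Matrix.adjugate_fin_two]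

theorem altForm_act (m : SL(2, ℤ)) (v w v' w' : V) :
    L.altForm (m 0 0 • v + m 1 0 • w) (m 0 1 • v + m 1 1 • w)
      (m 0 0 • v' + m 1 0 • w') (m 0 1 • v' + m 1 1 • w') = L.altForm v w v' w' := by
  have h := det_eq m
  simp only [IntegralLattice.altForm, ← Int.cast_smul_eq_zsmul ℝ, map_add, map_smul,
    LinearMap.add_apply, LinearMap.smul_apply, smul_eq_mul]
  rw [L.symm v' v, L.symm w' v, L.symm v' w, L.symm w' w]
  linear_combination (L.form v w' - L.form w v') * h

theorem altForm_add_left (v₁ w₁ v₂ w₂ v w : V) : L.altForm (v₁ + v₂) (w₁ + w₂) v w =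
    L.altForm v₁ w₁ v w + L.altForm v₂ w₂ v w := by
  simp only [IntegralLattice.altForm, map_add, LinearMap.add_apply]
  ring

theorem altForm_add_right (v w v₁ w₁ v₂ w₂ : V) : L.altForm v w (v₁ + v₂) (w₁ + w₂) =
    L.altForm v w v₁ w₁ + L.altForm v w v₂ w₂ := by
  simp only [IntegralLattice.altForm, map_add, LinearMap.add_apply]
  ring

theorem act_act (m m' : SL(2, ℤ)) (j : Fin 2) (v w : V) :
    m' 0 j • (m 0 0 • v + m 1 0 • w) + m' 1 j • (m 0 1 • v + m 1 1 • w) =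
      (m * m') 0 j • v + (m * m') 1 j • w := by
  simp only [Matrix.SpecialLinearGroup.coe_mul, Matrix.mul_apply, Fin.sum_univ_two]
  module

instance : Group (JacobiGroup L) :=
  Group.ofLeftAxioms
    (fun a b c => by
      ext1
      · simp only [mp_mul, mul_assoc]
      · simp only [v_mul, w_mul, mp_mul, Mp2Z.mat_mul, ← act_act]
        module
      · simp only [v_mul, w_mul, mp_mul, Mp2Z.mat_mul, ← act_act]
        module
      · simp only [xi_mul, v_mul, w_mul, mp_mul, Mp2Z.mat_mul, ← act_act]
        have h1 : L.altForm
            (c.mp.mat 0 0 • (b.mp.mat 0 0 • a.v + b.mp.mat 1 0 • a.w + b.v) +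
              c.mp.mat 1 0 • (b.mp.mat 0 1 • a.v + b.mp.mat 1 1 • a.w + b.w))
            (c.mp.mat 0 1 • (b.mp.mat 0 0 • a.v + b.mp.mat 1 0 • a.w + b.v) +
              c.mp.mat 1 1 • (b.mp.mat 0 1 • a.v + b.mp.mat 1 1 • a.w + b.w)) c.v c.w =
            L.altForm
              (c.mp.mat 0 0 • (b.mp.mat 0 0 • a.v + b.mp.mat 1 0 • a.w) +
                c.mp.mat 1 0 • (b.mp.mat 0 1 • a.v + b.mp.mat 1 1 • a.w))
              (c.mp.mat 0 1 • (b.mp.mat 0 0 • a.v + b.mp.mat 1 0 • a.w) +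
                c.mp.mat 1 1 • (b.mp.mat 0 1 • a.v + b.mp.mat 1 1 • a.w)) c.v c.w +
            L.altForm (c.mp.mat 0 0 • b.v + c.mp.mat 1 0 • b.w)
              (c.mp.mat 0 1 • b.v + c.mp.mat 1 1 • b.w) c.v c.w := by
          rw [← altForm_add_left]
          congr 1 <;> module
        rw [h1, altForm_add_right, altForm_act]
        rw [mul_add, mul_add, Circle.exp_add, Circle.exp_add]
        generalize Circle.exp (Real.pi * L.altForm _ _ b.v b.w) = x
        generalize Circle.exp (Real.pi * L.altForm _ _ c.v c.w) = y
        generalize Circle.exp (Real.pi * L.altForm _ _ c.v c.w) = y'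
        rw [mul_assoc, mul_assoc, mul_assoc, mul_assoc, mul_assoc, mul_left_comm x, mul_left_comm x]
        simp only [mul_assoc, mul_left_comm, mul_comm])
    (fun a => by
      ext1
      · simp only [mp_mul, mp_one, one_mul]
      · simp [v_mul, v_one, w_one]
      · simp [w_mul, v_one, w_one]
      · simp [xi_mul, v_one, w_one, xi_one, IntegralLattice.altForm])
    (fun a => by
      obtain ⟨h1, h2, h3, h4⟩ := inv_entries a.mp.mat
      have hd : a.mp.mat 0 0 * a.mp.mat 1 1 - a.mp.mat 0 1 * a.mp.mat 1 0 = 1 := by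
        exact_mod_cast det_eq a.mp.mat
      have hv : a.mp.mat 0 0 • (a⁻¹).v + a.mp.mat 1 0 • (a⁻¹).w = -a.v := by
        have := act_act a.mp.mat⁻¹ a.mp.mat 0 a.v a.w
        rw [inv_mul_cancel] at this
        simp only [v_inv, w_inv, smul_neg, ← neg_add, Mp2Z.mat_inv, this]
        simp
      have hw : a.mp.mat 0 1 • (a⁻¹).v + a.mp.mat 1 1 • (a⁻¹).w = -a.w := by
        have := act_act a.mp.mat⁻¹ a.mp.mat 1 a.v a.w
        rw [inv_mul_cancel] at this
        simp only [v_inv, w_inv, smul_neg, ← neg_add, Mp2Z.mat_inv, this]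
        simp
      ext1
      · simp only [mp_mul, mp_inv, mp_one, inv_mul_cancel]
      · rw [v_mul, hv, v_one, neg_add_cancel]
      · rw [w_mul, hw, w_one, neg_add_cancel]
      · rw [xi_mul, hv, hw, xi_inv, xi_one, inv_mul_cancel, one_mul]
        have : L.altForm (-a.v) (-a.w) a.v a.w = 0 := by
          simp [IntegralLattice.altForm]
        rw [this, mul_zero, Circle.exp_zero])

end JacobiGroup

/-- `γ ↦ (γ, [0, 0], 1)`. -/
def ofMp (L : IntegralLattice V) : Mp2Z →* JacobiGroup L where
  toFun γ := ⟨γ, 0, 0, 1⟩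
  map_one' := rfl
  map_mul' γ γ' := by
    ext1 <;> simp [JacobiGroup.mp_mul, JacobiGroup.v_mul, JacobiGroup.w_mul, JacobiGroup.xi_mul,
      IntegralLattice.altForm]

/-- `([v, w], ξ)` as an element of the Jacobi group. -/
def heis (L : IntegralLattice V) (v w : V) (ξ : Circle) : JacobiGroup L := ⟨1, v, w, ξ⟩

/-- The subgroup of all `(γ, [v, w], ξ)` with `γ` above `G`, with `v, w ∈ L` and `ξ = ±1`. -/
def jacobiSubgroup (L : IntegralLattice V) (G : Subgroup SL(2, ℤ)) : Subgroup (JacobiGroup L) where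
  carrier := {g | g.mp ∈ Mp2Z.preimage G ∧ g.v ∈ L.carrier ∧ g.w ∈ L.carrier ∧ g.ξ ^ 2 = 1}
  one_mem' := ⟨one_mem _, zero_mem _, zero_mem _, one_pow 2⟩
  mul_mem' := by
    rintro g h ⟨h1, h2, h3, h4⟩ ⟨k1, k2, k3, k4⟩
    have hv := add_mem (L.carrier.smul_mem (h.mp.mat 0 0) h2) (L.carrier.smul_mem (h.mp.mat 1 0) h3)
    have hw := add_mem (L.carrier.smul_mem (h.mp.mat 0 1) h2) (L.carrier.smul_mem (h.mp.mat 1 1) h3)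
    refine ⟨mul_mem h1 k1, add_mem hv k2, add_mem hw k3, ?_⟩
    rw [JacobiGroup.xi_mul, mul_pow, mul_pow, h4, k4, one_mul, one_mul]
    obtain ⟨m, hm⟩ := L.integral _ hv _ k3
    obtain ⟨n, hn⟩ := L.integral _ k2 _ hw
    rw [IntegralLattice.altForm, hm, hn, pow_two, ← Circle.exp_add, Circle.exp_eq_one]
    exact ⟨m - n, by push_cast; ring⟩
  inv_mem' := by
    rintro g ⟨h1, h2, h3, h4⟩
    refine ⟨inv_mem h1, ?_, ?_, ?_⟩
    · exact neg_mem (add_mem (L.carrier.smul_mem _ h2) (L.carrier.smul_mem _ h3))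
    · exact neg_mem (add_mem (L.carrier.smul_mem _ h2) (L.carrier.smul_mem _ h3))
    · rw [JacobiGroup.xi_inv, inv_pow, h4, inv_one]

theorem jacobiSubgroup_le_top (L : IntegralLattice V) (G : Subgroup SL(2, ℤ)) :
    jacobiSubgroup L G ≤ jacobiSubgroup L ⊤ :=
  fun _ h => ⟨trivial, h.2⟩

/-- The embedding of the preimage of `G` in the double cover into the Jacobi group of `G`. -/
def mpToJacobi (L : IntegralLattice V) (G : Subgroup SL(2, ℤ)) :
    Mp2Z.preimage G →* jacobiSubgroup L G :=
  ((ofMp L).comp (Mp2Z.preimage G).subtype).codRestrict _ fun γ =>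
    ⟨γ.2, zero_mem _, zero_mem _, one_pow 2⟩

end Jacobi

/-! ### Convergence and holomorphy for values in a finite-dimensional complex space

A finite-dimensional complex vector space has a unique Hausdorff vector space topology; convergence
and holomorphy with respect to it can be tested on all linear functionals. -/

section Topology

variable {X : Type*} [AddCommGroup X] [Module ℂ X]

/-- Unconditional (equivalently, absolute) convergence of `∑ f i` to `x`. -/
def VHasSum {ι : Type*} (f : ι → X) (x : X) : Prop :=
  ∀ l : Module.Dual ℂ X, HasSum (fun i => l (f i)) (l x)

theorem VHasSum.add {ι : Type*} {f g : ι → X} {x y : X} (hf : VHasSum f x) (hg : VHasSum g y) :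
    VHasSum (fun i => f i + g i) (x + y) := fun l => by
  simpa only [map_add] using (hf l).add (hg l)

theorem VHasSum.smul {ι : Type*} {f : ι → X} {x : X} (a : ℂ) (hf : VHasSum f x) :
    VHasSum (fun i => a • f i) (a • x) := fun l => by
  simpa only [map_smul, smul_eq_mul] using (hf l).mul_left a

/-- Holomorphic functions on the upper half plane. -/
def IsHol (h : ℍ → X) : Prop :=
  ∀ l : Module.Dual ℂ X, DifferentiableOn ℂ (fun τ : ℂ => l (h (ofComplex τ))) {τ | 0 < τ.im}

/-- Holomorphic functions on the product of the upper half plane and the complexification of `V`,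
in the coordinates given by any basis of `V`. -/
def IsHolJ {V : Type*} [AddCommGroup V] [Module ℝ V] (F : ℍ → ℂ ⊗[ℝ] V → X) : Prop :=
  ∀ (b : Module.Basis (Fin (Module.finrank ℝ V)) ℝ V) (l : Module.Dual ℂ X),
    DifferentiableOn ℂ
      (fun p : ℂ × (Fin (Module.finrank ℝ V) → ℂ) =>
        l (F (ofComplex p.1) (∑ i, p.2 i ⊗ₜ[ℝ] b i)))
      {p | 0 < p.1.im}

end Topology

/-! ### Jacobi forms of lattice index -/

section JacobiForms

variable {V : Type*} [AddCommGroup V] [Module ℝ V] {W : Type*} [AddCommGroup W] [Module ℂ W]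
variable {L : IntegralLattice V} {G : Subgroup SL(2, ℤ)}

/-- The point `z + τ v + w` of the complexification of `V`. -/
def translate (v w : V) (τ : ℍ) (z : ℂ ⊗[ℝ] V) : ℂ ⊗[ℝ] V :=
  z + (τ : ℂ) ⊗ₜ[ℝ] v + (1 : ℂ) ⊗ₜ[ℝ] w

/-- The automorphic factor `J_B`. -/
def jacobiFactor (g : JacobiGroup L) (τ : ℍ) (z : ℂ ⊗[ℝ] V) : ℂ :=
  (g.ξ : ℂ) * e (-((g.mp.mat 1 0 : ℂ) / ((g.mp.mat 1 0 : ℂ) * τ + (g.mp.mat 1 1 : ℂ)))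
      * L.QC (translate g.v g.w τ z)
    + τ * L.Q g.v + L.formC ((1 : ℂ) ⊗ₜ[ℝ] g.v) z + (1 / 2) * L.form g.v g.w)

/-- The slash operator of weight `κ / 2` and form `B`. -/
def jacobiSlash (κ : ℤ) (F : ℍ → ℂ ⊗[ℝ] V → W) (g : JacobiGroup L) : ℍ → ℂ ⊗[ℝ] V → W :=
  fun τ z => (g.mp.root τ ^ (-κ) * jacobiFactor g τ z) •
    F (g.mp.mat • τ)
      (((g.mp.mat 1 0 : ℂ) * τ + (g.mp.mat 1 1 : ℂ))⁻¹ • translate g.v g.w τ z)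

theorem jacobiSlash_add (κ : ℤ) (F F' : ℍ → ℂ ⊗[ℝ] V → W) (g : JacobiGroup L) :
    jacobiSlash κ (F + F') g = jacobiSlash κ F g + jacobiSlash κ F' g := by
  ext τ z
  simp [jacobiSlash]

theorem jacobiSlash_smul (κ : ℤ) (a : ℂ) (F : ℍ → ℂ ⊗[ℝ] V → W) (g : JacobiGroup L) :
    jacobiSlash κ (a • F) g = a • jacobiSlash κ F g := by
  ext τ z
  simp [jacobiSlash, smul_comm a]

theorem jacobiSlash_zero (κ : ℤ) (g : JacobiGroup L) :
    jacobiSlash κ (0 : ℍ → ℂ ⊗[ℝ] V → W) g = 0 := by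
  ext τ z
  simp [jacobiSlash]

/-- `F(τ, z) = ∑ c(n, t) qⁿ e(B(t, z))`, where for some positive integer `N` the sum is over
`n ∈ (1/N)ℤ` and `t ∈ (1/N)L♯` (that is, `c` vanishes elsewhere on `ℝ × V`) and the series converges
absolutely at every `(τ, z)`. For such exponents this forces normal convergence on compact sets. -/
structure IsFourierExpansion (L : IntegralLattice V) (F : ℍ → ℂ ⊗[ℝ] V → W) (c : ℝ → V → W) :
    Prop where
  support : ∃ N : ℕ, 0 < N ∧ ∀ n t, c n t ≠ 0 →
    (∃ m : ℤ, (N : ℝ) * n = m) ∧ (N : ℤ) • t ∈ L.dual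
  hasSum : ∀ (τ : ℍ) (z : ℂ ⊗[ℝ] V), VHasSum
    (fun p : ℝ × V => (e (p.1 * τ) * e (L.formC ((1 : ℂ) ⊗ₜ[ℝ] p.2) z)) • c p.1 p.2) (F τ z)

theorem IsFourierExpansion.add {F F' : ℍ → ℂ ⊗[ℝ] V → W} {c c' : ℝ → V → W}
    (h : IsFourierExpansion L F c) (h' : IsFourierExpansion L F' c') :
    IsFourierExpansion L (F + F') (c + c') where
  support := by
    obtain ⟨N, hN, H⟩ := h.support
    obtain ⟨N', hN', H'⟩ := h'.support
    refine ⟨N * N', Nat.mul_pos hN hN', fun n t hnt => ?_⟩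
    by_cases hc : c n t = 0
    · have hc' : c' n t ≠ 0 := fun h0 => hnt (by simp [hc, h0])
      obtain ⟨⟨m, hm⟩, ht⟩ := H' n t hc'
      refine ⟨⟨N * m, by push_cast; rw [← hm]; ring⟩, ?_⟩
      push_cast
      rw [mul_smul]
      exact L.dual.smul_mem _ ht
    · obtain ⟨⟨m, hm⟩, ht⟩ := H n t hc
      refine ⟨⟨N' * m, by push_cast; rw [← hm]; ring⟩, ?_⟩
      push_cast
      rw [mul_comm, mul_smul]
      exact L.dual.smul_mem _ ht
  hasSum τ z := by
    simpa only [Pi.add_apply, smul_add] using (h.hasSum τ z).add (h'.hasSum τ z)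

theorem IsFourierExpansion.smul {F : ℍ → ℂ ⊗[ℝ] V → W} {c : ℝ → V → W} (a : ℂ)
    (h : IsFourierExpansion L F c) : IsFourierExpansion L (a • F) (a • c) where
  support := by
    obtain ⟨N, hN, H⟩ := h.support
    exact ⟨N, hN, fun n t hnt => H n t fun h0 => hnt (by simp [h0])⟩
  hasSum τ z := by
    simpa only [Pi.smul_apply, smul_comm a] using (h.hasSum τ z).smul a

theorem IsFourierExpansion.zero : IsFourierExpansion L (0 : ℍ → ℂ ⊗[ℝ] V → W) 0 where
  support := ⟨1, one_pos, fun n t h => absurd rfl h⟩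
  hasSum τ z l := by simpa using hasSum_zero

/-- Holomorphic functions transforming like a Jacobi form of weight `κ / 2` and index `(L, B)` under
`G` with the representation `ρ`. -/
def jacobiHol (κ : ℤ) (ρ : Representation ℂ (jacobiSubgroup L G) W) :
    Submodule ℂ (ℍ → ℂ ⊗[ℝ] V → W) where
  carrier := {φ | IsHolJ φ ∧ ∀ (g : jacobiSubgroup L G) τ z,
    jacobiSlash κ φ (g : JacobiGroup L) τ z = ρ g (φ τ z)}
  zero_mem' := ⟨fun b l => by simp, fun g τ z => by simp [jacobiSlash]⟩
  add_mem' := by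
    rintro φ ψ ⟨h1, h2⟩ ⟨k1, k2⟩
    refine ⟨fun b l => ?_, fun g τ z => ?_⟩
    · simpa only [Pi.add_apply, map_add] using (h1 b l).fun_add (k1 b l)
    · simp [jacobiSlash_add, h2, k2]
  smul_mem' := by
    rintro a φ ⟨h1, h2⟩
    refine ⟨fun b l => ?_, fun g τ z => ?_⟩
    · simpa only [Pi.smul_apply, map_smul] using (h1 b l).fun_const_smul a
    · simp [jacobiSlash_smul, h2]

/-- Weakly holomorphic Jacobi forms. -/
def weaklyHolJacobiForms (κ : ℤ) (ρ : Representation ℂ (jacobiSubgroup L G) W) :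
    Submodule ℂ (ℍ → ℂ ⊗[ℝ] V → W) where
  carrier := {φ | φ ∈ jacobiHol κ ρ ∧ ∀ g ∈ jacobiSubgroup L ⊤, ∃ (N₀ : ℚ) (c : ℝ → V → W),
    IsFourierExpansion L (jacobiSlash κ φ g) c ∧ ∀ n t, c n t ≠ 0 → (N₀ : ℝ) ≤ n}
  zero_mem' := ⟨zero_mem _, fun g _ => ⟨0, 0, by
    rw [jacobiSlash_zero]; exact .zero, fun n t h => absurd rfl h⟩⟩
  add_mem' := by
    rintro φ ψ ⟨h1, h2⟩ ⟨k1, k2⟩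
    refine ⟨add_mem h1 k1, fun g hg => ?_⟩
    obtain ⟨N, c, hc, hN⟩ := h2 g hg
    obtain ⟨N', c', hc', hN'⟩ := k2 g hg
    refine ⟨min N N', c + c', by rw [jacobiSlash_add]; exact hc.add hc', fun n t h => ?_⟩
    by_cases h0 : c n t = 0
    · have h0' : c' n t ≠ 0 := fun h' => h (by simp [h0, h'])
      exact le_trans (by exact_mod_cast min_le_right N N') (hN' n t h0')
    · exact le_trans (by exact_mod_cast min_le_left N N') (hN n t h0)
  smul_mem' := by
    rintro a φ ⟨h1, h2⟩
    refine ⟨Submodule.smul_mem _ a h1, fun g hg => ?_⟩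
    obtain ⟨N, c, hc, hN⟩ := h2 g hg
    exact ⟨N, a • c, by rw [jacobiSlash_smul]; exact hc.smul a,
      fun n t h => hN n t fun h0 => h (by simp [h0])⟩

/-- Jacobi forms whose Fourier expansions at all cusps are supported on the `(n, t)` with
`P (n - Q(t))`. -/
def jacobiFormsWith (P : ℝ → Prop) (κ : ℤ) (ρ : Representation ℂ (jacobiSubgroup L G) W) :
    Submodule ℂ (ℍ → ℂ ⊗[ℝ] V → W) where
  carrier := {φ | φ ∈ jacobiHol κ ρ ∧ ∀ g ∈ jacobiSubgroup L ⊤, ∃ c : ℝ → V → W,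
    IsFourierExpansion L (jacobiSlash κ φ g) c ∧ ∀ n t, c n t ≠ 0 → P (n - L.Q t)}
  zero_mem' := ⟨zero_mem _, fun g _ => ⟨0, by
    rw [jacobiSlash_zero]; exact .zero, fun n t h => absurd rfl h⟩⟩
  add_mem' := by
    rintro φ ψ ⟨h1, h2⟩ ⟨k1, k2⟩
    refine ⟨add_mem h1 k1, fun g hg => ?_⟩
    obtain ⟨c, hc, hN⟩ := h2 g hg
    obtain ⟨c', hc', hN'⟩ := k2 g hg
    refine ⟨c + c', by rw [jacobiSlash_add]; exact hc.add hc', fun n t h => ?_⟩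
    by_cases h0 : c n t = 0
    · exact hN' n t fun h' => h (by simp [h0, h'])
    · exact hN n t h0
  smul_mem' := by
    rintro a φ ⟨h1, h2⟩
    refine ⟨Submodule.smul_mem _ a h1, fun g hg => ?_⟩
    obtain ⟨c, hc, hN⟩ := h2 g hg
    exact ⟨a • c, by rw [jacobiSlash_smul]; exact hc.smul a,
      fun n t h => hN n t fun h0 => h (by simp [h0])⟩

/-- Jacobi forms: `c(n, t) = 0` unless `n - Q(t) ≥ 0`, at all cusps. -/
def jacobiForms (κ : ℤ) (ρ : Representation ℂ (jacobiSubgroup L G) W) :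
    Submodule ℂ (ℍ → ℂ ⊗[ℝ] V → W) := jacobiFormsWith (fun x => 0 ≤ x) κ ρ

/-- Jacobi cusp forms: `c(n, t) = 0` unless `n - Q(t) > 0`, at all cusps. -/
def jacobiCuspForms (κ : ℤ) (ρ : Representation ℂ (jacobiSubgroup L G) W) :
    Submodule ℂ (ℍ → ℂ ⊗[ℝ] V → W) := jacobiFormsWith (fun x => 0 < x) κ ρ

theorem jacobiCuspForms_le (κ : ℤ) (ρ : Representation ℂ (jacobiSubgroup L G) W) :
    jacobiCuspForms κ ρ ≤ jacobiForms κ ρ := by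
  rintro φ ⟨h1, h2⟩
  refine ⟨h1, fun g hg => ?_⟩
  obtain ⟨c, hc, h⟩ := h2 g hg
  exact ⟨c, hc, fun n t hn => (h n t hn).le⟩

theorem jacobiForms_le (κ : ℤ) (ρ : Representation ℂ (jacobiSubgroup L G) W) :
    jacobiForms κ ρ ≤ weaklyHolJacobiForms κ ρ := by
  rintro φ ⟨h1, h2⟩
  refine ⟨h1, fun g hg => ?_⟩
  obtain ⟨c, hc, h⟩ := h2 g hg
  refine ⟨0, c, hc, fun n t hn => ?_⟩
  have hQ : 0 ≤ L.Q t := by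
    by_cases ht : t = 0
    · simp [ht, IntegralLattice.Q]
    · exact (half_pos (L.posDef t ht)).le
  have := h n t hn
  push_cast
  linarith

end JacobiForms

/-! ### Vector-valued modular forms -/

section ModularForms

variable {X : Type*} [AddCommGroup X] [Module ℂ X] {G : Subgroup SL(2, ℤ)}

/-- The slash operator of weight `κ / 2`. -/
def slash (κ : ℤ) (h : ℍ → X) (γ : Mp2Z) : ℍ → X :=
  fun τ => γ.root τ ^ (-κ) • h (γ.mat • τ)

theorem slash_add (κ : ℤ) (h h' : ℍ → X) (γ : Mp2Z) :
    slash κ (h + h') γ = slash κ h γ + slash κ h' γ := by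
  ext τ
  simp [slash]

theorem slash_smul (κ : ℤ) (a : ℂ) (h : ℍ → X) (γ : Mp2Z) :
    slash κ (a • h) γ = a • slash κ h γ := by
  ext τ
  simp [slash, smul_comm a]

theorem slash_zero (κ : ℤ) (γ : Mp2Z) : slash κ (0 : ℍ → X) γ = 0 := by
  ext τ
  simp [slash]

/-- `h(τ) = ∑ a(n) qⁿ`, where `n` runs through `(1/N)ℤ` for some positive integer `N`. -/
structure IsQExpansion (h : ℍ → X) (a : ℝ → X) : Prop where
  support : ∃ N : ℕ, 0 < N ∧ ∀ n, a n ≠ 0 → ∃ m : ℤ, (N : ℝ) * n = m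
  hasSum : ∀ τ : ℍ, VHasSum (fun n : ℝ => e (n * τ) • a n) (h τ)

theorem IsQExpansion.add {h h' : ℍ → X} {a a' : ℝ → X} (H : IsQExpansion h a)
    (H' : IsQExpansion h' a') : IsQExpansion (h + h') (a + a') where
  support := by
    obtain ⟨N, hN, K⟩ := H.support
    obtain ⟨N', hN', K'⟩ := H'.support
    refine ⟨N * N', Nat.mul_pos hN hN', fun n hn => ?_⟩
    by_cases ha : a n = 0
    · obtain ⟨m, hm⟩ := K' n fun h0 => hn (by simp [ha, h0])
      exact ⟨N * m, by push_cast; rw [← hm]; ring⟩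
    · obtain ⟨m, hm⟩ := K n ha
      exact ⟨N' * m, by push_cast; rw [← hm]; ring⟩
  hasSum τ := by
    simpa only [Pi.add_apply, smul_add] using (H.hasSum τ).add (H'.hasSum τ)

theorem IsQExpansion.smul {h : ℍ → X} {a : ℝ → X} (x : ℂ) (H : IsQExpansion h a) :
    IsQExpansion (x • h) (x • a) where
  support := by
    obtain ⟨N, hN, K⟩ := H.support
    exact ⟨N, hN, fun n hn => K n fun h0 => hn (by simp [h0])⟩
  hasSum τ := by
    simpa only [Pi.smul_apply, smul_comm x] using (H.hasSum τ).smul x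

theorem IsQExpansion.zero : IsQExpansion (0 : ℍ → X) 0 where
  support := ⟨1, one_pos, fun n h => absurd rfl h⟩
  hasSum τ l := by simpa using hasSum_zero

/-- Holomorphic functions on the upper half plane that satisfy the transformation equations of
weight `κ / 2` on the preimage of `G` in the double cover, with the representation `σ`. -/
def modularHol (κ : ℤ) (σ : Representation ℂ (Mp2Z.preimage G) X) : Submodule ℂ (ℍ → X) where
  carrier := {h | IsHol h ∧ ∀ (γ : Mp2Z.preimage G) τ, slash κ h (γ : Mp2Z) τ = σ γ (h τ)}
  zero_mem' := ⟨fun l => by simp, fun γ τ => by simp [slash]⟩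
  add_mem' := by
    rintro h k ⟨h1, h2⟩ ⟨k1, k2⟩
    refine ⟨fun l => ?_, fun γ τ => ?_⟩
    · simpa only [Pi.add_apply, map_add] using (h1 l).fun_add (k1 l)
    · simp [slash_add, h2, k2]
  smul_mem' := by
    rintro a h ⟨h1, h2⟩
    refine ⟨fun l => ?_, fun γ τ => ?_⟩
    · simpa only [Pi.smul_apply, map_smul] using (h1 l).fun_const_smul a
    · simp [slash_smul, h2]

/-- Weakly holomorphic modular forms: at every cusp only finitely many negative powers of `q`
occur. -/
def weaklyHolModularForms (κ : ℤ) (σ : Representation ℂ (Mp2Z.preimage G) X) :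
    Submodule ℂ (ℍ → X) where
  carrier := {h | h ∈ modularHol κ σ ∧ ∀ γ : Mp2Z, ∃ (N₀ : ℚ) (a : ℝ → X),
    IsQExpansion (slash κ h γ) a ∧ ∀ n, a n ≠ 0 → (N₀ : ℝ) ≤ n}
  zero_mem' := ⟨zero_mem _, fun γ => ⟨0, 0, by
    rw [slash_zero]; exact .zero, fun n h => absurd rfl h⟩⟩
  add_mem' := by
    rintro h k ⟨h1, h2⟩ ⟨k1, k2⟩
    refine ⟨add_mem h1 k1, fun γ => ?_⟩
    obtain ⟨N, a, ha, hN⟩ := h2 γ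
    obtain ⟨N', a', ha', hN'⟩ := k2 γ
    refine ⟨min N N', a + a', by rw [slash_add]; exact ha.add ha', fun n hn => ?_⟩
    by_cases h0 : a n = 0
    · have h0' : a' n ≠ 0 := fun h' => hn (by simp [h0, h'])
      exact le_trans (by exact_mod_cast min_le_right N N') (hN' n h0')
    · exact le_trans (by exact_mod_cast min_le_left N N') (hN n h0)
  smul_mem' := by
    rintro x h ⟨h1, h2⟩
    refine ⟨Submodule.smul_mem _ x h1, fun γ => ?_⟩
    obtain ⟨N, a, ha, hN⟩ := h2 γ
    exact ⟨N, x • a, by rw [slash_smul]; exact ha.smul x,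
      fun n hn => hN n fun h0 => hn (by simp [h0])⟩

/-- Modular forms whose `q`-expansions at all cusps are supported on the `n` with `P n`. -/
def modularFormsWith (P : ℝ → Prop) (κ : ℤ) (σ : Representation ℂ (Mp2Z.preimage G) X) :
    Submodule ℂ (ℍ → X) where
  carrier := {h | h ∈ modularHol κ σ ∧ ∀ γ : Mp2Z, ∃ a : ℝ → X,
    IsQExpansion (slash κ h γ) a ∧ ∀ n, a n ≠ 0 → P n}
  zero_mem' := ⟨zero_mem _, fun γ => ⟨0, by
    rw [slash_zero]; exact .zero, fun n h => absurd rfl h⟩⟩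
  add_mem' := by
    rintro h k ⟨h1, h2⟩ ⟨k1, k2⟩
    refine ⟨add_mem h1 k1, fun γ => ?_⟩
    obtain ⟨a, ha, hN⟩ := h2 γ
    obtain ⟨a', ha', hN'⟩ := k2 γ
    refine ⟨a + a', by rw [slash_add]; exact ha.add ha', fun n hn => ?_⟩
    by_cases h0 : a n = 0
    · exact hN' n fun h' => hn (by simp [h0, h'])
    · exact hN n h0
  smul_mem' := by
    rintro x h ⟨h1, h2⟩
    refine ⟨Submodule.smul_mem _ x h1, fun γ => ?_⟩
    obtain ⟨a, ha, hN⟩ := h2 γ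
    exact ⟨x • a, by rw [slash_smul]; exact ha.smul x,
      fun n hn => hN n fun h0 => hn (by simp [h0])⟩

/-- Modular forms, holomorphic at all cusps. -/
def modularForms (κ : ℤ) (σ : Representation ℂ (Mp2Z.preimage G) X) : Submodule ℂ (ℍ → X) :=
  modularFormsWith (fun n => 0 ≤ n) κ σ

/-- Cusp forms, vanishing at all cusps. -/
def cuspForms (κ : ℤ) (σ : Representation ℂ (Mp2Z.preimage G) X) : Submodule ℂ (ℍ → X) :=
  modularFormsWith (fun n => 0 < n) κ σ

end ModularForms

/-! ### Jacobi theta series and the Weil representation -/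

section Theta

variable {V : Type*} [AddCommGroup V] [Module ℝ V] (L : IntegralLattice V)

/-- The Jacobi theta series `ϑ_{L,t}(τ, z) = ∑_{v ∈ t + L} e(τ Q(v) + B(v, z))`. -/
def theta (t : L.Disc) (τ : ℍ) (z : ℂ ⊗[ℝ] V) : ℂ :=
  ∑' v : {v : L.dual // L.toDisc v = t},
    e (τ * L.Q (v.1 : V) + L.formC ((1 : ℂ) ⊗ₜ[ℝ] (v.1 : V)) z)

/-- `ρ` is the Weil representation of the full Jacobi group on `ℂ[L♯/L]`, that is, it is given on
the generators of the group by the standard formulas on the basis `δ_x`. -/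
structure IsWeilRepresentation (ρ : Representation ℂ (jacobiSubgroup L ⊤) (L.Disc →₀ ℂ)) :
    Prop where
  map_T : ∀ g : jacobiSubgroup L ⊤, (g : JacobiGroup L) = ofMp L Mp2Z.T → ∀ x : L.dual,
    ρ g (Finsupp.single (L.toDisc x) 1) = Finsupp.single (L.toDisc x) (e (L.Q (x : V)))
  map_S : ∀ g : jacobiSubgroup L ⊤, (g : JacobiGroup L) = ofMp L Mp2Z.S → ∀ x y : L.dual,
    ρ g (Finsupp.single (L.toDisc x) 1) (L.toDisc y) =
      (-Complex.I) ^ ((Module.finrank ℝ V : ℂ) / 2) / (Real.sqrt (Nat.card L.Disc) : ℂ)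
        * e (-(L.form (x : V) (y : V)))
  map_heis : ∀ (g : jacobiSubgroup L ⊤) (v w : V) (ξ : Circle),
    (g : JacobiGroup L) = heis L v w ξ → ∀ x : L.Disc,
    ρ g (Finsupp.single x 1) = Finsupp.single x ((ξ : ℂ) * e ((1 / 2) * L.form v w))

variable {W : Type*} [AddCommGroup W] [Module ℂ W]

/-- The restriction to the preimage of `G` in the double cover of `ρ ⊗ ρL*`, where `ρL*` is the
dual of a representation `ρL` of the full Jacobi group on `ℂ[L♯/L]`. -/
def thetaRepresentation (G : Subgroup SL(2, ℤ)) (ρ : Representation ℂ (jacobiSubgroup L G) W)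
    (ρL : Representation ℂ (jacobiSubgroup L ⊤) (L.Disc →₀ ℂ)) :
    Representation ℂ (Mp2Z.preimage G) (W ⊗[ℂ] Module.Dual ℂ (L.Disc →₀ ℂ)) :=
  (ρ.tprod (ρL.dual.comp (Subgroup.inclusion (jacobiSubgroup_le_top L G)))).comp (mpToJacobi L G)

/-- The dual basis vector `δ_t*` of `ℂ[L♯/L]*`. -/
def dualDelta (t : L.Disc) : Module.Dual ℂ (L.Disc →₀ ℂ) := Finsupp.lapply t

end Theta

end

end LatticeJacobi

open LatticeJacobi

namespace LatticeJacobi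

noncomputable section

/-! ### Uniqueness of absolutely convergent sums of characters -/

/-! Part (1) comes from Heisenberg invariance. Invariance under `z ↦ z + w` forces the Fourier
exponents `t` into the dual lattice. Invariance under `z ↦ z + τv`, with its automorphic factor,
forces `c(n, t)` to depend only on `n - Q(t)` and on `t` modulo `L`. Summing over `n` first and then
over the classes of `t` gives `∑ h_t ϑ_t`. The hypothesis on `ρ` concerns a family of Heisenberg
elements that `SL₂(ℤ)` permutes, so it passes from `φ` to every `φ|γ`
(`jacobiSlash_heis_invariant`). After that only the pairs `(0, 1)` and `(1, 0)` are needed. For them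
the factor `e(B(v, w)/2)` is trivial, so evenness plays no role. Coefficients are compared through
`eq_zero_of_hasSum_addChar`: on real translates of a point the expansion is an absolutely convergent
sum of distinct unitary characters.

For part (2), let `Θ = ∑ ϑ_t δ_t`. The Heisenberg group and `T` act on `Θ` by constant matrices
after reindexing the series. For `S` this is Poisson summation of a Gaussian (`gauss_poisson`),
which leaves a positive constant open. Applying `S` twice to `ϑ_0` determines it
(`inversion_constant`). Since `T` and `S` generate the metaplectic group, every group element acts
by some matrix. The theta series are linearly independent at each fixed `τ`, so that matrix is
unique, and uniqueness makes `g ↦ matrix` a representation without any check of relations.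

Finally `φ(τ, z)` is the contraction of `Θ(τ, z)` with `h(τ)`, and at fixed `τ` these contractions
determine `h(τ)` (`contract_thetaVec_injective`). Linearity and the transformation law of `h` are
therefore inherited from `φ`. The exponent of `q` in `h_t` is `n - Q(t)`, so the growth conditions
at the cusps carry over. -/

theorem norm_geom_sum_circle_le {z : ℂ} (hz : ‖z‖ = 1) (h1 : z ≠ 1) (N : ℕ) :
    ‖∑ k ∈ Finset.range N, z ^ k‖ ≤ 2 / ‖z - 1‖ := by
  rw [geom_sum_eq h1, norm_div]
  gcongr
  calc ‖z ^ N - 1‖ ≤ ‖z ^ N‖ + ‖(1 : ℂ)‖ := norm_sub_le _ _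
    _ = 2 := by rw [norm_pow, hz]; norm_num

/-- Averaging the relation over the translates by `0, g, ..., (N - 1)g` multiplies the `i`-th
coefficient by a Cesàro mean of powers of `ψ i g`. This mean is `1` for the trivial character and
`O(1/N)` when `ψ i g ≠ 1`. One such averaging per element of `F` makes all of `F` small while `i₀`
is untouched. -/
theorem exists_averaging {A ι : Type*} [AddCommGroup A] (ψ : ι → AddChar A Circle) (a : ι → ℂ)
    (h : ∀ g, HasSum (fun i => a i * (ψ i g : ℂ)) 0) (i₀ : ι) (h₀ : ψ i₀ = 0) (F : Finset ι)
    (hF : ∀ i ∈ F, ψ i ≠ 0) {ε : ℝ} (hε : 0 < ε) :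
    ∃ m : ι → ℂ, (∀ i, ‖m i‖ ≤ 1) ∧ m i₀ = 1 ∧ (∀ i ∈ F, ‖m i‖ ≤ ε) ∧
      ∀ g, HasSum (fun i => a i * m i * (ψ i g : ℂ)) 0 := by
  classical
  induction F using Finset.induction_on with
  | empty => exact ⟨fun _ => 1, by simp, rfl, by simp, by simpa using h⟩
  | insert j F hj ih =>
    obtain ⟨m, m1, m2, m3, m4⟩ := ih fun i hi => hF i (Finset.mem_insert_of_mem hi)
    obtain ⟨g, hg⟩ : ∃ g, ψ j g ≠ 1 := by
      by_contra! hcon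
      exact hF j (Finset.mem_insert_self _ _) (by ext g; simp [hcon])
    have hg' : (ψ j g : ℂ) ≠ 1 := fun h => hg (Circle.coe_injective (by simpa using h))
    obtain ⟨N, hN⟩ := exists_nat_gt (2 / ‖(ψ j g : ℂ) - 1‖ / ε)
    have hpos : 0 < ‖(ψ j g : ℂ) - 1‖ := norm_pos_iff.mpr (sub_ne_zero.mpr hg')
    have hN0 : (0 : ℝ) < N := lt_of_le_of_lt (by positivity) hN
    have hNC : (N : ℂ) ≠ 0 := by exact_mod_cast hN0.ne'
    have avg_le : ∀ i, ‖(N : ℂ)⁻¹ * ∑ k ∈ Finset.range N, (ψ i g : ℂ) ^ k‖ ≤ 1 := by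
      intro i
      rw [norm_mul, norm_inv, Complex.norm_natCast]
      have : ‖∑ k ∈ Finset.range N, (ψ i g : ℂ) ^ k‖ ≤ N :=
        (norm_sum_le _ _).trans (by simp [Circle.norm_coe])
      calc _ ≤ (N : ℝ)⁻¹ * N := by gcongr
        _ = 1 := inv_mul_cancel₀ hN0.ne'
    refine ⟨fun i => m i * ((N : ℂ)⁻¹ * ∑ k ∈ Finset.range N, (ψ i g : ℂ) ^ k), fun i => ?_, ?_,
      fun i hi => ?_, fun x => ?_⟩
    · rw [norm_mul]
      exact mul_le_one₀ (m1 i) (norm_nonneg _) (avg_le i)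
    · simp [m2, h₀, hNC]
    · rw [norm_mul]
      rcases Finset.mem_insert.mp hi with rfl | hi
      · refine (mul_le_of_le_one_left (norm_nonneg _) (m1 i)).trans ?_
        rw [norm_mul, norm_inv, Complex.norm_natCast, inv_mul_le_iff₀ hN0]
        refine (norm_geom_sum_circle_le (Circle.norm_coe _) hg' N).trans ?_
        rw [div_lt_iff₀ hε] at hN
        exact hN.le
      · exact (mul_le_of_le_one_right (norm_nonneg _) (avg_le i)).trans (m3 i hi)
    · have := (hasSum_sum fun k (_ : k ∈ Finset.range N) => m4 (x + k • g)).mul_left (N : ℂ)⁻¹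
      simp only [Finset.sum_const_zero, mul_zero] at this
      refine this.congr_fun ?_
      intro i
      simp only [AddChar.map_add_eq_mul, AddChar.map_nsmul_eq_pow, Circle.coe_mul, Circle.coe_pow,
        Finset.mul_sum, Finset.sum_mul]
      refine Finset.sum_congr rfl fun k _ => ?_
      ring

/-- An absolutely convergent sum of distinct unitary characters vanishes identically only if all
of its coefficients vanish. -/
theorem eq_zero_of_hasSum_addChar {A ι : Type*} [AddCommGroup A] {χ : ι → AddChar A Circle}
    (hχ : Function.Injective χ) {a : ι → ℂ} (h : ∀ g, HasSum (fun i => a i * (χ i g : ℂ)) 0) :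
    a = 0 := by
  classical
  ext i₀
  have ha : Summable fun i => ‖a i‖ := by simpa using (h 0).summable.norm
  -- Dividing by `χ i₀` makes the character at `i₀` trivial, as the averaging requires.
  set ψ : ι → AddChar A Circle := fun i => χ i - χ i₀ with hψ
  have hψ' : ∀ g, HasSum (fun i => a i * (ψ i g : ℂ)) 0 := by
    intro g
    have := (h g).mul_right ((χ i₀ g : ℂ)⁻¹)
    rw [zero_mul] at this
    refine this.congr_fun fun i => ?_
    rw [hψ, AddChar.sub_apply', Circle.coe_div, div_eq_mul_inv, mul_assoc]
  by_contra hne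
  have hpos : 0 < ‖a i₀‖ := norm_pos_iff.mpr hne
  -- Outside `F` the coefficients have total norm below `‖a i₀‖ / 2`.
  obtain ⟨F, hF⟩ := ((tendsto_tsum_compl_atTop_zero fun i => ‖a i‖).eventually
    (gt_mem_nhds (half_pos hpos))).exists_forall_of_atTop
  set F' := insert i₀ F
  have hF' := hF F' (Finset.subset_insert _ _)
  set S := ∑ i ∈ F'.erase i₀, ‖a i‖ with hS
  have hS0 : 0 ≤ S := Finset.sum_nonneg fun i _ => norm_nonneg _
  -- With this `ε` the terms of `F'` other than `i₀` contribute at most `S · ε ≤ ‖a i₀‖ / 2`.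
  -- Together with the tail they cannot cancel `a i₀`.
  obtain ⟨m, m1, m2, m3, m4⟩ := exists_averaging ψ a hψ' i₀ (sub_self _) (F'.erase i₀)
    (fun i hi => sub_ne_zero.mpr fun hi' => (Finset.mem_erase.mp hi).1 (hχ hi'))
    (ε := ‖a i₀‖ / 2 / (S + 1)) (by positivity)
  have key : HasSum (fun i => a i * m i) 0 := by simpa using m4 0
  have hle : ∀ i, ‖a i * m i‖ ≤ ‖a i‖ := fun i => by
    rw [norm_mul]; exact mul_le_of_le_one_right (norm_nonneg _) (m1 i)
  have hsplit := key.summable.sum_add_tsum_compl (s := F')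
  rw [key.tsum_eq, ← Finset.add_sum_erase _ _ (Finset.mem_insert_self i₀ F), m2, mul_one] at hsplit
  have e1 : ‖∑ i ∈ F'.erase i₀, a i * m i‖ ≤ ‖a i₀‖ / 2 := by
    calc _ ≤ ∑ i ∈ F'.erase i₀, ‖a i‖ * (‖a i₀‖ / 2 / (S + 1)) := by
          refine norm_sum_le_of_le _ fun i hi => ?_
          rw [norm_mul]
          exact mul_le_mul_of_nonneg_left (m3 i hi) (norm_nonneg _)
      _ = ‖a i₀‖ / 2 * (S / (S + 1)) := by rw [← Finset.sum_mul]; ring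
      _ ≤ ‖a i₀‖ / 2 * 1 := by
          gcongr
          exact (div_le_one (by positivity)).mpr (by linarith)
      _ = _ := mul_one _
  have e2 : ‖∑' i : ↑(↑F' : Set ι)ᶜ, a i * m i‖ < ‖a i₀‖ / 2 := by
    refine lt_of_le_of_lt ?_ hF'
    exact tsum_of_norm_bounded (ha.subtype _).hasSum fun i => hle i
  have : a i₀ = -(∑ i ∈ F'.erase i₀, a i * m i) - ∑' i : ↑(↑F' : Set ι)ᶜ, a i * m i := by
    linear_combination hsplit
  have h3 : ‖a i₀‖ ≤ ‖∑ i ∈ F'.erase i₀, a i * m i‖ + ‖∑' i : ↑(↑F' : Set ι)ᶜ, a i * m i‖ := by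
    conv_lhs => rw [this]
    exact (norm_sub_le _ _).trans (by rw [norm_neg])
  linarith

/-! ### Vector-valued sums -/

section VHasSum

variable {X : Type*} [AddCommGroup X] [Module ℂ X]

theorem eq_of_forall_dual {x y : X} (h : ∀ l : Module.Dual ℂ X, l x = l y) : x = y := by
  rw [← sub_eq_zero, ← Module.forall_dual_apply_eq_zero_iff ℂ]
  intro l
  rw [map_sub, h, sub_self]

theorem VHasSum.unique {ι : Type*} {f : ι → X} {x y : X} (hx : VHasSum f x) (hy : VHasSum f y) :
    x = y :=
  eq_of_forall_dual fun l => (hx l).unique (hy l)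

theorem VHasSum.map {ι : Type*} {f : ι → X} {x : X} (hx : VHasSum f x) {Y : Type*}
    [AddCommGroup Y] [Module ℂ Y] (A : X →ₗ[ℂ] Y) : VHasSum (fun i => A (f i)) (A x) :=
  fun l => hx (l ∘ₗ A)

theorem VHasSum.sum {ι κ : Type*} {s : Finset κ} {f : κ → ι → X} {x : κ → X}
    (hx : ∀ k ∈ s, VHasSum (f k) (x k)) : VHasSum (fun i => ∑ k ∈ s, f k i) (∑ k ∈ s, x k) :=
  fun l => by simpa only [map_sum] using hasSum_sum fun k hk => hx k hk l

/-- The sum of a family that is summable against all linear functionals. -/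
theorem exists_vHasSum [FiniteDimensional ℂ X] {ι : Type*} {f : ι → X}
    (h : ∀ l : Module.Dual ℂ X, Summable fun i => l (f i)) : ∃ x, VHasSum f x := by
  let b := Module.finBasis ℂ X
  -- The sum is built coordinatewise in a finite basis, since `X` carries no topology.
  refine ⟨∑ j, (∑' i, b.coord j (f i)) • b j, fun l => ?_⟩
  have h1 : ∀ x, l x = ∑ j, b.coord j x * l (b j) := fun x => by
    conv_lhs => rw [← b.sum_repr x]
    simp only [map_sum, map_smul, smul_eq_mul, Module.Basis.coord_apply]
  simp only [map_sum, map_smul, smul_eq_mul]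
  simp_rw [fun i => h1 (f i)]
  exact hasSum_sum fun j _ => (h _).hasSum.mul_right _

theorem IsHol.map {h : ℍ → X} (hh : IsHol h) {Y : Type*} [AddCommGroup Y] [Module ℂ Y]
    (A : X →ₗ[ℂ] Y) : IsHol fun τ => A (h τ) :=
  fun l => hh (l ∘ₗ A)

theorem IsHol.sum {κ : Type*} {s : Finset κ} {h : κ → ℍ → X} (hh : ∀ k ∈ s, IsHol (h k)) :
    IsHol fun τ => ∑ k ∈ s, h k τ := fun l => by
  simpa only [map_sum] using DifferentiableOn.fun_sum fun k hk => hh k hk l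

end VHasSum

/-! ### The exponential `e` -/

theorem e_add (x y : ℂ) : e (x + y) = e x * e y := by
  rw [e, e, e, mul_add, Complex.exp_add]

theorem e_zero : e 0 = 1 := by simp [e]

theorem e_ne_zero (x : ℂ) : e x ≠ 0 := Complex.exp_ne_zero _

theorem e_intCast (m : ℤ) : e m = 1 := by
  rw [e, Complex.exp_eq_one_iff]
  exact ⟨m, by ring⟩

theorem e_eq_one_iff (x : ℂ) : e x = 1 ↔ ∃ m : ℤ, x = m := by
  rw [e, Complex.exp_eq_one_iff]
  refine exists_congr fun m => ?_
  rw [mul_comm (m : ℂ), mul_right_inj' Complex.two_pi_I_ne_zero]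

theorem norm_e (x : ℂ) : ‖e x‖ = Real.exp (-2 * Real.pi * x.im) := by
  rw [e, Complex.norm_exp]
  congr 1
  simp

theorem coe_circle_exp (x : ℝ) : (Circle.exp (2 * Real.pi * x) : ℂ) = e x := by
  rw [Circle.coe_exp, e]
  congr 1
  push_cast
  ring

/-! ### The slash operator is a right action -/

section Cocycle

variable {V : Type*} [AddCommGroup V] [Module ℝ V] (L : IntegralLattice V)

namespace IntegralLattice

theorem formC_tmul (a b : ℂ) (x y : V) :
    L.formC (a ⊗ₜ[ℝ] x) (b ⊗ₜ[ℝ] y) = a * b * L.form x y := by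
  rw [formC, LinearMap.BilinForm.baseChange_tmul]
  simp [mul_comm]

theorem formC_symm (x y : ℂ ⊗[ℝ] V) : L.formC x y = L.formC y x := by
  induction x with
  | zero => simp
  | add x x' hx hx' => simp [hx, hx']
  | tmul a v =>
    induction y with
    | zero => simp
    | add y y' hy hy' => simp [hy, hy']
    | tmul b w => rw [formC_tmul, formC_tmul, L.symm v w, mul_comm a b]

theorem formC_tmul_left (a : ℂ) (x : V) (z : ℂ ⊗[ℝ] V) :
    L.formC (a ⊗ₜ[ℝ] x) z = a * L.formC ((1 : ℂ) ⊗ₜ[ℝ] x) z := by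
  rw [← smul_eq_mul, ← LinearMap.smul_apply, ← map_smul, TensorProduct.smul_tmul', smul_eq_mul,
    mul_one]

theorem formC_real_smul (a : ℝ) (x : V) (z : ℂ ⊗[ℝ] V) :
    L.formC ((1 : ℂ) ⊗ₜ[ℝ] (a • x)) z = a * L.formC ((1 : ℂ) ⊗ₜ[ℝ] x) z := by
  rw [← TensorProduct.smul_tmul, Complex.real_smul, mul_one, formC_tmul_left]

theorem QC_tmul (a : ℂ) (x : V) : L.QC (a ⊗ₜ[ℝ] x) = a ^ 2 * L.Q x := by
  rw [QC, formC_tmul, Q]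
  push_cast
  ring

theorem QC_add (x y : ℂ ⊗[ℝ] V) : L.QC (x + y) = L.QC x + L.QC y + L.formC x y := by
  simp only [QC, map_add, LinearMap.add_apply]
  rw [L.formC_symm y x]
  ring

theorem QC_smul (a : ℂ) (x : ℂ ⊗[ℝ] V) : L.QC (a • x) = a ^ 2 * L.QC x := by
  simp only [QC, map_smul, LinearMap.smul_apply, smul_eq_mul]
  ring

theorem Q_add (x y : V) : L.Q (x + y) = L.Q x + L.Q y + L.form x y := by
  simp only [Q, map_add, LinearMap.add_apply]
  rw [L.symm y x]
  ring

theorem Q_smul (a : ℝ) (x : V) : L.Q (a • x) = a ^ 2 * L.Q x := by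
  simp only [Q, map_smul, LinearMap.smul_apply, smul_eq_mul]
  ring

end IntegralLattice

variable {L}

theorem translate_mul (g h : JacobiGroup L) (τ : ℍ) (z : ℂ ⊗[ℝ] V) :
    translate (g * h).v (g * h).w τ z = translate h.v h.w τ z +
      ((h.mp.mat 0 0 : ℂ) * τ + h.mp.mat 0 1) ⊗ₜ[ℝ] g.v +
      ((h.mp.mat 1 0 : ℂ) * τ + h.mp.mat 1 1) ⊗ₜ[ℝ] g.w := by
  simp only [translate, JacobiGroup.v_mul, JacobiGroup.w_mul, ← Int.cast_smul_eq_zsmul ℝ,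
    TensorProduct.tmul_add, TensorProduct.tmul_smul, TensorProduct.add_tmul]
  simp only [TensorProduct.smul_tmul', Complex.real_smul, Complex.ofReal_intCast, mul_one]
  abel

theorem translate_comp (g h : JacobiGroup L) (τ : ℍ) (z : ℂ ⊗[ℝ] V) :
    translate g.v g.w (h.mp.mat • τ)
      (((h.mp.mat 1 0 : ℂ) * τ + (h.mp.mat 1 1 : ℂ))⁻¹ • translate h.v h.w τ z) =
    ((h.mp.mat 1 0 : ℂ) * τ + (h.mp.mat 1 1 : ℂ))⁻¹ • translate (g * h).v (g * h).w τ z := by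
  have hd := denom_ne h.mp.mat τ
  rw [translate_mul, smul_add, smul_add, TensorProduct.smul_tmul', TensorProduct.smul_tmul',
    smul_eq_mul, smul_eq_mul, inv_mul_cancel₀ hd, translate,
    UpperHalfPlane.coe_specialLinearGroup_apply]
  simp only [eq_intCast, Complex.ofReal_intCast]
  rw [div_eq_inv_mul]

/-- This is the cocycle relation behind the right action. The sign twist `exp(πi A)` in the
Heisenberg product is exactly what balances the terms `B(v, w)/2` of the two factors. -/
theorem jacobiFactor_mul (g h : JacobiGroup L) (τ : ℍ) (z : ℂ ⊗[ℝ] V) :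
    jacobiFactor (g * h) τ z = jacobiFactor g (h.mp.mat • τ)
      (((h.mp.mat 1 0 : ℂ) * τ + (h.mp.mat 1 1 : ℂ))⁻¹ • translate h.v h.w τ z) *
      jacobiFactor h τ z := by
  have hd := denom_ne h.mp.mat τ
  have hd2 := denom_ne g.mp.mat (h.mp.mat • τ)
  have hdm := denom_mul g.mp.mat h.mp.mat τ
  have hdet : (h.mp.mat 0 0 : ℂ) * h.mp.mat 1 1 - h.mp.mat 0 1 * h.mp.mat 1 0 = 1 := by
    exact_mod_cast JacobiGroup.det_eq h.mp.mat
  have hA : (Circle.exp (Real.pi * L.altForm (h.mp.mat 0 0 • g.v + h.mp.mat 1 0 • g.w)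
      (h.mp.mat 0 1 • g.v + h.mp.mat 1 1 • g.w) h.v h.w) : ℂ) =
      e (L.altForm (h.mp.mat 0 0 • g.v + h.mp.mat 1 0 • g.w)
      (h.mp.mat 0 1 • g.v + h.mp.mat 1 1 • g.w) h.v h.w / 2) := by
    rw [Circle.coe_exp, e]
    congr 1
    push_cast
    ring
  unfold jacobiFactor
  rw [translate_comp, JacobiGroup.mp_mul, Mp2Z.mat_mul, hdm, JacobiGroup.xi_mul,
    Circle.coe_mul, Circle.coe_mul, hA, L.QC_smul]
  rw [mul_mul_mul_comm, mul_assoc ((g.ξ : ℂ) * h.ξ), ← e_add, ← e_add]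
  congr 2
  rw [translate_mul]
  -- The translated point `Z` is taken as the variable, so that both automorphic exponents become
  -- polynomials in the same pairings.
  have hz : z = translate h.v h.w τ z - (τ : ℂ) ⊗ₜ[ℝ] h.v - (1 : ℂ) ⊗ₜ[ℝ] h.w := by
    rw [translate]; abel
  generalize translate h.v h.w τ z = Z at *
  subst hz
  rw [UpperHalfPlane.coe_specialLinearGroup_apply] at hd2 ⊢
  simp only [eq_intCast, Complex.ofReal_intCast, Matrix.SpecialLinearGroup.coe_mul,
    Matrix.mul_apply, Fin.sum_univ_two, Int.cast_add, Int.cast_mul] at hd2 ⊢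
  simp only [L.QC_add, L.QC_tmul, map_add, map_sub, map_smul, LinearMap.add_apply,
    L.formC_symm Z,
    LinearMap.smul_apply, smul_eq_mul, JacobiGroup.v_mul, JacobiGroup.w_mul,
    ← Int.cast_smul_eq_zsmul ℝ, L.formC_tmul, IntegralLattice.altForm, L.Q_add, L.Q_smul,
    TensorProduct.tmul_add,
    L.formC_tmul_left (_ + _) _ Z, L.formC_real_smul]
  push_cast
  simp only [L.symm h.v g.v, L.symm h.v g.w, L.symm g.w g.v, IntegralLattice.Q]
  push_cast
  generalize (h.mp.mat 0 0 : ℂ) = a at *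
  generalize (h.mp.mat 0 1 : ℂ) = b at *
  generalize (h.mp.mat 1 0 : ℂ) = c at *
  generalize (h.mp.mat 1 1 : ℂ) = d at *
  -- The coefficient `c/(cτ + d)` of the quadratic term obeys its own cocycle rule, which is a
  -- consequence of the determinant being `1`.
  have hK : ((g.mp.mat 1 0 : ℂ) * a + g.mp.mat 1 1 * c) /
      ((g.mp.mat 1 0 * ((a * τ + b) / (c * τ + d)) + g.mp.mat 1 1) * (c * τ + d)) =
      c / (c * τ + d) + g.mp.mat 1 0 / (g.mp.mat 1 0 * ((a * τ + b) / (c * τ + d)) +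
        g.mp.mat 1 1) * (c * τ + d)⁻¹ ^ 2 := by
    have h3 : (g.mp.mat 1 0 : ℂ) * (a * τ + b) + g.mp.mat 1 1 * (c * τ + d) ≠ 0 := by
      intro h0
      apply hd2
      rw [← mul_div_assoc, div_add' _ _ _ hd, h0, zero_div]
    field_simp
    linear_combination (g.mp.mat 1 0 : ℂ) * hdet
  rw [hK]
  generalize (g.mp.mat 1 0 : ℂ) / _ = q
  have hi : (c * τ + d) * (c * τ + d)⁻¹ = 1 := mul_inv_cancel₀ hd
  have hj : a * (c * τ + d) - c * (a * τ + b) = 1 := by linear_combination hdet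
  simp only [div_eq_mul_inv _ (c * (τ : ℂ) + d)]
  generalize hu : (c * (τ : ℂ) + d)⁻¹ = u at *
  generalize L.formC (1 ⊗ₜ[ℝ] g.v) Z = f₁
  generalize L.formC (1 ⊗ₜ[ℝ] g.w) Z = f₂
  generalize (L.form g.v g.v : ℂ) = x₁
  generalize (L.form g.v g.w : ℂ) = x₂
  generalize (L.form g.w g.w : ℂ) = x₃
  linear_combination ((a * τ + b) * u * x₁ / 2 + u * f₁) * hj +
    (-(a * (a * τ + b) * x₁ / 2) - a * f₁ - c * f₂ - c * (c * τ + d) * x₃ / 2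
      - c * (a * τ + b) * x₂) * hi + x₂ / 2 * hdet

theorem jacobiSlash_mul {W : Type*} [AddCommGroup W] [Module ℂ W] (κ : ℤ)
    (F : ℍ → ℂ ⊗[ℝ] V → W) (g h : JacobiGroup L) :
    jacobiSlash κ F (g * h) = jacobiSlash κ (jacobiSlash κ F g) h := by
  ext τ z
  have hd := denom_ne h.mp.mat τ
  simp only [jacobiSlash]
  rw [jacobiFactor_mul, translate_comp, smul_smul, smul_smul, JacobiGroup.mp_mul, Mp2Z.mat_mul,
    Mp2Z.root_mul, denom_mul, mul_smul g.mp.mat, mul_zpow, mul_inv, mul_smul (_⁻¹ : ℂ)]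
  congr 1
  ring

theorem jacobiSlash_one {W : Type*} [AddCommGroup W] [Module ℂ W] (κ : ℤ)
    (F : ℍ → ℂ ⊗[ℝ] V → W) : jacobiSlash κ F (1 : JacobiGroup L) = F := by
  ext τ z
  simp [jacobiSlash, jacobiFactor, JacobiGroup.mp_one, JacobiGroup.v_one, JacobiGroup.w_one,
    JacobiGroup.xi_one, Mp2Z.mat_one, Mp2Z.root_one, translate, IntegralLattice.Q, e_zero]

theorem jacobiSlash_map {W X : Type*} [AddCommGroup W] [Module ℂ W] [AddCommGroup X] [Module ℂ X]
    (κ : ℤ) (A : W →ₗ[ℂ] X) (F : ℍ → ℂ ⊗[ℝ] V → W) (g : JacobiGroup L) (τ : ℍ) (z : ℂ ⊗[ℝ] V) :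
    jacobiSlash κ (fun τ z => A (F τ z)) g τ z = A (jacobiSlash κ F g τ z) := by
  simp only [jacobiSlash, map_smul]

theorem jacobiSlash_heis {W : Type*} [AddCommGroup W] [Module ℂ W]
    (κ : ℤ) (F : ℍ → ℂ ⊗[ℝ] V → W) (v w : V) (ξ : Circle) (τ : ℍ) (z : ℂ ⊗[ℝ] V) :
    jacobiSlash κ F (heis L v w ξ) τ z =
      ((ξ : ℂ) * e (τ * L.Q v + L.formC ((1 : ℂ) ⊗ₜ[ℝ] v) z + (1 / 2) * L.form v w)) •
        F τ (translate v w τ z) := by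
  simp [jacobiSlash, jacobiFactor, heis, Mp2Z.mat_one, Mp2Z.root_one]

end Cocycle

/-! ### Fourier expansions -/

section Fourier

variable {V : Type*} [AddCommGroup V] [Module ℝ V] {W : Type*} [AddCommGroup W] [Module ℂ W]
variable (L : IntegralLattice V)

/-- The character `u ↦ e(B(t, u))` of `V`. -/
def formChar (t : V) : AddChar V Circle where
  toFun u := Circle.exp (2 * Real.pi * L.form t u)
  map_zero_eq_one' := by simp
  map_add_eq_mul' u v := by rw [map_add, mul_add, Circle.exp_add]

theorem coe_formChar (t u : V) : (formChar L t u : ℂ) = e (L.form t u) := coe_circle_exp _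

theorem circle_exp_forall_eq {a b : ℝ}
    (h : ∀ x : ℝ, Circle.exp (2 * Real.pi * (a * x)) = Circle.exp (2 * Real.pi * (b * x))) :
    a = b := by
  by_contra hne
  -- At this point the two phases differ by exactly half a turn.
  have hx := h (1 / (2 * (a - b)))
  rw [Circle.exp_eq_exp] at hx
  obtain ⟨m, hm⟩ := hx
  have hab : a - b ≠ 0 := sub_ne_zero.mpr hne
  have h2 : (a - b) * (1 / (2 * (a - b))) = m := by
    have := Real.pi_pos.ne'
    apply mul_left_cancel₀ (mul_ne_zero two_ne_zero this)
    linear_combination hm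
  have h3 : (2 * m : ℝ) = 1 := by
    rw [← h2]
    field_simp
  have h4 : (2 * m : ℤ) = 1 := by exact_mod_cast h3
  omega

theorem formChar_injective : Function.Injective (formChar L) := by
  intro t t' h
  rw [← sub_eq_zero]
  by_contra hne
  refine (L.posDef _ hne).ne' ?_
  rw [LinearMap.map_sub₂, sub_eq_zero]
  refine circle_exp_forall_eq fun x => ?_
  -- Testing along the line spanned by `t - t'` gives `B(t - t', t - t') = 0`, against positive
  -- definiteness.
  have := DFunLike.congr_fun h (x • (t - t'))
  change Circle.exp _ = Circle.exp _ at this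
  rwa [map_smul, map_smul, smul_eq_mul, smul_eq_mul, mul_comm x, mul_comm x] at this

/-- The character `(x, u) ↦ e(nx + B(t, u))` of `ℝ × V`. -/
def fourierChar (p : ℝ × V) : AddChar (ℝ × V) Circle where
  toFun x := Circle.exp (2 * Real.pi * (p.1 * x.1)) * formChar L p.2 x.2
  map_zero_eq_one' := by simp
  map_add_eq_mul' x y := by
    rw [Prod.fst_add, Prod.snd_add, AddChar.map_add_eq_mul, mul_add, mul_add, Circle.exp_add]
    exact mul_mul_mul_comm _ _ _ _

theorem coe_fourierChar (p x : ℝ × V) :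
    (fourierChar L p x : ℂ) = e (p.1 * x.1) * e (L.form p.2 x.2) := by
  change ((Circle.exp _ * formChar L p.2 x.2 : Circle) : ℂ) = _
  rw [Circle.coe_mul, coe_circle_exp, coe_formChar]
  push_cast
  rfl

theorem fourierChar_injective : Function.Injective (fourierChar L) := by
  intro p p' h
  have h1 : p.2 = p'.2 := formChar_injective L <| by
    ext1 u
    have := DFunLike.congr_fun h (0, u)
    change Circle.exp _ * _ = Circle.exp _ * _ at this
    simpa using this
  refine Prod.ext (circle_exp_forall_eq fun x => ?_) h1
  have := DFunLike.congr_fun h (x, 0)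
  change Circle.exp _ * _ = Circle.exp _ * _ at this
  simpa using this

variable {L}

/-- The coefficients of an absolutely convergent Fourier expansion are unique. -/
theorem fourierCoeff_unique {F : ℍ → ℂ ⊗[ℝ] V → W} {c c' : ℝ → V → W}
    (h : ∀ (τ : ℍ) (z : ℂ ⊗[ℝ] V), VHasSum
      (fun p : ℝ × V => (e (p.1 * τ) * e (L.formC ((1 : ℂ) ⊗ₜ[ℝ] p.2) z)) • c p.1 p.2) (F τ z))
    (h' : ∀ (τ : ℍ) (z : ℂ ⊗[ℝ] V), VHasSum
      (fun p : ℝ × V => (e (p.1 * τ) * e (L.formC ((1 : ℂ) ⊗ₜ[ℝ] p.2) z)) • c' p.1 p.2) (F τ z)) :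
    c = c' := by
  ext n t
  refine eq_of_forall_dual fun l => ?_
  have key : (fun p : ℝ × V => e (p.1 * Complex.I) * (l (c p.1 p.2) - l (c' p.1 p.2))) = 0 := by
    refine eq_zero_of_hasSum_addChar (fourierChar_injective L) fun x => ?_
    -- On the points `(i + x, u)` with `x` and `u` real, each term is a unitary character of `ℝ × V`
    -- times `e(ni) ≠ 0`.
    have := (h (x.1 +ᵥ UpperHalfPlane.I) ((1 : ℂ) ⊗ₜ[ℝ] x.2) l).sub
      (h' (x.1 +ᵥ UpperHalfPlane.I) ((1 : ℂ) ⊗ₜ[ℝ] x.2) l)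
    rw [sub_self] at this
    refine this.congr_fun fun p => ?_
    rw [coe_fourierChar, map_smul, map_smul, smul_eq_mul, smul_eq_mul, L.formC_tmul,
      UpperHalfPlane.coe_vadd, UpperHalfPlane.coe_I, mul_add, e_add, one_mul, one_mul]
    ring
  have := congrFun key (n, t)
  simpa [e_ne_zero, sub_eq_zero] using this

theorem IsFourierExpansion.unique {F : ℍ → ℂ ⊗[ℝ] V → W} {c c' : ℝ → V → W}
    (h : IsFourierExpansion L F c) (h' : IsFourierExpansion L F c') : c = c' :=
  fourierCoeff_unique h.hasSum h'.hasSum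

/-- Translating `z` by the real vector `w` multiplies `c(n, t)` by `e(B(t, w))`. By uniqueness this
factor is `1` wherever the coefficient is nonzero. -/
theorem IsFourierExpansion.form_int {F : ℍ → ℂ ⊗[ℝ] V → W} {c : ℝ → V → W}
    (h : IsFourierExpansion L F c) {w : V}
    (hF : ∀ τ z, F τ (z + (1 : ℂ) ⊗ₜ[ℝ] w) = F τ z) {n : ℝ} {t : V} (hc : c n t ≠ 0) :
    ∃ m : ℤ, L.form t w = m := by
  have := fourierCoeff_unique (L := L) (F := F) (c := fun n t => e (L.form t w) • c n t)
    (c' := c) (fun τ z => ?_) h.hasSum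
  · have h1 := congrFun (congrFun this n) t
    have h2 : e (L.form t w) = 1 := by
      have : (e (L.form t w) - 1) • c n t = 0 := by rw [sub_smul, h1, one_smul, sub_self]
      exact sub_eq_zero.mp ((smul_eq_zero.mp this).resolve_right hc)
    obtain ⟨m, hm⟩ := (e_eq_one_iff _).mp h2
    exact ⟨m, by exact_mod_cast hm⟩
  · have := h.hasSum τ (z + (1 : ℂ) ⊗ₜ[ℝ] w)
    rw [hF] at this
    refine fun l => (this l).congr_fun fun p => ?_
    simp only [smul_smul, map_add, L.formC_tmul, e_add, one_mul, mul_assoc]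

/-- The translation `(n, t) ↦ (n + B(t, v) + Q(v), t + v)` of Fourier exponents. -/
def shiftEquiv (L : IntegralLattice V) (v : V) : ℝ × V ≃ ℝ × V where
  toFun p := (p.1 + L.form p.2 v + L.Q v, p.2 + v)
  invFun p := (p.1 - L.form (p.2 - v) v - L.Q v, p.2 - v)
  left_inv p := by
    ext
    · simp only [add_sub_cancel_right]
      ring
    · simp
  right_inv p := by
    ext
    · ring
    · simp

/-- The substitution `z ↦ z + τv` with its factor moves exponents by `shiftEquiv`, which preserves
`n - Q(t)`. Uniqueness then identifies the coefficients. -/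
theorem IsFourierExpansion.shift {F : ℍ → ℂ ⊗[ℝ] V → W} {c : ℝ → V → W}
    (h : IsFourierExpansion L F c) {v : V}
    (hF : ∀ (τ : ℍ) z, e (τ * L.Q v + L.formC ((1 : ℂ) ⊗ₜ[ℝ] v) z) • F τ (z + (τ : ℂ) ⊗ₜ[ℝ] v) =
      F τ z) (n : ℝ) (t : V) : c (n + L.Q (t + v)) (t + v) = c (n + L.Q t) t := by
  have := fourierCoeff_unique (L := L) (F := F)
    (c := fun n t => c ((shiftEquiv L v).symm (n, t)).1 ((shiftEquiv L v).symm (n, t)).2)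
    (c' := c) (fun τ z => ?_) h.hasSum
  · have h1 := congrFun (congrFun this (n + L.Q (t + v))) (t + v)
    have h2 : (shiftEquiv L v).symm (n + L.Q (t + v), t + v) = (n + L.Q t, t) := by
      rw [Equiv.symm_apply_eq]
      ext1
      · simp only [shiftEquiv, Equiv.coe_fn_mk, L.Q_add]
        ring
      · rfl
    rw [← h1, h2]
  · have := (h.hasSum τ (z + (τ : ℂ) ⊗ₜ[ℝ] v)).smul
      (e (τ * L.Q v + L.formC ((1 : ℂ) ⊗ₜ[ℝ] v) z))
    rw [hF] at this
    refine fun l => (Equiv.hasSum_iff (shiftEquiv L v)).mp ((this l).congr_fun fun p => ?_)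
    simp only [Function.comp_apply, Prod.mk.eta, Equiv.symm_apply_apply]
    rw [smul_smul]
    congr 2
    simp only [shiftEquiv, Equiv.coe_fn_mk, ← e_add]
    rw [TensorProduct.tmul_add, map_add, LinearMap.add_apply, map_add, L.formC_tmul]
    congr 1
    push_cast
    ring

/-- A sum `∑ a(n) qⁿ` that converges absolutely on the upper half plane is holomorphic. -/
theorem isHol_of_vHasSum {h : ℍ → W} {a : ℝ → W}
    (H : ∀ τ : ℍ, VHasSum (fun n : ℝ => e (n * τ) • a n) (h τ)) : IsHol h := by
  intro l
  have hsum : ∀ y : ℝ, 0 < y → Summable fun n : ℝ => Real.exp (-2 * Real.pi * (n * y)) * ‖l (a n)‖ := by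
    intro y hy
    have := (H ⟨y * Complex.I, by simpa using hy⟩ l).summable.norm
    refine this.congr fun n => ?_
    rw [map_smul, norm_smul, norm_e]
    simp
  have hloc : ∀ y₁ y₂ : ℝ, 0 < y₁ → 0 < y₂ → DifferentiableOn ℂ
      (fun τ : ℂ => ∑' n : ℝ, e (n * τ) * l (a n)) {τ : ℂ | y₁ < τ.im ∧ τ.im < y₂} := by
    intro y₁ y₂ h₁ h₂
    -- On the strip, terms with `n ≥ 0` are largest towards height `y₁` and terms with `n ≤ 0`
    -- towards `y₂`. The sum of both majorants works without any lower bound on the exponents.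
    refine differentiableOn_tsum_of_summable_norm ((hsum y₁ h₁).add (hsum y₂ h₂)) (fun n => ?_)
      ((isOpen_lt continuous_const Complex.continuous_im).inter
        (isOpen_lt Complex.continuous_im continuous_const)) fun n τ hτ => ?_
    · unfold e
      fun_prop
    · rw [norm_mul, norm_e, ← add_mul]
      refine mul_le_mul_of_nonneg_right ?_ (norm_nonneg _)
      have : ((n : ℂ) * τ).im = n * τ.im := by simp
      rw [this]
      rcases le_total 0 n with hn | hn
      · refine le_add_of_le_of_nonneg (Real.exp_le_exp.mpr ?_) (Real.exp_pos _).le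
        have := mul_le_mul_of_nonneg_left hτ.1.le hn
        nlinarith [Real.pi_pos]
      · refine le_add_of_nonneg_of_le (Real.exp_pos _).le (Real.exp_le_exp.mpr ?_)
        have := mul_le_mul_of_nonpos_left hτ.2.le hn
        nlinarith [Real.pi_pos]
  intro τ hτ
  have hτ' : 0 < τ.im := hτ
  have hopen : IsOpen {σ : ℂ | τ.im / 2 < σ.im ∧ σ.im < 2 * τ.im} :=
    (isOpen_lt continuous_const Complex.continuous_im).inter
      (isOpen_lt Complex.continuous_im continuous_const)
  have hd := (hloc (τ.im / 2) (2 * τ.im) (by positivity) (by positivity)).differentiableAt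
    (hopen.mem_nhds (x := τ) ⟨by linarith, by linarith⟩)
  refine DifferentiableAt.differentiableWithinAt (hd.congr_of_eventuallyEq ?_)
  filter_upwards [hopen.mem_nhds (x := τ) ⟨by linarith, by linarith⟩] with σ hσ
  have hσ0 : 0 < σ.im := lt_trans (by positivity) hσ.1
  have := (H (ofComplex σ) l).tsum_eq
  rw [← this, ofComplex_apply_of_im_pos hσ0]
  simp only [map_smul, smul_eq_mul]

/-- The reindexing `(t, n) ↦ (n + Q(t), t)` of Fourier exponents. -/
def thetaEquiv (L : IntegralLattice V) : V × ℝ ≃ ℝ × V where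
  toFun p := (p.2 + L.Q p.1, p.1)
  invFun p := (p.2, p.1 - L.Q p.2)
  left_inv p := by ext <;> simp
  right_inv p := by ext <;> simp

/-- The theta decomposition of a function whose Fourier coefficients `c(n, t)` depend only on
`n - Q(t)` and the class of `t` in `L♯ / L`. -/
theorem IsFourierExpansion.exists_theta_decomposition [FiniteDimensional ℂ W]
    {F : ℍ → ℂ ⊗[ℝ] V → W} {c : ℝ → V → W}
    (H : IsFourierExpansion L F c) (hdual : ∀ n t, c n t ≠ 0 → t ∈ L.dual)
    (hper : ∀ v ∈ L.carrier, ∀ n t, c (n + L.Q (t + v)) (t + v) = c (n + L.Q t) t) :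
    ∃ h : L.Disc → ℍ → W,
      (∀ t, IsHol (h t)) ∧
      (∀ (t : L.dual) (τ : ℍ),
        VHasSum (fun n : ℝ => e (n * τ) • c (n + L.Q (t : V)) (t : V)) (h (L.toDisc t) τ)) ∧
      ∀ τ z, F τ z = ∑ t, theta L t τ z • h t τ := by
  have hex : ∀ (t : V) (τ : ℍ), ∃ x,
      VHasSum (fun n : ℝ => e (n * τ) • c (n + L.Q t) t) x := by
    intro t τ
    refine exists_vHasSum fun l => ?_
    -- At `z = 0`, the terms with second exponent `t` form a subfamily of a summable family.
    -- Dividing by `e(τQ(t))` leaves the series of `h_t`.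
    have h1 := (((H.hasSum τ 0 l).summable.comp_injective (thetaEquiv L).injective).comp_injective
      (Prod.mk_right_injective t)).mul_left (e (-(L.Q t * τ)))
    refine h1.congr fun n => ?_
    simp only [Function.comp_apply, thetaEquiv, Equiv.coe_fn_mk, map_smul, smul_eq_mul, map_zero,
      e_zero, mul_one]
    rw [← mul_assoc, ← e_add]
    congr 2
    push_cast
    ring
  choose h₀ hh₀ using hex
  have hcl : ∀ t t' : L.dual, L.toDisc t = L.toDisc t' → h₀ (t : V) = h₀ (t' : V) := by
    intro t t' htt
    ext τ
    have hv : (t : V) - t' ∈ L.carrier :=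
      (Submodule.Quotient.eq (L.carrier.submoduleOf L.dual)).mp htt
    have := hh₀ (t : V) τ
    have hn : ∀ n : ℝ, c (n + L.Q (t : V)) (t : V) = c (n + L.Q (t' : V)) (t' : V) := by
      intro n
      have := hper _ hv n t'
      rwa [add_sub_cancel] at this
    simp_rw [hn] at this
    exact this.unique (hh₀ (t' : V) τ)
  have hout : ∀ t : L.dual, h₀ ((Quotient.out (L.toDisc t) : L.dual) : V) = h₀ (t : V) :=
    fun t => hcl _ _ (Quotient.out_eq _)
  refine ⟨fun d => h₀ ((Quotient.out d : L.dual) : V), fun d => isHol_of_vHasSum (hh₀ _),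
    fun t τ => ?_, fun τ z => ?_⟩
  · simp only [hout]
    exact hh₀ _ _
  · refine eq_of_forall_dual fun l => ?_
    have h1 := (Equiv.hasSum_iff (thetaEquiv L)).mpr (H.hasSum τ z l)
    -- Summation over `n` at fixed `t` factors as `e(τQ(t) + B(t, z)) h_t(τ)`.
    have h2 := h1.prod_fiberwise (g := fun t : V =>
      e (τ * L.Q t + L.formC ((1 : ℂ) ⊗ₜ[ℝ] t) z) * l (h₀ t τ)) (fun t => by
        refine ((hh₀ t τ l).mul_left _).congr_fun fun n => ?_
        simp only [Function.comp_apply, thetaEquiv, Equiv.coe_fn_mk, map_smul, smul_eq_mul]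
        rw [← mul_assoc, ← e_add, ← e_add]
        congr 2
        push_cast
        ring)
    have h3 : HasSum (fun t : L.dual =>
        e (τ * L.Q (t : V) + L.formC ((1 : ℂ) ⊗ₜ[ℝ] (t : V)) z) * l (h₀ (t : V) τ)) (l (F τ z)) := by
      refine (hasSum_subtype_iff_of_support_subset (s := (L.dual : Set V)) fun t ht => ?_).mpr h2
      by_contra hnd
      refine ht ?_
      have : h₀ t τ = 0 := (hh₀ t τ).unique fun l => by
        have : ∀ n, c (n + L.Q t) t = 0 := fun n => by
          by_contra h0
          exact hnd (hdual _ _ h0)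
        simp [this]
      simp [this]
    -- Summation over each class of `t`, on which `h_t` is constant, produces the theta series.
    have h4 := h3.tsum_fiberwise L.toDisc
    rw [h4.unique (hasSum_fintype _), map_sum]
    refine Finset.sum_congr rfl fun d _ => ?_
    rw [map_smul, smul_eq_mul, theta, ← tsum_mul_right]
    refine tsum_congr fun v => ?_
    rw [← hout v.1, show L.toDisc v.1 = d from v.2]

end Fourier

/-! ### Invariance under the Heisenberg group -/

section Invariance

variable {V : Type*} [AddCommGroup V] [Module ℝ V] {W : Type*} [AddCommGroup W] [Module ℂ W]
variable {L : IntegralLattice V} {G : Subgroup SL(2, ℤ)}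

theorem heis_mem (v w : V) (hv : v ∈ L.carrier) (hw : w ∈ L.carrier) :
    heis L v w 1 ∈ jacobiSubgroup L G :=
  ⟨one_mem _, hv, hw, one_pow 2⟩

theorem heis_mul_ofMp (γ : Mp2Z) (a b : ℤ) (v : V) :
    heis L (a • v) (b • v) 1 * ofMp L γ = ofMp L γ *
      heis L ((γ.mat 0 0 * a + γ.mat 1 0 * b) • v) ((γ.mat 0 1 * a + γ.mat 1 1 * b) • v) 1 := by
  ext1
  · change 1 * γ = γ * 1
    rw [one_mul, mul_one]
  · simp [JacobiGroup.v_mul, heis, ofMp, Mp2Z.mat_one, add_smul, mul_smul]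
  · simp [JacobiGroup.w_mul, heis, ofMp, Mp2Z.mat_one, add_smul, mul_smul]
  · simp [JacobiGroup.xi_mul, heis, ofMp, Mp2Z.mat_one, IntegralLattice.altForm]

/-- Moving the Heisenberg element to the left past `γ` replaces `(a, b)` by `(a, b)γ⁻¹`. This pair
is again coprime, so `ρ` is trivial on the resulting element. -/
theorem jacobiSlash_heis_invariant {κ : ℤ} {ρ : Representation ℂ (jacobiSubgroup L G) W}
    (hρ : ∀ a b : ℤ, IsCoprime a b → ∀ v ∈ L.carrier, ∀ g : jacobiSubgroup L G,
      (g : JacobiGroup L) = heis L (a • v) (b • v) 1 → ρ g = 1)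
    {φ : ℍ → ℂ ⊗[ℝ] V → W} (hφ : φ ∈ jacobiHol κ ρ) (γ : Mp2Z) {a b : ℤ} (hab : IsCoprime a b)
    {v : V} (hv : v ∈ L.carrier) :
    jacobiSlash κ (jacobiSlash κ φ (ofMp L γ)) (heis L (a • v) (b • v) 1) =
      jacobiSlash κ φ (ofMp L γ) := by
  have hdet : γ.mat 0 0 * γ.mat 1 1 - γ.mat 0 1 * γ.mat 1 0 = 1 := by
    exact_mod_cast JacobiGroup.det_eq γ.mat
  -- The two integers are the entries of `(a, b)γ⁻¹`.
  have h1 := heis_mul_ofMp (L := L) γ (γ.mat 1 1 * a - γ.mat 1 0 * b)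
    (γ.mat 0 0 * b - γ.mat 0 1 * a) v
  rw [show γ.mat 0 0 * (γ.mat 1 1 * a - γ.mat 1 0 * b) +
      γ.mat 1 0 * (γ.mat 0 0 * b - γ.mat 0 1 * a) = a by linear_combination a * hdet,
    show γ.mat 0 1 * (γ.mat 1 1 * a - γ.mat 1 0 * b) +
      γ.mat 1 1 * (γ.mat 0 0 * b - γ.mat 0 1 * a) = b by linear_combination b * hdet] at h1
  rw [← jacobiSlash_mul, ← h1, jacobiSlash_mul]
  congr 1
  ext τ z
  have hcop : IsCoprime (γ.mat 1 1 * a - γ.mat 1 0 * b) (γ.mat 0 0 * b - γ.mat 0 1 * a) := by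
    obtain ⟨x, y, hxy⟩ := hab
    exact ⟨γ.mat 0 0 * x + γ.mat 0 1 * y, γ.mat 1 0 * x + γ.mat 1 1 * y, by
      linear_combination (x * a + y * b) * hdet + hxy⟩
  have := hφ.2 ⟨_, heis_mem (G := G) _ _ (L.carrier.smul_mem (γ.mat 1 1 * a - γ.mat 1 0 * b) hv)
    (L.carrier.smul_mem (γ.mat 0 0 * b - γ.mat 0 1 * a) hv)⟩ τ z
  rw [hρ _ _ hcop v hv _ rfl] at this
  exact this

/-- The theta decomposition of Jacobi forms at all cusps. -/
theorem exists_theta_decomposition [FiniteDimensional ℂ W]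
    {κ : ℤ} {ρ : Representation ℂ (jacobiSubgroup L G) W}
    (hρ : ∀ a b : ℤ, IsCoprime a b → ∀ v ∈ L.carrier, ∀ g : jacobiSubgroup L G,
      (g : JacobiGroup L) = heis L (a • v) (b • v) 1 → ρ g = 1)
    {φ : ℍ → ℂ ⊗[ℝ] V → W} (hφ : φ ∈ jacobiHol κ ρ) (γ : Mp2Z) {c : ℝ → V → W}
    (H : IsFourierExpansion L (jacobiSlash κ φ (ofMp L γ)) c) :
    ∃ h : L.Disc → ℍ → W,
      (∀ t, IsHol (h t)) ∧
      (∀ (t : L.dual) (τ : ℍ),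
        VHasSum (fun n : ℝ => e (n * τ) • c (n + L.Q (t : V)) (t : V)) (h (L.toDisc t) τ)) ∧
      ∀ τ z, jacobiSlash κ φ (ofMp L γ) τ z = ∑ t, theta L t τ z • h t τ := by
  refine H.exists_theta_decomposition (fun n t hc => ?_) fun v hv n t => ?_
  · intro w hw
    have hinv : ∀ τ z, jacobiSlash κ φ (ofMp L γ) τ (z + (1 : ℂ) ⊗ₜ[ℝ] w) =
        jacobiSlash κ φ (ofMp L γ) τ z := fun τ z => by
      -- The pair `(0, 1)` gives periodicity in the real direction `w`, hence `B(t, w) ∈ ℤ`.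
      have := congrFun (congrFun (jacobiSlash_heis_invariant hρ hφ γ
        (a := 0) (b := 1) isCoprime_one_right hw) τ) z
      rw [jacobiSlash_heis] at this
      simpa [translate, IntegralLattice.Q, e_zero] using this
    obtain ⟨m, hm⟩ := H.form_int hinv hc
    exact Submodule.mem_one.mpr ⟨m, by simp [hm]⟩
  · refine H.shift (fun τ z => ?_) n t
    -- The pair `(1, 0)` gives quasi-periodicity in the direction `τv`.
    have := congrFun (congrFun (jacobiSlash_heis_invariant hρ hφ γ
      (a := 1) (b := 0) isCoprime_one_left hv) τ) z
    rw [jacobiSlash_heis] at this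
    simpa [translate] using this

end Invariance

/-! ### Poisson summation on `ℝⁿ` -/

section Poisson

open MeasureTheory

theorem isQuotientMap_torus (n : ℕ) :
    Topology.IsQuotientMap (fun (x : Fin n → ℝ) (i : Fin n) => (x i : UnitAddCircle)) := by
  have h : IsOpenQuotientMap (QuotientAddGroup.mk : ℝ → UnitAddCircle) :=
    QuotientAddGroup.isOpenQuotientMap_mk
  exact (IsOpenQuotientMap.piMap fun _ : Fin n => h).isQuotientMap

theorem mFourier_neg_coe {n : ℕ} (k : Fin n → ℤ) (x : Fin n → ℝ) :
    UnitAddTorus.mFourier (-k) (fun i => (x i : UnitAddCircle)) = e (-∑ i, (k i : ℂ) * x i) := by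
  simp only [UnitAddTorus.mFourier, ContinuousMap.coe_mk, fourier_coe_apply, e]
  rw [← Complex.exp_sum]
  congr 1
  simp [Finset.mul_sum, mul_assoc]

/-- The half-open unit cube translated by an integral vector. -/
def cube {n : ℕ} (m : Fin n → ℤ) : Set (Fin n → ℝ) :=
  {x | ∀ i, x i ∈ Set.Ioc (m i : ℝ) (m i + 1)}

theorem measurableSet_cube {n : ℕ} (m : Fin n → ℤ) : MeasurableSet (cube m) :=
  MeasurableSet.univ_pi' fun _ => measurableSet_Ioc

theorem iUnion_cube (n : ℕ) : ⋃ m : Fin n → ℤ, cube m = Set.univ := by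
  refine Set.eq_univ_of_forall fun x => Set.mem_iUnion.mpr ⟨fun i => ⌈x i⌉ - 1, fun i => ?_⟩
  have h1 := Int.ceil_lt_add_one (x i)
  have h2 := Int.le_ceil (x i)
  push_cast
  exact ⟨by linarith, by linarith⟩

theorem pairwise_disjoint_cube (n : ℕ) :
    Pairwise (Function.onFun Disjoint fun m : Fin n → ℤ => cube m) := by
  intro m m' hne
  refine Set.disjoint_left.mpr fun x hx hx' => hne ?_
  ext i
  have h1 := hx i
  have h2 := hx' i
  have h3 : (m i : ℝ) < m' i + 1 := lt_of_lt_of_le h1.1 h2.2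
  have h4 : (m' i : ℝ) < m i + 1 := lt_of_lt_of_le h2.1 h1.2
  have h5 : m i < m' i + 1 := by exact_mod_cast h3
  have h6 : m' i < m i + 1 := by exact_mod_cast h4
  omega

theorem setIntegral_cube {n : ℕ} (g : (Fin n → ℝ) → ℂ) (m : Fin n → ℤ) :
    ∫ x in cube m, g x = ∫ x in cube 0, g (x + fun i => (m i : ℝ)) := by
  have h := (measurePreserving_add_right (volume : Measure (Fin n → ℝ))
    (fun i => (m i : ℝ))).setIntegral_preimage_emb (MeasurableEquiv.addRight _).measurableEmbedding
    g (cube m)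
  rw [← h]
  congr 2
  ext x
  simp only [cube, Set.mem_preimage, Set.mem_ofPred_eq, Pi.add_apply, Set.mem_Ioc, Pi.zero_apply,
    Int.cast_zero, zero_add]
  refine forall_congr' fun i => ?_
  constructor
  · rintro ⟨h1, h2⟩
    exact ⟨by linarith, by linarith⟩
  · rintro ⟨h1, h2⟩
    exact ⟨by linarith, by linarith⟩

/-- This unfolds the integral over `ℝⁿ`, to match it with the Fourier coefficients of a
periodization. -/
theorem integral_eq_tsum_cube {n : ℕ} {g : (Fin n → ℝ) → ℂ} (hg : Integrable g) :
    HasSum (fun m : Fin n → ℤ => ∫ x in cube 0, g (x + fun i => (m i : ℝ))) (∫ x, g x) := by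
  have := hasSum_integral_iUnion (f := g) (μ := volume) (fun m : Fin n → ℤ => measurableSet_cube m)
    (pairwise_disjoint_cube n) (by rw [iUnion_cube]; exact hg.integrableOn)
  rw [iUnion_cube, Measure.restrict_univ] at this
  exact this.congr_fun fun m => (setIntegral_cube g m).symm

/-- Poisson summation for continuous functions that are dominated, together with their translates
in compact sets, by a summable sequence. -/
theorem tsum_eq_tsum_fourier {n : ℕ} {f : (Fin n → ℝ) → ℂ} (hc : Continuous f)
    (hi : Integrable f)
    (hb : ∀ R : ℝ, ∃ u : (Fin n → ℤ) → ℝ, Summable u ∧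
      ∀ x, ‖x‖ ≤ R → ∀ m : Fin n → ℤ, ‖f (x + fun i => (m i : ℝ))‖ ≤ u m)
    (hs : Summable fun k : Fin n → ℤ => ∫ x, e (-∑ i, (k i : ℂ) * x i) * f x) :
    ∑' m : Fin n → ℤ, f (fun i => (m i : ℝ)) =
      ∑' k : Fin n → ℤ, ∫ x, e (-∑ i, (k i : ℂ) * x i) * f x := by
  -- The periodization of `f`. It is continuous by local uniform domination and descends to a
  -- function `F₀` on the torus.
  set G : (Fin n → ℝ) → ℂ := fun x => ∑' m : Fin n → ℤ, f (x + fun i => (m i : ℝ)) with hG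
  have hGc : Continuous G := by
    rw [continuous_iff_continuousAt]
    intro x
    obtain ⟨u, hu, hfu⟩ := hb (‖x‖ + 1)
    have : ContinuousOn G (Metric.closedBall 0 (‖x‖ + 1)) :=
      continuousOn_tsum (fun m => by fun_prop) hu fun m y hy => hfu y (by simpa using hy) m
    refine this.continuousAt (Filter.mem_of_superset (Metric.ball_mem_nhds x one_pos) fun y hy => ?_)
    rw [mem_closedBall_zero_iff]
    have h1 : ‖y - x‖ < 1 := by simpa [dist_eq_norm] using hy
    linarith [norm_le_norm_add_norm_sub' y x]
  have hGp : ∀ (x : Fin n → ℝ) (k : Fin n → ℤ), G (x + fun i => (k i : ℝ)) = G x := by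
    intro x k
    rw [hG]
    simp only
    rw [← Equiv.tsum_eq (Equiv.addLeft k) fun m : Fin n → ℤ => f (x + fun i => (m i : ℝ))]
    refine tsum_congr fun m => congrArg f ?_
    ext i
    simp [add_assoc]
  have hq := isQuotientMap_torus n
  set F₀ : UnitAddTorus (Fin n) → ℂ := fun t => G (Function.surjInv hq.surjective t) with hF₀
  have hF₀' : ∀ x : Fin n → ℝ, F₀ (fun i => (x i : UnitAddCircle)) = G x := by
    intro x
    rw [hF₀]
    simp only
    set y := Function.surjInv hq.surjective (fun i => (x i : UnitAddCircle)) with hy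
    have h1 : (fun i => (y i : UnitAddCircle)) = fun i => (x i : UnitAddCircle) :=
      Function.surjInv_eq hq.surjective _
    have h2 : ∀ i, ∃ k : ℤ, (k : ℝ) = y i - x i := by
      intro i
      have := congrFun h1 i
      have h3 : ((y i - x i : ℝ) : UnitAddCircle) = 0 := by
        rw [AddCircle.coe_sub, this, sub_self]
      obtain ⟨k, hk⟩ := (AddCircle.coe_eq_zero_iff _).mp h3
      exact ⟨k, by simpa using hk⟩
    choose k hk using h2
    rw [← hGp x k]
    congr 1
    ext i
    simp [hk]
  have hF₀c : Continuous F₀ := by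
    rw [hq.continuous_iff]
    exact hGc.congr fun x => (hF₀' x).symm
  obtain ⟨u, hu, hfu⟩ := hb 1
  have hcoef : ∀ k, UnitAddTorus.mFourierCoeff F₀ k = ∫ x, e (-∑ i, (k i : ℂ) * x i) * f x := by
    intro k
    have hχ : Continuous fun x : Fin n → ℝ => e (-∑ i, (k i : ℂ) * x i) := by
      unfold e; fun_prop
    have hχ1 : ∀ x : Fin n → ℝ, ‖e (-∑ i, (k i : ℂ) * x i)‖ = 1 := by
      intro x
      have : (-∑ i, (k i : ℂ) * x i) = ((-∑ i, (k i : ℝ) * x i : ℝ) : ℂ) := by push_cast; rfl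
      rw [this, ← coe_circle_exp, Circle.norm_coe]
    have hint : Integrable fun x : Fin n → ℝ => e (-∑ i, (k i : ℂ) * x i) * f x :=
      hi.bdd_mul hχ.aestronglyMeasurable (Filter.Eventually.of_forall fun x => (hχ1 x).le)
    rw [UnitAddTorus.mFourierCoeff_eq_integral F₀ k 0]
    have hset : {x : Fin n → ℝ | ∀ i, x i ∈ Set.Ioc ((0 : Fin n → ℝ) i) ((0 : Fin n → ℝ) i + 1)} =
      cube 0 := by ext; simp [cube]
    rw [hset]
    simp only [hF₀', mFourier_neg_coe, smul_eq_mul]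
    have hper : ∀ (x : Fin n → ℝ) (m : Fin n → ℤ),
        e (-∑ i, (k i : ℂ) * ((x + fun i => (m i : ℝ)) i : ℝ)) = e (-∑ i, (k i : ℂ) * x i) := by
      intro x m
      have : (-∑ i, (k i : ℂ) * ((x + fun i => (m i : ℝ)) i : ℝ)) =
          (-∑ i, (k i : ℂ) * x i) + ((-∑ i, k i * m i : ℤ) : ℂ) := by
        push_cast
        rw [← neg_add, ← Finset.sum_add_distrib]
        congr 1
        refine Finset.sum_congr rfl fun i _ => ?_
        simp [mul_add]
      rw [this, e_add, e_intCast, mul_one]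
    have hbd : ∀ m : Fin n → ℤ, ∀ x ∈ cube (0 : Fin n → ℤ),
        ‖e (-∑ i, (k i : ℂ) * x i) * f (x + fun i => (m i : ℝ))‖ ≤ u m := by
      intro m x hx
      rw [norm_mul, hχ1, one_mul]
      refine hfu x ((pi_norm_le_iff_of_nonneg zero_le_one).mpr fun i => ?_) m
      have := hx i
      simp only [Pi.zero_apply, Int.cast_zero, zero_add, Set.mem_Ioc] at this
      rw [Real.norm_eq_abs, abs_le]
      exact ⟨by linarith, this.2⟩
    have hvol : volume (cube (0 : Fin n → ℤ)) = 1 := by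
      have : cube (0 : Fin n → ℤ) = Set.univ.pi fun _ => Set.Ioc (0 : ℝ) 1 := by
        ext x; simp [cube]
      rw [this, Real.volume_pi_Ioc]
      simp
    have hfin : IsFiniteMeasure (volume.restrict (cube (0 : Fin n → ℤ))) :=
      ⟨by rw [Measure.restrict_apply_univ, hvol]; exact ENNReal.one_lt_top⟩
    -- The characters are invariant under integral translations, so the integral over `ℝⁿ` is a sum
    -- of integrals over one cube. The bound `u` then allows sum and integral to be exchanged.
    have hH := integral_eq_tsum_cube hint
    simp only [hper] at hH
    rw [← hH.tsum_eq, integral_tsum_of_summable_integral_norm]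
    · refine setIntegral_congr_fun (measurableSet_cube _) fun x _ => ?_
      simp only [hG]
      rw [tsum_mul_left]
    · intro m
      refine (hint.comp_add_right fun i => (m i : ℝ)).integrableOn.congr ?_
      simp only [hper]
      exact Filter.EventuallyEq.rfl
    · refine Summable.of_nonneg_of_le (fun m => integral_nonneg fun x => norm_nonneg _)
        (fun m => ?_) hu
      have := norm_setIntegral_le_of_norm_le_const (μ := volume) (s := cube (0 : Fin n → ℤ))
        (f := fun x => ‖e (-∑ i, (k i : ℂ) * x i) * f (x + fun i => (m i : ℝ))‖) (C := u m)
        (by rw [hvol]; exact ENNReal.one_lt_top) (fun x hx => by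
          rw [norm_norm]; exact hbd m x hx)
      rw [Measure.real, hvol] at this
      simpa using (le_abs_self _).trans this
  -- Summable Fourier coefficients let the series converge pointwise to `F₀`. Evaluation at `0` is
  -- the Poisson formula.
  have := UnitAddTorus.hasSum_mFourier_series_apply_of_summable (f := ⟨F₀, hF₀c⟩)
    (hs.congr fun k => (hcoef k).symm) (fun i => ((0 : ℝ) : UnitAddCircle))
  simp only [ContinuousMap.coe_mk, hcoef] at this
  rw [hF₀' fun _ => 0] at this
  have h1 : ∀ k : Fin n → ℤ, UnitAddTorus.mFourier k (fun i => ((0 : ℝ) : UnitAddCircle)) = 1 := by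
    intro k
    have := mFourier_neg_coe (-k) (fun _ => 0)
    rw [neg_neg] at this
    rw [this]
    simp [e_zero]
  simp only [h1, smul_eq_mul, mul_one] at this
  rw [this.tsum_eq, hG]
  refine tsum_congr fun m => congrArg f ?_
  ext i
  simp

end Poisson

/-! ### Gaussian sums over lattices -/

section Gauss

open MeasureTheory

theorem norm_e_mul_Q (σ : ℂ) (x y : ℝ) :
    ‖e (σ * x + y)‖ = Real.exp (-(2 * Real.pi * σ.im * x)) := by
  rw [norm_e]
  congr 1
  simp
  ring

/-- The transported Lebesgue measure is a Haar measure, hence a multiple of the volume. Only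
positivity of the factor is recorded, because `inversion_constant` determines the resulting
normalization indirectly. -/
theorem exists_integral_comp_linearEquiv {n : ℕ} {E : Type*} [NormedAddCommGroup E]
    [InnerProductSpace ℝ E] [FiniteDimensional ℝ E] [MeasurableSpace E] [BorelSpace E]
    (Λ : (Fin n → ℝ) ≃L[ℝ] E) : ∃ K : ℝ, 0 < K ∧ ∀ g : E → ℂ, Integrable g →
      Integrable (fun x => g (Λ x)) ∧ ∫ x, g (Λ x) = K * ∫ y, g y := by
  let μ : Measure E := (volume : Measure (Fin n → ℝ)).map Λ
  have : μ.IsAddHaarMeasure := Λ.isAddHaarMeasure_map _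
  obtain ⟨c, hc⟩ : ∃ c : NNReal, μ = c • (volume : Measure E) :=
    ⟨_, Measure.isAddLeftInvariant_eq_smul μ volume⟩
  have hc0 : c ≠ 0 := by
    rintro rfl
    rw [zero_smul] at hc
    exact (NeZero.ne μ) hc
  refine ⟨c, by exact_mod_cast pos_iff_ne_zero.mpr hc0, fun g hg => ?_⟩
  have hm : MeasurableEmbedding Λ := Λ.toHomeomorph.measurableEmbedding
  have hgμ : Integrable g μ := by
    rw [hc]
    exact hg.smul_measure_nnreal
  refine ⟨(hm.integrable_map_iff).mp hgμ, ?_⟩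
  rw [← hm.integral_map g]
  change ∫ y, g y ∂μ = _
  rw [hc, integral_smul_nnreal_measure]
  simp [NNReal.smul_def]

theorem summable_prod_pi {f : ℤ → ℝ} (hf0 : ∀ m, 0 ≤ f m) (hf : Summable f) (n : ℕ) :
    Summable fun m : Fin n → ℤ => ∏ i, f (m i) := by
  induction n with
  | zero => exact Summable.of_finite
  | succ n ih =>
    rw [← (Fin.consEquiv fun _ : Fin (n + 1) => ℤ).summable_iff]
    refine (hf.mul_of_nonneg ih hf0 fun m => Finset.prod_nonneg fun i _ => hf0 _).congr fun p => ?_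
    simp [Fin.prod_univ_succ, Fin.consEquiv]

/-- These are the norms of the terms of the Jacobi theta series at `z = 0` and `τ = iε/π`. -/
theorem summable_exp_neg_mul_sq {ε : ℝ} (hε : 0 < ε) :
    Summable fun m : ℤ => Real.exp (-(ε * (m : ℝ) ^ 2)) := by
  have h := (summable_jacobiTheta₂_term_iff 0 ((ε / Real.pi : ℝ) * Complex.I)).mpr
    (by simpa using div_pos hε Real.pi_pos)
  refine h.norm.congr fun m => ?_
  rw [jacobiTheta₂_term, Complex.norm_exp]
  congr 1
  have : (2 * Real.pi * Complex.I * m * 0 + Real.pi * Complex.I * m ^ 2 *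
      ((ε / Real.pi : ℝ) * Complex.I) : ℂ) = ((-(ε * (m : ℝ) ^ 2) : ℝ) : ℂ) := by
    have hπ : (Real.pi : ℂ) ≠ 0 := by exact_mod_cast Real.pi_pos.ne'
    push_cast
    field_simp
    linear_combination (m : ℂ) ^ 2 * ε * Complex.I_sq
  rw [this, Complex.ofReal_re]

variable {V : Type*} [AddCommGroup V] [Module ℝ V]
variable (L : IntegralLattice V)

theorem Q_nonneg (x : V) : 0 ≤ L.Q x := by
  by_cases h : x = 0
  · simp [h, IntegralLattice.Q]
  · exact (half_pos (L.posDef x h)).le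

/-- Since `Q(x + 2u) ≥ 0`, one has `-B(x + u, u) ≤ Q(x + u) + Q(u)`. Inserting this in `Q(x) = Q((x
+ u) - u)` gives the bound, which controls all translates of a Gaussian at once. -/
theorem Q_add_lower_bound (x u : V) : L.Q x / 2 - L.Q u ≤ L.Q (x + u) := by
  have h1 := L.Q_add (x + u) (-u)
  have h2 := Q_nonneg L (x + u + u)
  rw [L.Q_add] at h2
  have h3 : L.Q (-u) = L.Q u := by simp [IntegralLattice.Q]
  rw [add_neg_cancel_right, h3, map_neg] at h1
  linarith

theorem Q_eq_norm {L : IntegralLattice V}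
    {Φ : V ≃ₗ[ℝ] EuclideanSpace ℝ (Fin (Module.finrank ℝ V))}
    (hΦ : ∀ x y, inner ℝ (Φ x) (Φ y) = L.form x y) (x : V) : L.Q x = ‖Φ x‖ ^ 2 / 2 := by
  rw [IntegralLattice.Q, ← hΦ, real_inner_self_eq_norm_sq]

variable [FiniteDimensional ℝ V]

/-- A linear isometry of `(V, B)` with a standard Euclidean space. -/
theorem exists_isometry : ∃ Φ : V ≃ₗ[ℝ] EuclideanSpace ℝ (Fin (Module.finrank ℝ V)),
    ∀ x y, inner ℝ (Φ x) (Φ y) = L.form x y := by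
  let core : InnerProductSpace.Core ℝ V :=
    { inner := fun x y => L.form x y
      conj_inner_symm := fun x y => by simpa using L.symm y x
      re_inner_nonneg := fun x => by
        have := Q_nonneg L x
        rw [IntegralLattice.Q] at this
        simpa using by linarith
      add_left := fun x y z => by simp
      smul_left := fun x y r => by simp
      definite := fun x hx => by
        by_contra h
        exact (L.posDef x h).ne' hx }
  let _ : NormedAddCommGroup V := core.toNormedAddCommGroup
  let _ : InnerProductSpace ℝ V := InnerProductSpace.ofCore core.toCore
  exact ⟨(stdOrthonormalBasis ℝ V).repr.toLinearEquiv, fun x y =>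
    (stdOrthonormalBasis ℝ V).repr.inner_map_map x y⟩

/-- Norms on a finite-dimensional space are equivalent, so `Q` dominates the sum of squares of the
coordinates and lattice sums reduce to products of one-dimensional ones. -/
theorem exists_Q_lower_bound {n : ℕ} (b : Module.Basis (Fin n) ℝ V) :
    ∃ c > 0, ∀ x : Fin n → ℝ, c * ∑ i, x i ^ 2 ≤ L.Q (b.equivFun.symm x) := by
  obtain ⟨Φ, hΦ⟩ := exists_isometry L
  let Λ := (b.equivFun.symm.trans Φ).toContinuousLinearEquiv
  set K := ‖(Λ.symm : EuclideanSpace ℝ (Fin (Module.finrank ℝ V)) →L[ℝ] (Fin n → ℝ))‖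
  -- The estimates give `∑ xᵢ² ≤ 2nK² Q`. The added `1` keeps the constant positive when `n = 0`.
  refine ⟨(2 * n * K ^ 2 + 1)⁻¹, by positivity, fun x => ?_⟩
  have h1 : ‖x‖ ≤ K * ‖Φ (b.equivFun.symm x)‖ := by
    have := (Λ.symm : EuclideanSpace ℝ (Fin (Module.finrank ℝ V)) →L[ℝ] (Fin n → ℝ)).le_opNorm
      (Λ x)
    rwa [ContinuousLinearEquiv.coe_coe, ContinuousLinearEquiv.symm_apply_apply] at this
  have h2 : ∑ i, x i ^ 2 ≤ n * ‖x‖ ^ 2 := by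
    have : ∀ i ∈ Finset.univ, x i ^ 2 ≤ ‖x‖ ^ 2 := fun i _ => by
      rw [← sq_abs, ← Real.norm_eq_abs]
      exact pow_le_pow_left₀ (norm_nonneg _) (norm_le_pi_norm x i) 2
    simpa using Finset.sum_le_card_nsmul _ _ _ this
  have h3 : ‖x‖ ^ 2 ≤ K ^ 2 * ‖Φ (b.equivFun.symm x)‖ ^ 2 := by
    rw [← mul_pow]
    exact pow_le_pow_left₀ (norm_nonneg _) h1 2
  rw [inv_mul_le_iff₀ (by positivity), Q_eq_norm hΦ]
  have h4 : (n : ℝ) * ‖x‖ ^ 2 ≤ n * (K ^ 2 * ‖Φ (b.equivFun.symm x)‖ ^ 2) := by gcongr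
  nlinarith [sq_nonneg ‖Φ (b.equivFun.symm x)‖]

theorem summable_exp_neg_Q {n : ℕ} (b : Module.Basis (Fin n) ℝ V) {ε : ℝ} (hε : 0 < ε) :
    Summable fun m : Fin n → ℤ =>
      Real.exp (-(ε * L.Q (b.equivFun.symm fun i => (m i : ℝ)))) := by
  obtain ⟨c, hc, hcb⟩ := exists_Q_lower_bound L b
  refine Summable.of_nonneg_of_le (fun _ => (Real.exp_pos _).le) (fun m => ?_)
    (summable_prod_pi (fun _ => (Real.exp_pos _).le) (summable_exp_neg_mul_sq (mul_pos hε hc)) n)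
  rw [← Real.exp_sum, Real.exp_le_exp, Finset.sum_neg_distrib, ← Finset.mul_sum]
  have := mul_le_mul_of_nonneg_left (hcb fun i => (m i : ℝ)) hε.le
  linarith

theorem summable_exp_neg_Q_add {n : ℕ} (b : Module.Basis (Fin n) ℝ V) {ε : ℝ} (hε : 0 < ε)
    (u : V) : Summable fun m : Fin n → ℤ =>
      Real.exp (-(ε * L.Q ((b.equivFun.symm fun i => (m i : ℝ)) + u))) := by
  refine Summable.of_nonneg_of_le (fun _ => (Real.exp_pos _).le) (fun m => ?_)
    ((summable_exp_neg_Q L b (half_pos hε)).mul_left (Real.exp (ε * L.Q u)))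
  rw [← Real.exp_add, Real.exp_le_exp]
  have := mul_le_mul_of_nonneg_left
    (Q_add_lower_bound L (b.equivFun.symm fun i => (m i : ℝ)) u) hε.le
  linarith

end Gauss

/-! ### The inversion formula -/

section Inversion

open MeasureTheory

variable {V : Type*} [AddCommGroup V] [Module ℝ V]
variable (L : IntegralLattice V)

/-- Integer coordinates on a lattice. -/
theorem exists_int_coords {n : ℕ} (b : Module.Basis (Fin n) ℝ V) (N : Submodule ℤ V)
    (hN : N = Submodule.span ℤ (Set.range b)) :
    ∃ E : (Fin n → ℤ) ≃ N, ∀ m, (E m : V) = b.equivFun.symm fun i => (m i : ℝ) := by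
  subst hN
  refine ⟨(b.restrictScalars ℤ).equivFun.symm.toEquiv, fun m => ?_⟩
  simp [Module.Basis.equivFun_symm_apply, Int.cast_smul_eq_zsmul]

/-- Dual bases of `V` that span the lattice and its dual. -/
theorem exists_dual_bases : ∃ b b' : Module.Basis (Fin (Module.finrank ℝ V)) ℝ V,
    L.carrier = Submodule.span ℤ (Set.range b) ∧ L.dual = Submodule.span ℤ (Set.range b') ∧
    ∀ x y : Fin (Module.finrank ℝ V) → ℝ,
      L.form (b'.equivFun.symm x) (b.equivFun.symm y) = ∑ i, x i * y i := by
  obtain ⟨b, hb⟩ := L.exists_basis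
  refine ⟨b, L.form.dualBasis L.nondegenerate b, hb, ?_, fun x y => ?_⟩
  · rw [IntegralLattice.dual, hb, LinearMap.BilinForm.dualSubmodule_span_of_basis]
  · simp only [Module.Basis.equivFun_symm_apply, map_sum, LinearMap.sum_apply, map_smul,
      LinearMap.smul_apply, smul_eq_mul, LinearMap.BilinForm.apply_dualBasis_left]
    simp [mul_comm]

/-- Here `β = πi/τ` has positive real part because `Im(-1/τ) > 0`, and `π/β = -iτ` supplies the base
of the complex power. -/
theorem gauss_integral (Φ : V ≃ₗ[ℝ] EuclideanSpace ℝ (Fin (Module.finrank ℝ V)))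
    (hΦ : ∀ x y, inner ℝ (Φ x) (Φ y) = L.form x y) (τ : ℍ) (v : V) :
    Integrable (fun y => e (-(τ : ℂ)⁻¹ * L.Q (Φ.symm y) + L.form (Φ.symm y) v)) ∧
    ∫ y, e (-(τ : ℂ)⁻¹ * L.Q (Φ.symm y) + L.form (Φ.symm y) v) =
      (-Complex.I * τ) ^ ((Module.finrank ℝ V : ℂ) / 2) * e (τ * L.Q v) := by
  have hτ := τ.ne_zero
  have hπ : (Real.pi : ℂ) ≠ 0 := by exact_mod_cast Real.pi_pos.ne'
  set β : ℂ := Real.pi * Complex.I / τ with hβ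
  have hre : 0 < β.re := by
    have h1 := UpperHalfPlane.im_inv_neg_coe_pos τ
    have : β.re = Real.pi * ((-τ : ℂ)⁻¹).im := by
      rw [hβ, inv_neg, mul_div_assoc, Complex.re_ofReal_mul, div_eq_mul_inv]
      simp
    rw [this]
    positivity
  have hf : ∀ y, e (-(τ : ℂ)⁻¹ * L.Q (Φ.symm y) + L.form (Φ.symm y) v) =
      Complex.exp (-β * (‖y‖ : ℂ) ^ 2 + (2 * Real.pi * Complex.I) * (inner ℝ (Φ v) y : ℝ)) := by
    intro y
    rw [e, Q_eq_norm hΦ, ← hΦ, Φ.apply_symm_apply, real_inner_comm]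
    congr 1
    push_cast
    rw [hβ]
    field_simp
  simp only [hf]
  refine ⟨GaussianFourier.integrable_cexp_neg_mul_sq_norm_add hre _ _, ?_⟩
  rw [GaussianFourier.integral_cexp_neg_mul_sq_norm_add hre, finrank_euclideanSpace_fin]
  congr 2
  · rw [hβ]
    field_simp
    linear_combination Complex.I_sq
  · rw [Q_eq_norm hΦ, hβ]
    push_cast
    field_simp
    ring

/-- Poisson summation for Gaussian functions on a lattice. -/
theorem gauss_poisson [FiniteDimensional ℝ V] : ∃ K : ℝ, 0 < K ∧ ∀ (τ : ℍ) (u v : V),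
    ∑' x : L.carrier, e (-(τ : ℂ)⁻¹ * L.Q (x + u) + L.form (x + u) v) =
      K * (-Complex.I * τ) ^ ((Module.finrank ℝ V : ℂ) / 2) *
        ∑' y : L.dual, e (τ * L.Q (y - v) + L.form y u) := by
  obtain ⟨b, b', hb, hb', hbb⟩ := exists_dual_bases L
  obtain ⟨E, hE⟩ := exists_int_coords b _ hb
  obtain ⟨E', hE'⟩ := exists_int_coords b' _ hb'
  obtain ⟨Φ, hΦ⟩ := exists_isometry L
  obtain ⟨K, hK, hKint⟩ := exists_integral_comp_linearEquiv
    (b.equivFun.symm.trans Φ).toContinuousLinearEquiv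
  refine ⟨K, hK, fun τ u v => ?_⟩
  set ψ := b.equivFun.symm with hψ
  set f : (Fin (Module.finrank ℝ V) → ℝ) → ℂ := fun x =>
    e (-(τ : ℂ)⁻¹ * L.Q (ψ x + u) + L.form (ψ x + u) v) with hf
  have hψc : Continuous fun x => L.Q (ψ x + u) := by
    have h1 : Continuous (ψ.trans Φ) := (ψ.trans Φ).toContinuousLinearEquiv.continuous
    have h2 : ∀ x, L.Q (ψ x + u) = ‖(ψ.trans Φ) x + Φ u‖ ^ 2 / 2 := fun x => by
      rw [Q_eq_norm hΦ, map_add]; rfl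
    simp only [h2]
    fun_prop
  have hψc' : Continuous fun x => L.form (ψ x + u) v := by
    have h1 : Continuous (ψ.trans Φ) := (ψ.trans Φ).toContinuousLinearEquiv.continuous
    have h2 : ∀ x, L.form (ψ x + u) v = inner ℝ ((ψ.trans Φ) x + Φ u) (Φ v) := fun x => by
      rw [← hΦ, map_add]; rfl
    simp only [h2]
    fun_prop
  have him : 0 < (-(τ : ℂ)⁻¹).im := by
    have h1 := UpperHalfPlane.im_inv_neg_coe_pos τ
    rwa [inv_neg] at h1
  have hcont : Continuous f := by
    rw [hf]
    unfold e
    fun_prop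
  have hint : ∀ w : V, Integrable (fun x => e (-(τ : ℂ)⁻¹ * L.Q (ψ x + u) + L.form (ψ x + u) w)) ∧
      ∫ x, e (-(τ : ℂ)⁻¹ * L.Q (ψ x + u) + L.form (ψ x + u) w) =
      K * ((-Complex.I * τ) ^ ((Module.finrank ℝ V : ℂ) / 2) * e (τ * L.Q w)) := by
    intro w
    obtain ⟨h1, h2⟩ := gauss_integral L Φ hΦ τ w
    have h3 := hKint _ (h1.comp_add_right (Φ u))
    rw [integral_add_right_eq_self
      (fun y => e (-(τ : ℂ)⁻¹ * L.Q (Φ.symm y) + L.form (Φ.symm y) w)), h2] at h3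
    have h4 : ∀ x, Φ.symm ((ψ.trans Φ).toContinuousLinearEquiv x + Φ u) = ψ x + u := by
      intro x
      rw [map_add, Φ.symm_apply_apply]
      congr 1
      exact Φ.symm_apply_apply _
    simp only [h4] at h3
    exact h3
  have hcoef : ∀ k : Fin (Module.finrank ℝ V) → ℤ, ∫ x, e (-∑ i, (k i : ℂ) * x i) * f x =
      K * (-Complex.I * τ) ^ ((Module.finrank ℝ V : ℂ) / 2) *
        e (τ * L.Q ((E' k : V) - v) + L.form (E' k : V) u) := by
    intro k
    -- In dual bases the frequency `k` is a dual lattice vector `y`. The character merely replaces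
    -- `v` by `v - y` in the Gaussian, up to the constant `e(B(y, u))`.
    have h1 : ∀ x, e (-∑ i, (k i : ℂ) * x i) * f x = e (L.form (E' k : V) u) *
        e (-(τ : ℂ)⁻¹ * L.Q (ψ x + u) + L.form (ψ x + u) (v - E' k)) := by
      intro x
      have h2 : (∑ i, (k i : ℂ) * x i) = (L.form (E' k : V) (ψ x) : ℂ) := by
        rw [hE', hbb]
        push_cast
        rfl
      rw [h2, hf, ← e_add, ← e_add, map_sub, L.symm _ (ψ x), L.symm _ u]
      congr 1
      simp only [map_add, LinearMap.add_apply]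
      push_cast
      ring
    simp only [h1]
    rw [integral_const_mul, (hint _).2, e_add]
    have h3 : L.Q (v - E' k) = L.Q (E' k - v) := by
      rw [← neg_sub, IntegralLattice.Q, LinearMap.map_neg₂, map_neg, neg_neg, IntegralLattice.Q]
    rw [h3]
    ring
  have hP := tsum_eq_tsum_fourier hcont (hint v).1 (fun R => ?_) ?_
  · rw [← Equiv.tsum_eq E, ← Equiv.tsum_eq E', ← tsum_mul_left]
    simp only [hcoef] at hP
    rw [← hP]
    simp only [hE, hf]
  · obtain ⟨C, hC⟩ := (isCompact_closedBall (0 : Fin (Module.finrank ℝ V) → ℝ)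
      R).exists_bound_of_continuousOn hψc.continuousOn
    have hpos : 0 < 2 * Real.pi * (-(τ : ℂ)⁻¹).im := by positivity
    -- With `C` bounding `Q(ψ x + u)` on the ball, the translate by `m` has `Q ≥ Q(m)/2 - C`, hence
    -- half the decay rate and the factor involving `C`.
    refine ⟨_, (summable_exp_neg_Q L b (half_pos hpos)).mul_left
      (Real.exp (2 * Real.pi * (-(τ : ℂ)⁻¹).im * C)), fun x hx m => ?_⟩
    rw [hf]
    simp only
    rw [norm_e_mul_Q, ← Real.exp_add, Real.exp_le_exp, map_add, add_comm (ψ x), add_assoc]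
    have h1 := Q_add_lower_bound L (ψ fun i => (m i : ℝ)) (ψ x + u)
    have h2 := (le_abs_self _).trans (hC x (by simpa using hx))
    have h3 := mul_le_mul_of_nonneg_left (h1.trans' (sub_le_sub_left h2 _)) hpos.le
    linarith
  · simp only [hcoef]
    refine Summable.mul_left _ (Summable.of_norm ?_)
    simp only [norm_e_mul_Q, hE', sub_eq_add_neg]
    exact summable_exp_neg_Q_add L b' (by have := τ.im_pos; positivity) _

end Inversion

/-! ### Theta series -/

section ThetaSeries

variable {V : Type*} [AddCommGroup V] [Module ℝ V]

theorem mat_S_mul_S : (Mp2Z.S * Mp2Z.S).mat = -1 :=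
  Subtype.ext ModularGroup.S_mul_S_eq

/-- The arguments `-π/2` of `-i` and `arg τ ∈ [0, π]` add up inside `(-π, π]`. Principal logarithms
therefore add, and the chosen root of `τ` cancels against the Gaussian factor. -/
theorem neg_I_mul_cpow (τ : ℍ) (n : ℕ) :
    ((τ : ℂ) ^ (1 / 2 : ℂ)) ^ (-(n : ℤ)) * (-Complex.I * τ) ^ ((n : ℂ) / 2) =
      (-Complex.I) ^ ((n : ℂ) / 2) := by
  have h : (-Complex.I * τ) ^ ((n : ℂ) / 2) =
      (-Complex.I) ^ ((n : ℂ) / 2) * (τ : ℂ) ^ ((n : ℂ) / 2) := by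
    have hI : -Complex.I ≠ 0 := neg_ne_zero.mpr Complex.I_ne_zero
    have harg : Complex.arg (-Complex.I) = -(Real.pi / 2) := by simp
    have h1 : 0 ≤ Complex.arg τ := Complex.arg_nonneg_iff.mpr τ.im_pos.le
    have h2 : Complex.arg τ ≤ Real.pi := Complex.arg_le_pi _
    have hπ := Real.pi_pos
    rw [Complex.cpow_def_of_ne_zero (mul_ne_zero hI τ.ne_zero), Complex.cpow_def_of_ne_zero hI,
      Complex.cpow_def_of_ne_zero τ.ne_zero, ← Complex.exp_add,
      Complex.log_mul hI τ.ne_zero (by rw [harg]; constructor <;> linarith)]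
    ring_nf
  have h2 : ((τ : ℂ) ^ (1 / 2 : ℂ)) ^ (-(n : ℤ)) = (τ : ℂ) ^ (-((n : ℂ) / 2)) := by
    rw [← Complex.cpow_mul_int]
    congr 1
    push_cast
    ring
  rw [h, h2, mul_left_comm, ← Complex.cpow_add _ _ τ.ne_zero, neg_add_cancel, Complex.cpow_zero,
    mul_one]

/-- `1` and `τ` form a real basis of `ℂ`. Through `v` and `w` a complex variable `z` becomes the
pair of real shifts in `gauss_poisson`. -/
theorem exists_decomposition (τ : ℍ) (z : ℂ ⊗[ℝ] V) :
    ∃ v w : V, z = (τ : ℂ) ⊗ₜ[ℝ] v + (1 : ℂ) ⊗ₜ[ℝ] w := by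
  induction z with
  | zero => exact ⟨0, 0, by simp⟩
  | add z z' hz hz' =>
    obtain ⟨v, w, rfl⟩ := hz
    obtain ⟨v', w', rfl⟩ := hz'
    exact ⟨v + v', w + w', by simp only [TensorProduct.tmul_add]; abel⟩
  | tmul a x =>
    have hτ : (τ.im : ℂ) ≠ 0 := by exact_mod_cast τ.im_pos.ne'
    refine ⟨(a.im / τ.im) • x, (a.re - a.im / τ.im * τ.re) • x, ?_⟩
    rw [← TensorProduct.smul_tmul, ← TensorProduct.smul_tmul, ← TensorProduct.add_tmul]
    congr 1
    apply Complex.ext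
    · simp
    · simp [τ.im_pos.ne']

variable (L : IntegralLattice V)

theorem form_dual_int (x : L.dual) {v : V} (hv : v ∈ L.carrier) : ∃ m : ℤ, L.form (x : V) v = m := by
  obtain ⟨m, hm⟩ := Submodule.mem_one.mp (x.2 v hv)
  exact ⟨m, by simpa using hm.symm⟩

theorem toDisc_eq_iff (x y : L.dual) : L.toDisc x = L.toDisc y ↔ (x : V) - y ∈ L.carrier :=
  Submodule.Quotient.eq (L.carrier.submoduleOf L.dual)

/-- The general term of the theta series. -/
def thetaTerm (τ : ℍ) (z : ℂ ⊗[ℝ] V) (x : V) : ℂ :=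
  e (τ * L.Q x + L.formC ((1 : ℂ) ⊗ₜ[ℝ] x) z)

theorem e_neg_form_congr (x : L.dual) {y y' : L.dual} (h : L.toDisc y = L.toDisc y') :
    e (-(L.form (x : V) (y : V))) = e (-(L.form (x : V) (y' : V))) := by
  obtain ⟨m, hm⟩ := form_dual_int L x ((toDisc_eq_iff L y y').mp h)
  rw [map_sub, sub_eq_iff_eq_add] at hm
  rw [hm, Complex.ofReal_add, neg_add, e_add, Complex.ofReal_intCast, ← Int.cast_neg, e_intCast,
    one_mul]

theorem theta_eq_tsum_carrier (x : L.dual) (τ : ℍ) (z : ℂ ⊗[ℝ] V) :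
    theta L (L.toDisc x) τ z = ∑' l : L.carrier, thetaTerm L τ z (l + x) := by
  let E : L.carrier ≃ {v : L.dual // L.toDisc v = L.toDisc x} :=
    { toFun := fun l => ⟨⟨l, L.carrier_le_dual l.2⟩ + x, (toDisc_eq_iff L _ _).mpr (by simp)⟩
      invFun := fun v => ⟨v.1 - x, (toDisc_eq_iff L _ _).mp v.2⟩
      left_inv := fun l => by simp
      right_inv := fun v => by ext; simp }
  rw [theta, ← E.tsum_eq]
  rfl

/-- For `z = τv + w`, completing the square turns the norm of the term into a constant times a
Gaussian at `x + v`. -/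
theorem summable_thetaTerm [FiniteDimensional ℝ V] (τ : ℍ) (z : ℂ ⊗[ℝ] V) :
    Summable fun x : L.dual => thetaTerm L τ z x := by
  obtain ⟨b, b', -, hb', -⟩ := exists_dual_bases L
  obtain ⟨E, hE⟩ := exists_int_coords b' _ hb'
  obtain ⟨v, w, rfl⟩ := exists_decomposition τ z
  rw [← E.summable_iff]
  have h := ((summable_exp_neg_Q_add L b' (ε := 2 * Real.pi * τ.im)
    (by have := τ.im_pos; positivity) v).mul_left ‖e (-(τ * L.Q v))‖)
  refine Summable.of_norm (h.congr fun m => ?_)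
  rw [← hE, ← UpperHalfPlane.coe_im, ← norm_e_mul_Q τ (L.Q (E m + v)) (L.form (E m : V) w),
    ← norm_mul, ← e_add, Function.comp_apply, thetaTerm, map_add, L.formC_tmul, L.formC_tmul,
    L.Q_add]
  congr 2
  push_cast
  ring

variable [FiniteDimensional ℝ V]

/-- Linear combinations of theta series as sums over the dual lattice. -/
theorem hasSum_theta (f : L.Disc → ℂ) (τ : ℍ) (z : ℂ ⊗[ℝ] V) :
    HasSum (fun x : L.dual => f (L.toDisc x) * thetaTerm L τ z x) (∑ t, f t * theta L t τ z) := by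
  obtain ⟨C, hC⟩ : ∃ C, ∀ t, ‖f t‖ ≤ C := by
    obtain ⟨C, hC⟩ := (Set.finite_range fun t => ‖f t‖).bddAbove
    exact ⟨C, fun t => hC ⟨t, rfl⟩⟩
  have hs : Summable fun x : L.dual => f (L.toDisc x) * thetaTerm L τ z x :=
    Summable.of_norm_bounded ((summable_thetaTerm L τ z).norm.mul_left C) fun x => by
      rw [norm_mul]
      exact mul_le_mul_of_nonneg_right (hC _) (norm_nonneg _)
  have h := hs.hasSum.tsum_fiberwise L.toDisc
  have h2 : ∑ t, f t * theta L t τ z = ∑' x : L.dual, f (L.toDisc x) * thetaTerm L τ z x := by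
    rw [h.unique (hasSum_fintype _)]
    refine Finset.sum_congr rfl fun t _ => ?_
    rw [theta, ← tsum_mul_left]
    refine tsum_congr fun x => ?_
    rw [show L.toDisc x.1 = t from x.2]
    rfl
  rw [h2]
  exact hs.hasSum

/-- The theta series are linearly independent for every fixed `τ`. -/
theorem theta_linearIndependent {f : L.Disc → ℂ} {τ : ℍ}
    (h : ∀ z, ∑ t, f t * theta L t τ z = 0) : f = 0 := by
  have key : (fun x : L.dual => f (L.toDisc x) * e (τ * L.Q (x : V))) = 0 := by
    -- On real `z = u` the terms are distinct characters of `V` with coefficients `f(x) e(τQ(x))`.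
    refine eq_zero_of_hasSum_addChar (χ := fun x : L.dual => formChar L (x : V))
      ((formChar_injective L).comp Subtype.val_injective) fun u => ?_
    have := hasSum_theta L f τ ((1 : ℂ) ⊗ₜ[ℝ] u)
    rw [h] at this
    refine this.congr_fun fun x => ?_
    rw [thetaTerm, coe_formChar, e_add, L.formC_tmul, one_mul, one_mul, mul_assoc]
  ext t
  obtain ⟨x, rfl⟩ := Submodule.Quotient.mk_surjective _ t
  simpa [e_ne_zero] using congrFun key x

open Classical in
theorem hasSum_theta_single (t : L.Disc) (τ : ℍ) (z : ℂ ⊗[ℝ] V) :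
    HasSum (fun x : L.dual => if L.toDisc x = t then thetaTerm L τ z x else 0) (theta L t τ z) := by
  have := hasSum_theta L (Pi.single t 1) τ z
  have h2 : ∑ s, (Pi.single t 1 : L.Disc → ℂ) s * theta L s τ z = theta L t τ z := by
    simp [Pi.single_apply]
  rw [h2] at this
  refine this.congr_fun fun x => ?_
  simp [Pi.single_apply]

/-- The substitution `x ↦ x + v` preserves the class, and the leftover factor `e(B(x, w))` is `1`
for `x` in the dual lattice. -/
theorem jacobiSlash_theta_heis (κ : ℤ) (t : L.Disc) {v w : V} (hv : v ∈ L.carrier)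
    (hw : w ∈ L.carrier) (ξ : Circle) (τ : ℍ) (z : ℂ ⊗[ℝ] V) :
    jacobiSlash κ (theta L t) (heis L v w ξ) τ z =
      (ξ : ℂ) * e ((1 / 2) * L.form v w) * theta L t τ z := by
  rw [jacobiSlash_heis, smul_eq_mul]
  have h1 := (hasSum_theta_single L t τ (translate v w τ z)).mul_left
    ((ξ : ℂ) * e (τ * L.Q v + L.formC ((1 : ℂ) ⊗ₜ[ℝ] v) z + (1 / 2) * L.form v w))
  have h2 := (hasSum_theta_single L t τ z).mul_left ((ξ : ℂ) * e ((1 / 2) * L.form v w))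
  rw [← (Equiv.addRight (⟨v, L.carrier_le_dual hv⟩ : L.dual)).hasSum_iff] at h2
  refine h1.unique (h2.congr_fun fun x => ?_)
  have hx : L.toDisc (x + ⟨v, L.carrier_le_dual hv⟩) = L.toDisc x := by
    rw [toDisc_eq_iff]
    simpa using hv
  simp only [Function.comp_apply, Equiv.coe_addRight]
  by_cases ht : L.toDisc x = t
  · rw [if_pos ht, if_pos (hx.trans ht)]
    obtain ⟨m, hm⟩ := form_dual_int L x hw
    have hm' : e (L.form (x : V) w) = 1 := by rw [hm]; exact e_intCast m
    have : e (τ * L.Q v + L.formC ((1 : ℂ) ⊗ₜ[ℝ] v) z + (1 / 2) * L.form v w) *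
        thetaTerm L τ (translate v w τ z) x = e ((1 / 2) * L.form v w) *
        thetaTerm L τ z (x + v) * e (L.form (x : V) w) := by
      rw [thetaTerm, thetaTerm, ← e_add, ← e_add, ← e_add]
      congr 1
      simp only [translate, L.Q_add, map_add, TensorProduct.tmul_add, LinearMap.add_apply,
        L.formC_tmul]
      push_cast
      ring
    rw [mul_assoc, this, hm', mul_one, mul_assoc]
    rfl
  · rw [if_neg ht, if_neg (hx ▸ ht), mul_zero, mul_zero]

/-- Evenness enters here: it makes `Q` modulo `ℤ` constant on the classes of `L♯/L`. -/
theorem jacobiSlash_theta_T (κ : ℤ) (hL : L.IsEven) (x : L.dual) (τ : ℍ) (z : ℂ ⊗[ℝ] V) :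
    jacobiSlash κ (theta L (L.toDisc x)) (ofMp L Mp2Z.T) τ z =
      e (L.Q (x : V)) * theta L (L.toDisc x) τ z := by
  have h0 : jacobiSlash κ (theta L (L.toDisc x)) (ofMp L Mp2Z.T) τ z =
      theta L (L.toDisc x) (ModularGroup.T • τ) z := by
    simp [jacobiSlash, jacobiFactor, ofMp, Mp2Z.T, ModularGroup.T, translate, e_zero,
      IntegralLattice.Q]
  rw [h0]
  refine (hasSum_theta_single L _ _ z).unique
    (((hasSum_theta_single L _ τ z).mul_left _).congr_fun fun y => ?_)
  rw [mul_ite, mul_zero]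
  split_ifs with h
  · have hxy := (toDisc_eq_iff L y x).mp h
    obtain ⟨m, hm⟩ := hL _ hxy
    obtain ⟨m', hm'⟩ := form_dual_int L x hxy
    have hQ : L.Q (y : V) = L.Q (x : V) + ((m + m' : ℤ) : ℝ) := by
      have := L.Q_add (x : V) (y - x)
      rw [add_sub_cancel, hm, hm'] at this
      rw [this]
      push_cast
      ring
    have hQ' : e (L.Q (x : V)) = e (L.Q (y : V)) := by
      rw [hQ, Complex.ofReal_add, e_add, Complex.ofReal_intCast, e_intCast, mul_one]
    rw [hQ', thetaTerm, thetaTerm, ← e_add, UpperHalfPlane.modular_T_smul,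
      UpperHalfPlane.coe_vadd]
    congr 1
    push_cast
    ring
  · rfl

/-- The inversion formula up to the determination of a positive constant. -/
theorem exists_jacobiSlash_theta_S : ∃ K : ℝ, 0 < K ∧ ∀ (x : L.dual) (τ : ℍ) (z : ℂ ⊗[ℝ] V),
    jacobiSlash (Module.finrank ℝ V) (theta L (L.toDisc x)) (ofMp L Mp2Z.S) τ z =
      K * (-Complex.I) ^ ((Module.finrank ℝ V : ℂ) / 2) * ∑ s : L.Disc,
        e (-(L.form (x : V) ((Quotient.out s : L.dual) : V))) * theta L s τ z := by
  obtain ⟨K, hK, H⟩ := gauss_poisson L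
  refine ⟨K, hK, fun x τ z => ?_⟩
  have h0 : jacobiSlash (Module.finrank ℝ V) (theta L (L.toDisc x)) (ofMp L Mp2Z.S) τ z =
      ((τ : ℂ) ^ (1 / 2 : ℂ)) ^ (-(Module.finrank ℝ V : ℤ)) * (e (-(τ : ℂ)⁻¹ * L.QC z) *
        theta L (L.toDisc x) (ModularGroup.S • τ) ((τ : ℂ)⁻¹ • z)) := by
    simp [jacobiSlash, jacobiFactor, ofMp, Mp2Z.S, ModularGroup.S, translate,
      IntegralLattice.Q, mul_assoc]
  have hsum := hasSum_theta L
    (fun s => e (-(L.form (x : V) ((Quotient.out s : L.dual) : V)))) τ z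
  rw [h0, ← hsum.tsum_eq, theta_eq_tsum_carrier, ← neg_I_mul_cpow τ]
  obtain ⟨v, w, rfl⟩ := exists_decomposition τ z
  have hτ := τ.ne_zero
  -- Completing the square absorbs `w` into the shift `u = x - w` and leaves `v` as the linear
  -- parameter.
  have hl : ∀ l : L.carrier, e (-(τ : ℂ)⁻¹ * L.QC ((τ : ℂ) ⊗ₜ[ℝ] v + (1 : ℂ) ⊗ₜ[ℝ] w)) *
      thetaTerm L (ModularGroup.S • τ) ((τ : ℂ)⁻¹ • ((τ : ℂ) ⊗ₜ[ℝ] v + (1 : ℂ) ⊗ₜ[ℝ] w)) (l + x) =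
      e (-(τ * L.Q v)) *
        e (-(τ : ℂ)⁻¹ * L.Q (l + (x - w)) + L.form (l + (x - w)) v) := by
    intro l
    have hS : ((ModularGroup.S • τ : ℍ) : ℂ) = -(τ : ℂ)⁻¹ := by
      rw [UpperHalfPlane.modular_S_smul, UpperHalfPlane.coe_mk, inv_neg]
    rw [thetaTerm, ← e_add, ← e_add, hS, map_smul, map_add, L.formC_tmul, L.formC_tmul, L.QC_add, L.QC_tmul, L.QC_tmul, L.formC_tmul,
      ← add_sub_assoc, sub_eq_add_neg _ w, L.Q_add (l + x), map_add, map_neg,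
      L.symm v w]
    congr 1
    simp only [IntegralLattice.Q, map_add, map_neg, LinearMap.add_apply, LinearMap.neg_apply,
      smul_eq_mul]
    push_cast
    field_simp
    ring
  -- Poisson summation yields `Q(y - v)` and `+B(y, x)`. Replacing `y` by `-y` restores `Q(y + v)`
  -- and the sign in `e(-B(x, y))`.
  have hy : ∀ y : L.dual, e (-(τ * L.Q v)) *
      e (τ * L.Q (((-y : L.dual) : V) - v) + L.form ((-y : L.dual) : V) (x - w)) =
      e (-(L.form (x : V) ((Quotient.out (L.toDisc y) : L.dual) : V))) *
        thetaTerm L τ ((τ : ℂ) ⊗ₜ[ℝ] v + (1 : ℂ) ⊗ₜ[ℝ] w) y := by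
    intro y
    rw [e_neg_form_congr L x (y' := y) (Quotient.out_eq _), thetaTerm, ← e_add, ← e_add, map_add,
      L.formC_tmul, L.formC_tmul, L.symm (x : V) y]
    have : L.Q (((-y : L.dual) : V) - v) = L.Q ((y : V) + v) := by
      rw [Submodule.coe_neg, ← neg_add', IntegralLattice.Q, LinearMap.map_neg₂, map_neg, neg_neg,
        IntegralLattice.Q]
    rw [this, L.Q_add, Submodule.coe_neg, map_neg, LinearMap.neg_apply, map_sub]
    congr 1
    push_cast
    ring
  have hneg := (Equiv.neg L.dual).tsum_eq fun y : L.dual =>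
    e (τ * L.Q ((y : V) - v) + L.form (y : V) (x - w))
  rw [← tsum_mul_left, tsum_congr hl, tsum_mul_left, H, ← tsum_congr hy, tsum_mul_left,
    ← hneg]
  simp only [Equiv.neg_apply]
  ring

theorem theta_zero_neg (τ : ℍ) (z : ℂ ⊗[ℝ] V) : theta L 0 τ (-z) = theta L 0 τ z := by
  have h := hasSum_theta_single L 0 τ (-z)
  rw [← (Equiv.neg L.dual).hasSum_iff] at h
  refine h.unique ((hasSum_theta_single L 0 τ z).congr_fun fun x => ?_)
  have h1 : (L.toDisc (-x) = 0) ↔ (L.toDisc x = 0) := neg_eq_zero (a := L.toDisc x)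
  have h2 : thetaTerm L τ (-z) (-x : L.dual) = thetaTerm L τ z x := by
    simp [thetaTerm, IntegralLattice.Q, TensorProduct.tmul_neg]
  simp only [Function.comp_apply, Equiv.neg_apply, h2]
  by_cases h : L.toDisc x = 0
  · rw [if_pos h, if_pos (h1.mpr h)]
  · rw [if_neg h, if_neg (mt h1.mp h)]

theorem jacobiSlash_theta_S_sq (κ : ℤ) (τ : ℍ) (z : ℂ ⊗[ℝ] V) :
    jacobiSlash κ (theta L 0) (ofMp L (Mp2Z.S * Mp2Z.S)) τ z =
      (Mp2Z.S * Mp2Z.S).root τ ^ (-κ) * theta L 0 τ z := by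
  rw [← theta_zero_neg]
  simp [jacobiSlash, jacobiFactor, ofMp, mat_S_mul_S, translate, IntegralLattice.Q, e_zero]

/-- The normalization of the inversion formula. -/
theorem inversion_constant {K : ℝ} (hK : 0 < K) (H : ∀ (x : L.dual) (τ : ℍ) (z : ℂ ⊗[ℝ] V),
    jacobiSlash (Module.finrank ℝ V) (theta L (L.toDisc x)) (ofMp L Mp2Z.S) τ z =
      K * (-Complex.I) ^ ((Module.finrank ℝ V : ℂ) / 2) * ∑ s : L.Disc,
        e (-(L.form (x : V) ((Quotient.out s : L.dual) : V))) * theta L s τ z) :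
    K = (Real.sqrt (Nat.card L.Disc))⁻¹ := by
  classical
  set C : ℂ := K * (-Complex.I) ^ ((Module.finrank ℝ V : ℂ) / 2) with hC
  set ε : ℂ := (Mp2Z.S * Mp2Z.S).root UpperHalfPlane.I ^ (-(Module.finrank ℝ V : ℤ)) with hε
  have h1 : jacobiSlash (Module.finrank ℝ V) (theta L 0) (ofMp L Mp2Z.S) =
      fun τ z => C * ∑ s : L.Disc, theta L s τ z := by
    ext τ z
    have := H 0 τ z
    simpa [e_zero] using this
  -- Applying `S` twice to `ϑ_0` is computed in two ways: as the matrix `-1`, which contributes only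
  -- the unimodular scalar `ε`, and through the inversion formula.
  have h2 : ∀ z, ε * theta L 0 UpperHalfPlane.I z = ∑ u : L.Disc, (C ^ 2 * ∑ s : L.Disc,
      e (-(L.form ((Quotient.out s : L.dual) : V) ((Quotient.out u : L.dual) : V)))) *
        theta L u UpperHalfPlane.I z := by
    intro z
    rw [hε, ← jacobiSlash_theta_S_sq, map_mul, jacobiSlash_mul, h1]
    have h3 : jacobiSlash (Module.finrank ℝ V) (fun τ z => C * ∑ s : L.Disc, theta L s τ z)
        (ofMp L Mp2Z.S) UpperHalfPlane.I z = C * ∑ s : L.Disc,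
        jacobiSlash (Module.finrank ℝ V) (theta L s) (ofMp L Mp2Z.S) UpperHalfPlane.I z := by
      simp only [jacobiSlash, smul_eq_mul, Finset.mul_sum]
      exact Finset.sum_congr rfl fun s _ => by ring
    have h4 : ∀ s : L.Disc,
        jacobiSlash (Module.finrank ℝ V) (theta L s) (ofMp L Mp2Z.S) UpperHalfPlane.I z =
        C * ∑ u : L.Disc, e (-(L.form ((Quotient.out s : L.dual) : V)
          ((Quotient.out u : L.dual) : V))) * theta L u UpperHalfPlane.I z := fun s => by
      have := H (Quotient.out s) UpperHalfPlane.I z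
      rwa [show L.toDisc (Quotient.out s) = s from Quotient.out_eq s] at this
    rw [h3]
    simp only [h4, ← Finset.mul_sum]
    rw [← mul_assoc, ← pow_two, Finset.sum_comm]
    simp only [Finset.mul_sum, Finset.sum_mul, mul_assoc]
  have h5 := theta_linearIndependent L (τ := UpperHalfPlane.I) (f := fun u => (C ^ 2 * ∑ s : L.Disc,
      e (-(L.form ((Quotient.out s : L.dual) : V) ((Quotient.out u : L.dual) : V)))) -
      if u = 0 then ε else 0) fun z => by
    simp only [sub_mul, Finset.sum_sub_distrib, ← h2]
    simp
  -- Comparison of the coefficients of `ϑ_0` gives `C² |L♯/L| = ε`. Taking norms yields `K² |L♯/L| =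
  -- 1`.
  have h6 := congrFun h5 0
  have h7 : ∀ s : L.Disc, e (-(L.form ((Quotient.out s : L.dual) : V)
      ((Quotient.out (0 : L.Disc) : L.dual) : V))) = 1 := fun s => by
    have := e_neg_form_congr L (Quotient.out s) (y := Quotient.out (0 : L.Disc)) (y' := 0)
      (Quotient.out_eq _)
    rw [this]
    simp [e_zero]
  simp only [h7, if_true, Pi.zero_apply, sub_eq_zero] at h6
  have hI : ‖(-Complex.I) ^ ((Module.finrank ℝ V : ℂ) / 2)‖ = 1 := by
    rw [Complex.norm_cpow_of_ne_zero (neg_ne_zero.mpr Complex.I_ne_zero)]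
    simp
  have hε1 : ‖ε‖ = 1 := by
    have h8 := (Mp2Z.S * Mp2Z.S).sq_root UpperHalfPlane.I
    have h9 : ‖(Mp2Z.S * Mp2Z.S).root UpperHalfPlane.I‖ ^ 2 = 1 := by
      rw [← norm_pow, h8, mat_S_mul_S]
      simp
    rw [hε, norm_zpow, (pow_eq_one_iff_of_nonneg (norm_nonneg _) two_ne_zero).mp h9, one_zpow]
  have h10 := congrArg norm h6
  rw [hε1, norm_mul, norm_pow, hC, norm_mul, hI, mul_one, Complex.norm_real,
    Real.norm_of_nonneg hK.le] at h10
  simp only [Finset.sum_const, Finset.card_univ, nsmul_eq_mul, mul_one, Complex.norm_natCast] at h10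
  rw [← Nat.card_eq_fintype_card] at h10
  have hD : (0 : ℝ) < Nat.card L.Disc := by exact_mod_cast Nat.card_pos
  rw [eq_comm, inv_eq_iff_eq_inv, Real.sqrt_eq_iff_mul_self_eq_of_pos (by positivity)]
  field_simp
  linarith

theorem jacobiSlash_theta_S (x : L.dual) (τ : ℍ) (z : ℂ ⊗[ℝ] V) :
    jacobiSlash (Module.finrank ℝ V) (theta L (L.toDisc x)) (ofMp L Mp2Z.S) τ z =
      (-Complex.I) ^ ((Module.finrank ℝ V : ℂ) / 2) / (Real.sqrt (Nat.card L.Disc) : ℂ) *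
      ∑ s : L.Disc, e (-(L.form (x : V) ((Quotient.out s : L.dual) : V))) * theta L s τ z := by
  obtain ⟨K, hK, H⟩ := exists_jacobiSlash_theta_S L
  rw [H, inversion_constant L hK H]
  push_cast
  ring

end ThetaSeries

/-! ### Generators of the metaplectic group -/

namespace Mp2Z

/-- `S⁴` is the nontrivial element of the kernel of the projection to `SL₂(ℤ)`. -/
theorem S_pow_four_root (τ : ℍ) : (S * S * (S * S)).root τ = -1 := by
  have h := (S * S).sq_root τ
  rw [root_mul, mat_S_mul_S, ModularGroup.SL_neg_smul, one_smul, ← pow_two, h,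
    mat_S_mul_S]
  simp

theorem S_pow_four_mat : (S * S * (S * S)).mat = 1 := by
  rw [mat_mul, mat_S_mul_S]
  simp

/-- The quotient of two roots over the same matrix is continuous with square `1`, hence a constant
sign on the connected upper half plane. -/
theorem eq_or_eq_of_mat_eq {g h : Mp2Z} (H : g.mat = h.mat) :
    g = h ∨ g = h * (S * S * (S * S)) := by
  have hsq : ∀ τ, (g.root τ / h.root τ) ^ 2 = 1 := fun τ => by
    have := h.root_ne_zero τ
    rw [div_pow, g.sq_root, h.sq_root, H, div_self (denom_ne _ _)]
  have hc : Continuous fun τ => g.root τ / h.root τ :=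
    g.continuous_root.div h.continuous_root h.root_ne_zero
  have h1 : (∀ τ, g.root τ / h.root τ = 1) ∨ ∀ τ, g.root τ / h.root τ = -1 := by
    have := IsPreconnected.eq_or_eq_neg_of_sq_eq (S := Set.univ) isPreconnected_univ
      hc.continuousOn (continuousOn_const (c := (1 : ℂ))) (fun τ _ => by simpa using hsq τ)
      (fun _ => one_ne_zero)
    exact this.imp (fun h τ => h (Set.mem_univ τ)) fun h τ => h (Set.mem_univ τ)
  refine h1.imp (fun h1 => ?_) fun h1 => ?_
  · ext1
    · exact H
    · ext τ
      exact (div_eq_one_iff_eq (h.root_ne_zero τ)).mp (h1 τ)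
  · ext1
    · rw [mat_mul, S_pow_four_mat, mul_one, H]
    · ext τ
      rw [root_mul, S_pow_four_mat, one_smul, S_pow_four_root, mul_neg_one]
      have := h1 τ
      rw [div_eq_iff (h.root_ne_zero τ)] at this
      rw [this, neg_one_mul]

/-- The images generate `SL₂(ℤ)`, and the kernel of the projection is already contained in the
subgroup, being generated by `S⁴`. -/
theorem closure_generators : Subgroup.closure {T, S} = ⊤ := by
  have hmap : (Subgroup.closure {T, S}).map proj = ⊤ := by
    rw [MonoidHom.map_closure, Set.image_pair, ← _root_.SpecialLinearGroup.SL2Z_generators,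
      Set.pair_comm]
    rfl
  have hS : S ∈ Subgroup.closure {T, S} := Subgroup.subset_closure (by simp)
  have hS4 : S * S * (S * S) ∈ Subgroup.closure {T, S} :=
    mul_mem (mul_mem hS hS) (mul_mem hS hS)
  refine eq_top_iff.mpr fun g _ => ?_
  obtain ⟨h, hh, hg⟩ : g.mat ∈ (Subgroup.closure {T, S}).map proj := hmap ▸ Subgroup.mem_top _
  rcases eq_or_eq_of_mat_eq (g := g) (h := h) hg.symm with rfl | rfl
  · exact hh
  · exact mul_mem hh hS4

end Mp2Z

/-! ### The Weil representation -/

section Weil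

variable {V : Type*} [AddCommGroup V] [Module ℝ V] (L : IntegralLattice V)

/-- The vector `∑ ϑ_t(τ, z) δ_t`. -/
def thetaVec (τ : ℍ) (z : ℂ ⊗[ℝ] V) : L.Disc →₀ ℂ :=
  Finsupp.equivFunOnFinite.symm fun t => theta L t τ z

theorem thetaVec_apply (τ : ℍ) (z : ℂ ⊗[ℝ] V) (t : L.Disc) :
    thetaVec L τ z t = theta L t τ z := rfl

theorem map_eq_sum {ι : Type*} [Fintype ι] {Y : Type*} [AddCommGroup Y] [Module ℂ Y]
    (A : (ι →₀ ℂ) →ₗ[ℂ] Y) (x : ι →₀ ℂ) : A x = ∑ t, x t • A (Finsupp.single t 1) := by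
  conv_lhs => rw [← Finsupp.sum_single x, Finsupp.sum_fintype _ _ (by simp)]
  rw [map_sum]
  refine Finset.sum_congr rfl fun t _ => ?_
  rw [← map_smul, Finsupp.smul_single, smul_eq_mul, mul_one]

theorem jacobiSlash_thetaVec_apply (κ : ℤ) (g : JacobiGroup L) (τ : ℍ) (z : ℂ ⊗[ℝ] V)
    (t : L.Disc) : jacobiSlash κ (thetaVec L) g τ z t = jacobiSlash κ (theta L t) g τ z := by
  simp only [jacobiSlash, Finsupp.smul_apply, thetaVec_apply]

/-- `M` describes the action of `g` on the theta series. -/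
def IsThetaTransform (g : JacobiGroup L) (M : (L.Disc →₀ ℂ) →ₗ[ℂ] (L.Disc →₀ ℂ)) : Prop :=
  ∀ τ z, jacobiSlash (Module.finrank ℝ V) (thetaVec L) g τ z = M (thetaVec L τ z)

variable {L}

theorem IsThetaTransform.one : IsThetaTransform L 1 1 := fun τ z => by
  rw [jacobiSlash_one]
  rfl

/-- Constant matrices commute with the slash operator. The right action on functions therefore
multiplies matrices in the same order as group elements. -/
theorem IsThetaTransform.mul {g h : JacobiGroup L} {M N : (L.Disc →₀ ℂ) →ₗ[ℂ] (L.Disc →₀ ℂ)}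
    (hg : IsThetaTransform L g M) (hh : IsThetaTransform L h N) :
    IsThetaTransform L (g * h) (M * N) := fun τ z => by
  have h1 : jacobiSlash (Module.finrank ℝ V) (thetaVec L) g = fun τ z => M (thetaVec L τ z) := by
    ext1 τ
    ext1 z
    exact hg τ z
  rw [jacobiSlash_mul, h1, jacobiSlash_map, hh]
  rfl

theorem ofMp_mul_heis (g : JacobiGroup L) : ofMp L g.mp * heis L g.v g.w g.ξ = g := by
  ext1
  · exact mul_one _
  · simp [JacobiGroup.v_mul, heis, ofMp]
  · simp [JacobiGroup.w_mul, heis, ofMp]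
  · simp [JacobiGroup.xi_mul, heis, ofMp, IntegralLattice.altForm]

theorem e_Q_congr (hL : L.IsEven) {x y : L.dual} (h : L.toDisc x = L.toDisc y) :
    e (L.Q (x : V)) = e (L.Q (y : V)) := by
  have hxy := (toDisc_eq_iff L x y).mp h
  obtain ⟨m, hm⟩ := hL _ hxy
  obtain ⟨m', hm'⟩ := form_dual_int L y hxy
  have := L.Q_add (y : V) (x - y)
  rw [add_sub_cancel, hm, hm'] at this
  rw [this, Complex.ofReal_add, Complex.ofReal_add, e_add, e_add, Complex.ofReal_intCast,
    Complex.ofReal_intCast, e_intCast, e_intCast, mul_one, mul_one]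

/-- The embedding of the double cover into the full Jacobi group. -/
def ofMpTop (L : IntegralLattice V) : Mp2Z →* jacobiSubgroup L ⊤ :=
  (ofMp L).codRestrict _ fun _ => ⟨trivial, zero_mem _, zero_mem _, one_pow 2⟩

/-- Every element is a product of a metaplectic and a Heisenberg element, and `T`, `S` generate the
metaplectic part. -/
theorem IsWeilRepresentation.unique {ρ ρ' : Representation ℂ (jacobiSubgroup L ⊤) (L.Disc →₀ ℂ)}
    (h : IsWeilRepresentation L ρ) (h' : IsWeilRepresentation L ρ') : ρ = ρ' := by
  have hMp : ρ.comp (ofMpTop L) = ρ'.comp (ofMpTop L) := by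
    refine MonoidHom.eq_of_eqOn_dense Mp2Z.closure_generators fun γ hγ => ?_
    refine Finsupp.lhom_ext' fun t => LinearMap.ext_ring ?_
    obtain ⟨x, rfl⟩ := Submodule.Quotient.mk_surjective _ t
    rcases hγ with rfl | rfl
    · exact (h.map_T _ rfl x).trans (h'.map_T _ rfl x).symm
    · ext s
      obtain ⟨y, rfl⟩ := Submodule.Quotient.mk_surjective _ s
      exact (h.map_S _ rfl x y).trans (h'.map_S _ rfl x y).symm
  ext1 g
  have hg : g = ofMpTop L (g : JacobiGroup L).mp *
      ⟨heis L (g : JacobiGroup L).v (g : JacobiGroup L).w (g : JacobiGroup L).ξ,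
        ⟨one_mem _, g.2.2.1, g.2.2.2.1, g.2.2.2.2⟩⟩ := Subtype.ext (ofMp_mul_heis _).symm
  rw [hg, map_mul, map_mul]
  congr 1
  · exact DFunLike.congr_fun hMp _
  · refine Finsupp.lhom_ext' fun t => LinearMap.ext_ring ?_
    exact (h.map_heis _ _ _ _ rfl t).trans (h'.map_heis _ _ _ _ rfl t).symm

variable [FiniteDimensional ℝ V]

/-- Linear maps on `ℂ[L♯/L]` are determined by their values on the vectors of theta series. -/
theorem thetaVec_ext {Y : Type*} [AddCommGroup Y] [Module ℂ Y] {A B : (L.Disc →₀ ℂ) →ₗ[ℂ] Y}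
    (τ : ℍ) (h : ∀ z, A (thetaVec L τ z) = B (thetaVec L τ z)) : A = B := by
  refine Finsupp.lhom_ext' fun t => LinearMap.ext_ring (eq_of_forall_dual fun l => ?_)
  have := theta_linearIndependent L (τ := τ)
    (f := fun t => l (A (Finsupp.single t 1)) - l (B (Finsupp.single t 1))) fun z => by
      have hz := congrArg l (h z)
      rw [map_eq_sum A, map_eq_sum B, map_sum, map_sum, ← sub_eq_zero,
        ← Finset.sum_sub_distrib] at hz
      rw [← hz]
      refine Finset.sum_congr rfl fun t _ => ?_
      rw [map_smul, map_smul, thetaVec_apply, smul_eq_mul, smul_eq_mul]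
      ring
  exact sub_eq_zero.mp (congrFun this t)

theorem IsThetaTransform.unique {g : JacobiGroup L} {M N : (L.Disc →₀ ℂ) →ₗ[ℂ] (L.Disc →₀ ℂ)}
    (hM : IsThetaTransform L g M) (hN : IsThetaTransform L g N) : M = N :=
  thetaVec_ext UpperHalfPlane.I fun z => by rw [← hM, ← hN]

/-- The range of `M` contains all theta vectors, which span. Finite dimension then makes `M`
bijective, and its inverse describes `g⁻¹`. -/
theorem IsThetaTransform.inv {g : JacobiGroup L} {M : (L.Disc →₀ ℂ) →ₗ[ℂ] (L.Disc →₀ ℂ)}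
    (hM : IsThetaTransform L g M) : ∃ N, IsThetaTransform L g⁻¹ N := by
  have h1 : jacobiSlash (Module.finrank ℝ V) (thetaVec L) g = fun τ z => M (thetaVec L τ z) := by
    ext1 τ
    ext1 z
    exact hM τ z
  have h2 : ∀ τ z, M (jacobiSlash (Module.finrank ℝ V) (thetaVec L) g⁻¹ τ z) = thetaVec L τ z := by
    intro τ z
    rw [← jacobiSlash_map, ← h1, ← jacobiSlash_mul, mul_inv_cancel, jacobiSlash_one]
  have hsurj : Function.Surjective M := by
    rw [← LinearMap.range_eq_top, ← Submodule.ker_mkQ (LinearMap.range M), LinearMap.ker_eq_top]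
    refine thetaVec_ext UpperHalfPlane.I fun z => ?_
    rw [LinearMap.zero_apply, Submodule.mkQ_apply, Submodule.Quotient.mk_eq_zero]
    exact ⟨_, h2 _ _⟩
  have hinj : Function.Injective M := LinearMap.injective_iff_surjective.mpr hsurj
  let E := LinearEquiv.ofBijective M ⟨hinj, hsurj⟩
  refine ⟨E.symm, fun τ z => ?_⟩
  rw [← h2 τ z]
  exact (E.symm_apply_apply _).symm

theorem IsThetaTransform.heis {v w : V} (hv : v ∈ L.carrier) (hw : w ∈ L.carrier) (ξ : Circle) :
    IsThetaTransform L (heis L v w ξ) (((ξ : ℂ) * e ((1 / 2) * L.form v w)) • 1) := fun τ z => by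
  ext t
  rw [jacobiSlash_thetaVec_apply, jacobiSlash_theta_heis L _ t hv hw]
  rfl

theorem IsThetaTransform.T (hL : L.IsEven) : IsThetaTransform L (ofMp L Mp2Z.T)
    (Finsupp.linearCombination ℂ fun t =>
      Finsupp.single t (e (L.Q ((Quotient.out t : L.dual) : V)))) := fun τ z => by
  ext t
  have h := jacobiSlash_theta_T L (Module.finrank ℝ V) hL (Quotient.out t) τ z
  rw [show L.toDisc (Quotient.out t) = t from Quotient.out_eq t] at h
  rw [jacobiSlash_thetaVec_apply, h, map_eq_sum]
  simp only [Finsupp.finsetSum_apply, Finsupp.smul_apply, Finsupp.linearCombination_single,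
    thetaVec_apply, one_smul, smul_eq_mul]
  rw [Finset.sum_eq_single t (fun s _ hs => by rw [Finsupp.single_eq_of_ne' hs, mul_zero])
    (fun ht => absurd (Finset.mem_univ t) ht), Finsupp.single_eq_same, mul_comm]

theorem IsThetaTransform.S : IsThetaTransform L (ofMp L Mp2Z.S)
    (Finsupp.linearCombination ℂ fun s => Finsupp.equivFunOnFinite.symm fun t =>
      (-Complex.I) ^ ((Module.finrank ℝ V : ℂ) / 2) / (Real.sqrt (Nat.card L.Disc) : ℂ) *
      e (-(L.form ((Quotient.out t : L.dual) : V) ((Quotient.out s : L.dual) : V)))) :=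
  fun τ z => by
  ext t
  have h := jacobiSlash_theta_S L (Quotient.out t) τ z
  rw [show L.toDisc (Quotient.out t) = t from Quotient.out_eq t] at h
  rw [jacobiSlash_thetaVec_apply, h, map_eq_sum, Finset.mul_sum]
  simp only [Finsupp.finsetSum_apply, Finsupp.smul_apply, Finsupp.linearCombination_single,
    thetaVec_apply, one_smul, Finsupp.equivFunOnFinite_symm_apply_apply, smul_eq_mul]
  exact Finset.sum_congr rfl fun s _ => by ring

theorem exists_thetaTransform_ofMp (hL : L.IsEven) (γ : Mp2Z) :
    ∃ M, IsThetaTransform L (ofMp L γ) M := by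
  have hγ : γ ∈ Subgroup.closure {Mp2Z.T, Mp2Z.S} := Mp2Z.closure_generators ▸ Subgroup.mem_top γ
  induction hγ using Subgroup.closure_induction with
  | mem x hx =>
    rcases hx with rfl | rfl
    · exact ⟨_, .T hL⟩
    · exact ⟨_, .S⟩
  | one => exact ⟨1, by rw [map_one]; exact .one⟩
  | mul x y _ _ hx hy =>
    obtain ⟨M, hM⟩ := hx
    obtain ⟨N, hN⟩ := hy
    exact ⟨M * N, by rw [map_mul]; exact hM.mul hN⟩
  | inv x _ hx =>
    obtain ⟨M, hM⟩ := hx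
    rw [map_inv]
    exact hM.inv

theorem exists_thetaTransform (hL : L.IsEven) (g : jacobiSubgroup L ⊤) :
    ∃ M, IsThetaTransform L (g : JacobiGroup L) M := by
  obtain ⟨M, hM⟩ := exists_thetaTransform_ofMp hL (g : JacobiGroup L).mp
  have := hM.mul (IsThetaTransform.heis g.2.2.1 g.2.2.2.1 (g : JacobiGroup L).ξ)
  rw [ofMp_mul_heis] at this
  exact ⟨_, this⟩

/-- The Weil representation of the Jacobi group of an even lattice. -/
def weilRep (hL : L.IsEven) : Representation ℂ (jacobiSubgroup L ⊤) (L.Disc →₀ ℂ) where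
  -- The arbitrary choice is harmless: the theta transform of `g` is unique, and this uniqueness
  -- also gives multiplicativity.
  toFun g := (exists_thetaTransform hL g).choose
  map_one' := (exists_thetaTransform hL 1).choose_spec.unique .one
  map_mul' g h := (exists_thetaTransform hL (g * h)).choose_spec.unique
    ((exists_thetaTransform hL g).choose_spec.mul (exists_thetaTransform hL h).choose_spec)

theorem isThetaTransform_weilRep (hL : L.IsEven) (g : jacobiSubgroup L ⊤) :
    IsThetaTransform L (g : JacobiGroup L) (weilRep hL g) :=
  (exists_thetaTransform hL g).choose_spec

theorem isWeilRepresentation_weilRep (hL : L.IsEven) : IsWeilRepresentation L (weilRep hL) where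
  map_T g hg x := by
    have h := isThetaTransform_weilRep hL g
    rw [hg] at h
    rw [h.unique (.T hL), Finsupp.linearCombination_single, one_smul,
      e_Q_congr hL (Quotient.out_eq (L.toDisc x))]
  map_S g hg x y := by
    have h := isThetaTransform_weilRep hL g
    rw [hg] at h
    rw [h.unique .S, Finsupp.linearCombination_single, one_smul,
      Finsupp.equivFunOnFinite_symm_apply_apply,
      e_neg_form_congr L _ (y' := x) (Quotient.out_eq (L.toDisc x)), L.symm,
      e_neg_form_congr L _ (y' := y) (Quotient.out_eq (L.toDisc y))]
  map_heis g v w ξ hg x := by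
    have h := isThetaTransform_weilRep hL g
    rw [hg] at h
    have hv : v ∈ L.carrier := by
      have := g.2.2.1
      rwa [hg] at this
    have hw : w ∈ L.carrier := by
      have := g.2.2.2.1
      rwa [hg] at this
    rw [h.unique (.heis hv hw ξ)]
    simp

end Weil

/-! ### The theta lift -/

section Contraction

variable {D : Type*} {W : Type*} [AddCommGroup W] [Module ℂ W]

/-- The contraction `W ⊗ ℂ[D]* → W` with an element of `ℂ[D]`. -/
def contract : (D →₀ ℂ) →ₗ[ℂ] (W ⊗[ℂ] Module.Dual ℂ (D →₀ ℂ)) →ₗ[ℂ] W :=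
  (TensorProduct.lift (LinearMap.smulRightₗ (R := ℂ) (M := W) (M₂ := D →₀ ℂ)).flip).flip

theorem contract_tmul (x : D →₀ ℂ) (w : W) (f : Module.Dual ℂ (D →₀ ℂ)) :
    contract x (w ⊗ₜ[ℂ] f) = f x • w := by
  simp [contract]

theorem eq_sum_contract [Fintype D] (X : W ⊗[ℂ] Module.Dual ℂ (D →₀ ℂ)) :
    X = ∑ t, contract (Finsupp.single t 1) X ⊗ₜ[ℂ] Finsupp.lapply t := by
  induction X with
  | zero => simp
  | add X Y hX hY =>
    conv_lhs => rw [hX, hY]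
    simp only [map_add, TensorProduct.add_tmul, Finset.sum_add_distrib]
  | tmul w f =>
    simp only [contract_tmul, TensorProduct.smul_tmul]
    rw [← TensorProduct.tmul_sum]
    congr 1
    refine LinearMap.ext fun x => ?_
    rw [map_eq_sum f x]
    simp only [LinearMap.sum_apply, LinearMap.smul_apply, Finsupp.lapply_apply, smul_eq_mul]
    exact Finset.sum_congr rfl fun t _ => mul_comm _ _

theorem eq_zero_of_contract [Fintype D] {X : W ⊗[ℂ] Module.Dual ℂ (D →₀ ℂ)}
    (h : (contract (D := D) (W := W)).flip X = 0) : X = 0 := by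
  rw [eq_sum_contract X]
  refine Finset.sum_eq_zero fun t _ => ?_
  have := LinearMap.congr_fun h (Finsupp.single t 1)
  rw [LinearMap.flip_apply, LinearMap.zero_apply] at this
  rw [this, TensorProduct.zero_tmul]

theorem contract_transpose (R : (D →₀ ℂ) →ₗ[ℂ] (D →₀ ℂ)) (x : D →₀ ℂ)
    (X : W ⊗[ℂ] Module.Dual ℂ (D →₀ ℂ)) :
    contract x (LinearMap.lTensor W (Module.Dual.transpose (R := ℂ) R) X) = contract (R x) X := by
  induction X with
  | zero => simp
  | add X Y hX hY => simp only [map_add, hX, hY]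
  | tmul w f =>
    rw [LinearMap.lTensor_tmul, contract_tmul, contract_tmul]
    rfl

end Contraction

/-! ### Transformation law and `q`-expansions of the theta lift -/

section Lift

variable {V : Type*} [AddCommGroup V] [Module ℝ V]
variable {W : Type*} [AddCommGroup W] [Module ℂ W]
variable {L : IntegralLattice V} {G : Subgroup SL(2, ℤ)}

theorem contract_thetaVec_sum (τ : ℍ) (z : ℂ ⊗[ℝ] V) (h : L.Disc → W) :
    contract (thetaVec L τ z) (∑ t, h t ⊗ₜ[ℂ] dualDelta L t) = ∑ t, theta L t τ z • h t := by
  simp only [map_sum, contract_tmul]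
  rfl

/-- The weight splits as `k = (k - n/2) + n/2`, where the theta vector carries `n/2`, with `n = dim
V`, and the whole elliptic factor. -/
theorem jacobiSlash_contract (κ : ℤ) (h : ℍ → W ⊗[ℂ] Module.Dual ℂ (L.Disc →₀ ℂ)) (γ : Mp2Z)
    (τ : ℍ) (z : ℂ ⊗[ℝ] V) :
    jacobiSlash κ (fun τ z => contract (thetaVec L τ z) (h τ)) (ofMp L γ) τ z =
      contract (jacobiSlash (Module.finrank ℝ V) (thetaVec L) (ofMp L γ) τ z)
        (slash (κ - Module.finrank ℝ V) h γ τ) := by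
  simp only [jacobiSlash, slash, map_smul, LinearMap.smul_apply, smul_smul]
  congr 1
  have : γ.root τ ^ (-κ) =
      γ.root τ ^ (-(κ - Module.finrank ℝ V)) * γ.root τ ^ (-(Module.finrank ℝ V : ℤ)) := by
    rw [← zpow_add₀ (γ.root_ne_zero τ)]
    congr 1
    ring
  change γ.root τ ^ (-κ) * _ = γ.root τ ^ (-(κ - Module.finrank ℝ V)) *
    (γ.root τ ^ (-(Module.finrank ℝ V : ℤ)) * _)
  rw [this, mul_assoc]

theorem vHasSum_theta_lift {c : ℝ → V → W} {H : L.Disc → ℍ → W}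
    (hH : ∀ (t : L.dual) (τ : ℍ),
      VHasSum (fun n : ℝ => e (n * τ) • c (n + L.Q (t : V)) (t : V)) (H (L.toDisc t) τ))
    {r : L.Disc → L.dual} (hr : ∀ t, L.toDisc (r t) = t) (τ : ℍ) :
    VHasSum (fun n : ℝ => e (n * τ) •
      ∑ t, c (n + L.Q (r t : V)) (r t : V) ⊗ₜ[ℂ] dualDelta L t)
      (∑ t, H t τ ⊗ₜ[ℂ] dualDelta L t) := by
  have h1 := VHasSum.sum (s := Finset.univ) fun t _ =>
    (hH (r t) τ).map ((TensorProduct.mk ℂ W (Module.Dual ℂ (L.Disc →₀ ℂ))).flip (dualDelta L t))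
  simp only [hr] at h1
  refine fun l => (h1 l).congr_fun fun n => ?_
  simp only [Finset.smul_sum]
  rfl

theorem exists_dual_torsion : ∃ M : ℕ, 0 < M ∧ ∀ t ∈ L.dual, (M : ℤ) • t ∈ L.carrier := by
  refine ⟨Nat.card L.Disc, Nat.card_pos, fun t ht => ?_⟩
  have h1 : Nat.card L.Disc • L.toDisc ⟨t, ht⟩ = 0 := card_nsmul_eq_zero'
  have h2 : L.toDisc (Nat.card L.Disc • ⟨t, ht⟩) = L.toDisc 0 := h1
  have h3 := (toDisc_eq_iff L _ _).mp h2
  simpa using h3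

/-- The values of `Q` on the dual lattice have bounded denominators. -/
theorem exists_Q_denominator : ∃ M : ℕ, 0 < M ∧ ∀ t : L.dual, ∃ m : ℤ, (M : ℝ) * L.Q (t : V) = m := by
  obtain ⟨M, hM, h⟩ := exists_dual_torsion (L := L)
  refine ⟨2 * M, by positivity, fun t => ?_⟩
  obtain ⟨m, hm⟩ := form_dual_int L t (h t t.2)
  refine ⟨m, ?_⟩
  rw [← Int.cast_smul_eq_zsmul ℝ, map_smul, smul_eq_mul] at hm
  rw [← hm, IntegralLattice.Q]
  push_cast
  ring

/-- The `q`-expansion of the theta lift. -/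
theorem isQExpansion_theta_lift {F : ℍ → ℂ ⊗[ℝ] V → W} {c : ℝ → V → W}
    (hc : IsFourierExpansion L F c) {H : L.Disc → ℍ → W}
    (hH : ∀ (t : L.dual) (τ : ℍ),
      VHasSum (fun n : ℝ => e (n * τ) • c (n + L.Q (t : V)) (t : V)) (H (L.toDisc t) τ))
    {Y : Type*} [AddCommGroup Y] [Module ℂ Y]
    (A : (W ⊗[ℂ] Module.Dual ℂ (L.Disc →₀ ℂ)) →ₗ[ℂ] Y) :
    ∃ a : ℝ → Y, IsQExpansion (fun τ => A (∑ t, H t τ ⊗ₜ[ℂ] dualDelta L t)) a ∧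
      ∀ n, a n ≠ 0 → ∃ t : L.Disc, c (n + L.Q ((Quotient.out t : L.dual) : V))
        ((Quotient.out t : L.dual) : V) ≠ 0 := by
  have hne : ∀ n, A (∑ t : L.Disc, c (n + L.Q ((Quotient.out t : L.dual) : V))
        ((Quotient.out t : L.dual) : V) ⊗ₜ[ℂ] dualDelta L t) ≠ 0 →
      ∃ t : L.Disc, c (n + L.Q ((Quotient.out t : L.dual) : V))
        ((Quotient.out t : L.dual) : V) ≠ 0 := by
    intro n hn
    by_contra! hcon
    exact hn (by simp [hcon])
  refine ⟨fun n => A (∑ t : L.Disc, c (n + L.Q ((Quotient.out t : L.dual) : V))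
    ((Quotient.out t : L.dual) : V) ⊗ₜ[ℂ] dualDelta L t), ⟨?_, fun τ => ?_⟩, hne⟩
  · obtain ⟨N, hN, hNc⟩ := hc.support
    obtain ⟨M, hM, hMQ⟩ := exists_Q_denominator (L := L)
    -- `n` is a difference of `n + Q(t) ∈ (1/N)ℤ` and `Q(t) ∈ (1/M)ℤ`.
    refine ⟨N * M, Nat.mul_pos hN hM, fun n hn => ?_⟩
    obtain ⟨t, ht⟩ := hne n hn
    obtain ⟨⟨m, hm⟩, -⟩ := hNc _ _ ht
    obtain ⟨m', hm'⟩ := hMQ (Quotient.out t)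
    refine ⟨M * m - N * m', ?_⟩
    push_cast
    rw [← hm, ← hm']
    ring
  · have := (vHasSum_theta_lift hH (r := Quotient.out) (fun t => Quotient.out_eq t) τ).map A
    simpa only [map_smul] using this

variable [FiniteDimensional ℝ V]

/-- For fixed `τ` the theta vectors span `ℂ[L♯/L]`. Identities for the lift can thus be tested on
the Jacobi form itself. -/
theorem contract_thetaVec_injective {τ : ℍ} {X Y : W ⊗[ℂ] Module.Dual ℂ (L.Disc →₀ ℂ)}
    (h : ∀ z, contract (thetaVec L τ z) X = contract (thetaVec L τ z) Y) : X = Y := by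
  rw [← sub_eq_zero]
  refine eq_zero_of_contract (thetaVec_ext τ fun z => ?_)
  rw [LinearMap.flip_apply, map_sub, h, sub_self, LinearMap.zero_apply]

theorem slash_eq_of_contract (hL : L.IsEven) {κ : ℤ} {φ : ℍ → ℂ ⊗[ℝ] V → W}
    {h : ℍ → W ⊗[ℂ] Module.Dual ℂ (L.Disc →₀ ℂ)}
    (hφ : ∀ τ z, contract (thetaVec L τ z) (h τ) = φ τ z) (γ : Mp2Z) (τ : ℍ) (z : ℂ ⊗[ℝ] V) :
    contract (weilRep hL (ofMpTop L γ) (thetaVec L τ z)) (slash (κ - Module.finrank ℝ V) h γ τ) =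
      jacobiSlash κ φ (ofMp L γ) τ z := by
  have h1 : φ = fun τ z => contract (thetaVec L τ z) (h τ) := by
    ext τ z
    exact (hφ τ z).symm
  rw [h1, jacobiSlash_contract, ← isThetaTransform_weilRep hL (ofMpTop L γ)]
  rfl

/-- Modular transformations of the theta lift. -/
theorem slash_eq_thetaRepresentation (hL : L.IsEven) {κ : ℤ}
    {ρ : Representation ℂ (jacobiSubgroup L G) W} {φ : ℍ → ℂ ⊗[ℝ] V → W}
    (hφ : φ ∈ jacobiHol κ ρ) {h : ℍ → W ⊗[ℂ] Module.Dual ℂ (L.Disc →₀ ℂ)}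
    (hh : ∀ τ z, contract (thetaVec L τ z) (h τ) = φ τ z) (γ : Mp2Z.preimage G) (τ : ℍ) :
    slash (κ - Module.finrank ℝ V) h (γ : Mp2Z) τ =
      thetaRepresentation L G ρ (weilRep hL) γ (h τ) := by
  set R := weilRep hL (ofMpTop L γ) with hR
  have hRinv : weilRep hL (ofMpTop L γ)⁻¹ * R = 1 := by
    rw [hR, ← map_mul, inv_mul_cancel, map_one]
  -- Evaluation pairs `ρL` with its dual invariantly, so only the action of `ρ` survives the
  -- contraction.
  have hσ : ∀ (x : L.Disc →₀ ℂ) (X : W ⊗[ℂ] Module.Dual ℂ (L.Disc →₀ ℂ)),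
      contract (R x) (thetaRepresentation L G ρ (weilRep hL) γ X) =
        ρ (mpToJacobi L G γ) (contract x X) := by
    intro x X
    induction X with
    | zero => simp
    | add X Y hX hY => simp only [map_add, hX, hY]
    | tmul w f =>
      have h1 : thetaRepresentation L G ρ (weilRep hL) γ (w ⊗ₜ[ℂ] f) =
          ρ (mpToJacobi L G γ) w ⊗ₜ[ℂ] (f ∘ₗ weilRep hL (ofMpTop L γ)⁻¹) := rfl
      rw [h1, contract_tmul, contract_tmul, map_smul]
      congr 1
      exact congrArg f (LinearMap.congr_fun hRinv x)
  have key : ∀ z, contract (R (thetaVec L τ z)) (slash (κ - Module.finrank ℝ V) h (γ : Mp2Z) τ) =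
      contract (R (thetaVec L τ z)) (thetaRepresentation L G ρ (weilRep hL) γ (h τ)) := by
    intro z
    rw [slash_eq_of_contract hL hh, hσ, hh]
    exact hφ.2 (mpToJacobi L G γ) τ z
  have hRinv' : R * weilRep hL (ofMpTop L γ)⁻¹ = 1 := by
    rw [hR, ← map_mul, mul_inv_cancel, map_one]
  rw [← sub_eq_zero]
  refine eq_zero_of_contract ?_
  -- The identity is known only after precomposition with `R`, and invertibility of `R` removes it.
  have h2 : (contract (D := L.Disc) (W := W)).flip
      (slash (κ - Module.finrank ℝ V) h (γ : Mp2Z) τ -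
        thetaRepresentation L G ρ (weilRep hL) γ (h τ)) ∘ₗ R = 0 :=
    thetaVec_ext τ fun z => by
      rw [LinearMap.comp_apply, LinearMap.flip_apply, map_sub, key, sub_self, LinearMap.zero_apply]
  refine LinearMap.ext fun x => ?_
  have h3 := LinearMap.congr_fun h2 (weilRep hL (ofMpTop L γ)⁻¹ x)
  rw [LinearMap.comp_apply] at h3
  rwa [show R (weilRep hL (ofMpTop L γ)⁻¹ x) = x from LinearMap.congr_fun hRinv' x] at h3

/-- The theta lift at an arbitrary cusp. -/
theorem slash_eq_lTensor (hL : L.IsEven) {κ : ℤ} {φ : ℍ → ℂ ⊗[ℝ] V → W}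
    {h : ℍ → W ⊗[ℂ] Module.Dual ℂ (L.Disc →₀ ℂ)}
    (hh : ∀ τ z, contract (thetaVec L τ z) (h τ) = φ τ z) (γ : Mp2Z)
    {H : L.Disc → ℍ → W}
    (hH : ∀ τ z, jacobiSlash κ φ (ofMp L γ) τ z = ∑ t, theta L t τ z • H t τ) (τ : ℍ) :
    slash (κ - Module.finrank ℝ V) h γ τ =
      LinearMap.lTensor W (Module.Dual.transpose (R := ℂ) (weilRep hL (ofMpTop L γ)⁻¹))
        (∑ t, H t τ ⊗ₜ[ℂ] dualDelta L t) := by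
  have h1 : LinearMap.lTensor W (Module.Dual.transpose (R := ℂ) (weilRep hL (ofMpTop L γ)))
      (slash (κ - Module.finrank ℝ V) h γ τ) = ∑ t, H t τ ⊗ₜ[ℂ] dualDelta L t :=
    contract_thetaVec_injective fun z => by
      rw [contract_transpose, slash_eq_of_contract hL hh, hH, contract_thetaVec_sum]
  rw [← h1, ← LinearMap.comp_apply, ← LinearMap.lTensor_comp]
  have h2 : Module.Dual.transpose (R := ℂ) (weilRep hL (ofMpTop L γ)⁻¹) ∘ₗ
      Module.Dual.transpose (R := ℂ) (weilRep hL (ofMpTop L γ)) = LinearMap.id := by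
    ext1 f
    change f ∘ₗ (weilRep hL (ofMpTop L γ) * weilRep hL (ofMpTop L γ)⁻¹) = f
    rw [← map_mul, mul_inv_cancel, map_one]
    rfl
  rw [h2, LinearMap.lTensor_id, LinearMap.id_apply]

end Lift

/-! ### The lift as a linear map between spaces of forms -/

section ThetaLift

variable {V : Type*} [AddCommGroup V] [Module ℝ V] {W : Type*} [AddCommGroup W] [Module ℂ W]
variable {L : IntegralLattice V} {G : Subgroup SL(2, ℤ)}
variable {κ : ℤ} {ρ : Representation ℂ (jacobiSubgroup L G) W}

theorem jacobiSlash_ofMp_one (φ : ℍ → ℂ ⊗[ℝ] V → W) : jacobiSlash κ φ (ofMp L 1) = φ := by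
  rw [map_one, jacobiSlash_one]

theorem ofMp_mem_jacobiSubgroup_top (γ : Mp2Z) : ofMp L γ ∈ jacobiSubgroup L ⊤ :=
  (ofMpTop L γ).2

/-- The vector-valued function attached to a Fourier expansion of a Jacobi form. -/
theorem exists_theta_lift [FiniteDimensional ℂ W]
    (hρ : ∀ a b : ℤ, IsCoprime a b → ∀ v ∈ L.carrier, ∀ g : jacobiSubgroup L G,
      (g : JacobiGroup L) = heis L (a • v) (b • v) 1 → ρ g = 1)
    {φ : ℍ → ℂ ⊗[ℝ] V → W} (hφ : φ ∈ jacobiHol κ ρ) {c : ℝ → V → W}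
    (hc : IsFourierExpansion L φ c) :
    ∃ Θ : ℍ → W ⊗[ℂ] Module.Dual ℂ (L.Disc →₀ ℂ), IsHol Θ ∧
      (∀ τ z, contract (thetaVec L τ z) (Θ τ) = φ τ z) ∧
      ∀ r : L.Disc → L.dual, (∀ t, L.toDisc (r t) = t) → ∀ τ : ℍ,
        VHasSum (fun n : ℝ => e (n * τ) •
          ∑ t, c (n + L.Q (r t : V)) (r t : V) ⊗ₜ[ℂ] dualDelta L t) (Θ τ) := by
  rw [← jacobiSlash_ofMp_one (κ := κ) φ] at hc
  obtain ⟨h, hhol, hsum, hdec⟩ := exists_theta_decomposition hρ hφ 1 hc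
  refine ⟨fun τ => ∑ t, h t τ ⊗ₜ[ℂ] dualDelta L t, ?_, fun τ z => ?_, fun r hr τ => ?_⟩
  · exact IsHol.sum fun t _ =>
      (hhol t).map ((TensorProduct.mk ℂ W (Module.Dual ℂ (L.Disc →₀ ℂ))).flip (dualDelta L t))
  · rw [contract_thetaVec_sum, ← hdec, jacobiSlash_ofMp_one]
  · exact vHasSum_theta_lift hsum hr τ

variable [FiniteDimensional ℝ V]

theorem theta_lift_mem_modularHol (hL : L.IsEven) {φ : ℍ → ℂ ⊗[ℝ] V → W} (hφ : φ ∈ jacobiHol κ ρ)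
    {Θ : ℍ → W ⊗[ℂ] Module.Dual ℂ (L.Disc →₀ ℂ)} (hhol : IsHol Θ)
    (hΘ : ∀ τ z, contract (thetaVec L τ z) (Θ τ) = φ τ z) :
    Θ ∈ modularHol (κ - Module.finrank ℝ V) (thetaRepresentation L G ρ (weilRep hL)) :=
  ⟨hhol, slash_eq_thetaRepresentation hL hφ hΘ⟩


variable [FiniteDimensional ℂ W]

/-- The `q`-expansions of the theta lift at all cusps. -/
theorem exists_isQExpansion_slash
    (hρ : ∀ a b : ℤ, IsCoprime a b → ∀ v ∈ L.carrier, ∀ g : jacobiSubgroup L G,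
      (g : JacobiGroup L) = heis L (a • v) (b • v) 1 → ρ g = 1) (hL : L.IsEven)
    {φ : ℍ → ℂ ⊗[ℝ] V → W} (hφ : φ ∈ jacobiHol κ ρ)
    {Θ : ℍ → W ⊗[ℂ] Module.Dual ℂ (L.Disc →₀ ℂ)}
    (hΘ : ∀ τ z, contract (thetaVec L τ z) (Θ τ) = φ τ z) (γ : Mp2Z) {c : ℝ → V → W}
    (hc : IsFourierExpansion L (jacobiSlash κ φ (ofMp L γ)) c) :
    ∃ a, IsQExpansion (slash (κ - Module.finrank ℝ V) Θ γ) a ∧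
      ∀ n, a n ≠ 0 → ∃ t : L.Disc, c (n + L.Q ((Quotient.out t : L.dual) : V))
        ((Quotient.out t : L.dual) : V) ≠ 0 := by
  obtain ⟨H, -, hsum, hdec⟩ := exists_theta_decomposition hρ hφ γ hc
  rw [funext (slash_eq_lTensor hL hΘ γ hdec)]
  exact isQExpansion_theta_lift hc hsum _


/-- The theta lift as a linear map. -/
theorem exists_linear_theta_lift
    (hρ : ∀ a b : ℤ, IsCoprime a b → ∀ v ∈ L.carrier, ∀ g : jacobiSubgroup L G,
      (g : JacobiGroup L) = heis L (a • v) (b • v) 1 → ρ g = 1) (hL : L.IsEven) :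
    ∃ Θ : weaklyHolJacobiForms κ ρ →ₗ[ℂ] weaklyHolModularForms (κ - Module.finrank ℝ V)
        (thetaRepresentation L G ρ (weilRep hL)),
      (∀ φ τ z, contract (thetaVec L τ z) ((Θ φ).1 τ) = φ.1 τ z) ∧
      ∀ (φ : weaklyHolJacobiForms κ ρ) (c : ℝ → V → W), IsFourierExpansion L φ.1 c →
        ∀ r : L.Disc → L.dual, (∀ t, L.toDisc (r t) = t) → ∀ τ : ℍ,
          VHasSum (fun n : ℝ => e (n * τ) •
            ∑ t, c (n + L.Q (r t : V)) (r t : V) ⊗ₜ[ℂ] dualDelta L t) ((Θ φ).1 τ) := by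
  have key : ∀ φ : weaklyHolJacobiForms κ ρ,
      ∃ Θ : weaklyHolModularForms (κ - Module.finrank ℝ V)
        (thetaRepresentation L G ρ (weilRep hL)),
      ∀ τ z, contract (thetaVec L τ z) (Θ.1 τ) = φ.1 τ z := by
    rintro ⟨φ, hφ, hφc⟩
    obtain ⟨N, c, hc, -⟩ := hφc _ (ofMp_mem_jacobiSubgroup_top 1)
    rw [jacobiSlash_ofMp_one] at hc
    obtain ⟨Θ, hhol, hΘ, -⟩ := exists_theta_lift hρ hφ hc
    refine ⟨⟨Θ, theta_lift_mem_modularHol hL hφ hhol hΘ, fun γ => ?_⟩, hΘ⟩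
    obtain ⟨N, c, hc, hN⟩ := hφc _ (ofMp_mem_jacobiSubgroup_top γ)
    obtain ⟨a, ha, hac⟩ := exists_isQExpansion_slash hρ hL hφ hΘ γ hc
    -- A nonzero coefficient at `n` forces `n + Q(t) ≥ N` for one of finitely many representatives
    -- `t`, so the exponents are at least `N - B`.
    obtain ⟨B, hB⟩ := (Set.finite_range fun t : L.Disc =>
      L.Q ((Quotient.out t : L.dual) : V)).bddAbove
    obtain ⟨M, hM⟩ := exists_rat_lt ((N : ℝ) - B)
    refine ⟨M, a, ha, fun n hn => ?_⟩
    obtain ⟨t, ht⟩ := hac n hn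
    have h1 := hN _ _ ht
    have h2 := hB (Set.mem_range_self t)
    linarith
  choose Θ hΘ using key
  -- The lift of each form is unique by injectivity of the contraction. Hence it is linear and
  -- agrees with the series built from any Fourier expansion and any representatives.
  refine ⟨{ toFun := Θ, map_add' := fun φ ψ => ?_, map_smul' := fun a φ => ?_ }, hΘ,
    fun φ c hc r hr τ => ?_⟩
  · refine Subtype.ext (funext fun τ => contract_thetaVec_injective (τ := τ) fun z => ?_)
    rw [hΘ]
    change _ = contract (thetaVec L τ z) ((Θ φ).1 τ + (Θ ψ).1 τ)
    rw [map_add, hΘ, hΘ]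
    rfl
  · refine Subtype.ext (funext fun τ => contract_thetaVec_injective (τ := τ) fun z => ?_)
    rw [hΘ]
    change _ = contract (thetaVec L τ z) (a • (Θ φ).1 τ)
    rw [map_smul, hΘ]
    rfl
  · obtain ⟨Θ', -, hΘ', hsum⟩ := exists_theta_lift hρ φ.2.1 hc
    have : (Θ φ).1 τ = Θ' τ := contract_thetaVec_injective (τ := τ) fun z => by
      rw [hΘ, hΘ']
    change VHasSum _ ((Θ φ).1 τ)
    rw [this]
    exact hsum r hr τ

/-- A coefficient of `qⁿ` can be nonzero only if some `c(n + Q(t), t)` is, and there the Jacobi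
condition reads `P n`. Holomorphy and vanishing at the cusps are thus treated together. -/
theorem theta_lift_mem_modularFormsWith
    (hρ : ∀ a b : ℤ, IsCoprime a b → ∀ v ∈ L.carrier, ∀ g : jacobiSubgroup L G,
      (g : JacobiGroup L) = heis L (a • v) (b • v) 1 → ρ g = 1) (hL : L.IsEven) {P : ℝ → Prop}
    {φ : ℍ → ℂ ⊗[ℝ] V → W} (hφ : φ ∈ jacobiFormsWith P κ ρ)
    {Θ : ℍ → W ⊗[ℂ] Module.Dual ℂ (L.Disc →₀ ℂ)} (hhol : IsHol Θ)
    (hΘ : ∀ τ z, contract (thetaVec L τ z) (Θ τ) = φ τ z) :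
    Θ ∈ modularFormsWith P (κ - Module.finrank ℝ V) (thetaRepresentation L G ρ (weilRep hL)) := by
  refine ⟨theta_lift_mem_modularHol hL hφ.1 hhol hΘ, fun γ => ?_⟩
  obtain ⟨c, hc, hP⟩ := hφ.2 _ (ofMp_mem_jacobiSubgroup_top γ)
  obtain ⟨a, ha, hac⟩ := exists_isQExpansion_slash hρ hL hφ.1 hΘ γ hc
  refine ⟨a, ha, fun n hn => ?_⟩
  obtain ⟨t, ht⟩ := hac n hn
  simpa using hP _ _ ht

end ThetaLift

end

end LatticeJacobi

/-! ### The theorem -/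

theorem mainTheorem6 {V : Type*} [AddCommGroup V] [Module ℝ V] [FiniteDimensional ℝ V]
    {W : Type*} [AddCommGroup W] [Module ℂ W] [FiniteDimensional ℂ W]
    (L : IntegralLattice V) (G : Subgroup SL(2, ℤ)) (hG : G.FiniteIndex)
    -- the weight is `k = κ / 2`
    (κ : ℤ)
    (ρ : Representation ℂ (jacobiSubgroup L G) W) (hker : (MonoidHom.ker ρ).FiniteIndex)
    (hρ : ∀ a b : ℤ, IsCoprime a b → ∀ v ∈ L.carrier, ∀ g : jacobiSubgroup L G,
      (g : JacobiGroup L) = heis L (a • v) (b • v) 1 → ρ g = 1) :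
    -- the theta decomposition at all cusps, for even and odd lattices
    (∀ φ ∈ weaklyHolJacobiForms κ ρ, ∀ γ : Mp2Z, ∃ c : ℝ → V → W,
      IsFourierExpansion L (jacobiSlash κ φ (ofMp L γ)) c ∧
      (∀ c', IsFourierExpansion L (jacobiSlash κ φ (ofMp L γ)) c' → c' = c) ∧
      ∃ h : L.Disc → ℍ → W,
        (∀ t, IsHol (h t)) ∧
        (∀ (t : L.dual) (τ : ℍ),
          VHasSum (fun n : ℝ => e (n * τ) • c (n + L.Q (t : V)) (t : V)) (h (L.toDisc t) τ)) ∧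
        ∀ τ z, jacobiSlash κ φ (ofMp L γ) τ z = ∑ t, theta L t τ z • h t τ) ∧
    -- the embeddings into spaces of modular forms, for even lattices
    (L.IsEven → ∃ ρL : Representation ℂ (jacobiSubgroup L ⊤) (L.Disc →₀ ℂ),
      IsWeilRepresentation L ρL ∧
      (∀ ρ', IsWeilRepresentation L ρ' → ρ' = ρL) ∧
      ∃ Θ : weaklyHolJacobiForms κ ρ →ₗ[ℂ]
          weaklyHolModularForms (κ - Module.finrank ℝ V) (thetaRepresentation L G ρ ρL),
        Function.Injective Θ ∧
        (∀ (φ : weaklyHolJacobiForms κ ρ) (c : ℝ → V → W), IsFourierExpansion L φ.1 c →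
          ∀ r : L.Disc → L.dual, (∀ t, L.toDisc (r t) = t) → ∀ τ : ℍ,
            VHasSum (fun n : ℝ => e (n * τ) •
              ∑ t, c (n + L.Q (r t : V)) (r t : V) ⊗ₜ[ℂ] dualDelta L t) ((Θ φ).1 τ)) ∧
        (∀ φ, φ.1 ∈ jacobiForms κ ρ →
          (Θ φ).1 ∈ modularForms (κ - Module.finrank ℝ V) (thetaRepresentation L G ρ ρL)) ∧
        (∀ φ, φ.1 ∈ jacobiCuspForms κ ρ →
          (Θ φ).1 ∈ cuspForms (κ - Module.finrank ℝ V) (thetaRepresentation L G ρ ρL))) := by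
  refine ⟨fun φ hφ γ => ?_, fun hL => ⟨weilRep hL, isWeilRepresentation_weilRep hL,
    fun ρ' h => h.unique (isWeilRepresentation_weilRep hL), ?_⟩⟩
  · obtain ⟨-, c, hc, -⟩ := hφ.2 _ (ofMp_mem_jacobiSubgroup_top γ)
    exact ⟨c, hc, fun c' hc' => hc'.unique hc, exists_theta_decomposition hρ hφ.1 γ hc⟩
  · obtain ⟨Θ, hΘ, hsum⟩ := exists_linear_theta_lift (κ := κ) hρ hL
    refine ⟨Θ, fun φ ψ h => Subtype.ext (funext fun τ => funext fun z => ?_), hsum,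
      fun φ hφ => theta_lift_mem_modularFormsWith hρ hL hφ (Θ φ).2.1.1 (hΘ φ),
      fun φ hφ => theta_lift_mem_modularFormsWith hρ hL hφ (Θ φ).2.1.1 (hΘ φ)⟩
    -- A form is recovered from its lift by contraction with the theta vector.
    rw [← hΘ φ, ← hΘ ψ, h]
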